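/- **Setting.** Let $\mathbb K$ be an algebraic closure of $\mathbb C(q)$, with a chosen square root $q^{1/2}$ of $q$. Let $A=(a_{ij})_{i,j\in I}$, $I=\{0,1,\dots,n\}$, be the untwisted affine Cartan matrix of type $A_n^{(1)}$ ($n\ge1$), $B_n^{(1)}$ ($n\ge2$), $C_n^{(1)}$ ($n\ge1$) or $D_n^{(1)}$ ($n\ge3$), with standard labelling, corresponding to $\mathfrak{sl}_N$ ($N=n+1$), $\mathfrak{so}_N$ ($N=2n+1$), $\mathfrak{sp}_N$ ($N=2n$), $\mathfrak{so}_N$ ($N=2n$). (Conventions for small ranks: $B_2^{(1)}$ has bonds $0\Rightarrow 2\Leftarrow 1$; $C_1^{(1)}$ has the Cartan matrix of $A_1^{(1)}$; $D_3^{(1)}$ is the 4-cycle $0-2-1-3-0$.) Put $d_i=1$, except $d_n=\tfrac12$ in type $B$ and $d_0=d_n=2$ in type $C$, so that $d_ia_{ij}=d_ja_{ji}$; put $q_i=q^{d_i}$, and $x^{(r)}=x^r/[r]_{q_i}!$ for $x=x_i$ or $x=y_i$. $U_q(\mathfrak g)$ is the $\mathbb K$-algebra generated by $x_i,y_i,k_i^{\pm1}$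 ($i\in I$) with relations $k_ik_j=k_jk_i$, $k_ix_j=q_i^{a_{ij}}x_jk_i$, $k_iy_j=q_i^{-a_{ij}}y_jk_i$, $[x_i,y_j]=\delta_{ij}\frac{k_i-k_i^{-1}}{q_i-q_i^{-1}}$ and, for $i\neq j$, the quantum Serre relations $\sum_{r=0}^{1-a_{ij}}(-1)^r z_i^{(1-a_{ij}-r)}z_jz_i^{(r)}=0$ for $z=x$ and $z=y$. Its antipode $S$ is the algebra anti-automorphism with $S(x_i)=-k_i^{-1}x_i$, $S(y_i)=-y_ik_i$, $S(k_i)=k_i^{-1}$. Every $\sigma\in\mathrm{Aut}(A)=\{\sigma\in\mathrm{Sym}(I): a_{\sigma(i)\sigma(j)}=a_{ij}\ \forall i,j\}$ acts on $U_q(\mathfrak g)$ by $x_i\mapsto x_{\sigma(i)}$, $y_i\mapsto y_{\sigma(i)}$, $k_i\mapsto k_{\sigma(i)}$. **Vector representation.** Let $\langle N\rangle=\{1,\dots,N\}$ for $\mathfrak{sl}_N$, $\{-n,\dots,n\}$ for $\mathfrak{so}_{2n+1}$ and $\{-n,\dots,n\}\setminus\{0\}$ for $\mathfrak{sp}_{2n},\mathfrak{so}_{2n}$,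 and let $E_{ab}$ ($a,b\in\langle N\rangle$) be the elementary matrices. In the orthogonal and symplectic cases set $F_{ab}=E_{ab}-\vartheta_a\vartheta_bE_{-b,-a}$, where $\vartheta_a=1$ (orthogonal) or $\vartheta_a=\mathrm{sgn}(a)$ (symplectic), and let $\vartheta=1$ or $\vartheta=-1$, respectively; write $\bar\imath=n+1-i$. For invertible $u$ the representation $T_u$ of $U_q(\mathfrak g)$ is given as follows, where $T_u(k_i)=q^{h_i}$ with $h_i$ diagonal. * $\mathfrak{sl}_N$: $T_u(x_i)=E_{i,i+1}$, $T_u(y_i)=E_{i+1,i}$, $h_i=E_{ii}-E_{i+1,i+1}$ for $1\le i\le n$; $T_u(x_0)=uE_{N1}$, $T_u(y_0)=u^{-1}E_{1N}$, $h_0=E_{NN}-E_{11}$. * Other types, $1\le i<n$: $T_u(x_i)=F_{-\bar\imath,-\bar\imath+1}$, $T_u(y_i)=F_{-\bar\imath+1,-\bar\imath}$, $h_i=F'_{\bar\imath-1}-F'_{\bar\imath}$, where $F'_j=E_{jj}-E_{-j,-j}$. * $i=n$: for $\mathfrak{so}_{2n+1}$, $T_u(x_n)=\gamma(E_{-1,0}-q^{-1/2}E_{01})$,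 $T_u(y_n)=\gamma(E_{0,-1}-q^{1/2}E_{10})$ with a chosen $\gamma\in\mathbb K$, $\gamma^2=q^{1/2}+q^{-1/2}$, and $h_n=-F'_1$; for $\mathfrak{sp}_{2n}$, $T_u(x_n)=\tfrac12F_{-1,1}$, $T_u(y_n)=\tfrac12F_{1,-1}$, $h_n=-2F'_1$; for $\mathfrak{so}_{2n}$, $T_u(x_n)=F_{-2,1}$, $T_u(y_n)=F_{1,-2}$, $h_n=-F'_1-F'_2$. * $i=0$: in the orthogonal cases $T_u(x_0)=uF_{n-1,-n}$, $T_u(y_0)=u^{-1}F_{-n,n-1}$, $h_0=F'_{n-1}+F'_n$; for $\mathfrak{sp}_{2n}$, $T_u(x_0)=\tfrac u2F_{n,-n}$, $T_u(y_0)=\tfrac1{2u}F_{-n,n}$, $h_0=2F'_n$. **Rotations.** Let $\rho=(0\,1\cdots n)$, $\phi_1=(0\,1)$, $\pi(i)=n-i$. The group of rotational symmetries $\Sigma_A\le\mathrm{Aut}(A)$ is $\langle\rho\rangle$ for $\mathfrak{sl}_N$, $\langle\phi_1\rangle$ for $\mathfrak{so}_{2n+1}$, $\langle\pi\rangle$ for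 $\mathfrak{sp}_{2n}$ and $\langle\phi_1,\pi\rangle$ (dihedral of order 8) for $\mathfrak{so}_{2n}$. Put $$Z^\rho(u)=\sum_{i=1}^nE_{i,i+1}+uE_{N1},\qquad Z^{\phi_1}(u)=\sum_{|i|<n}E_{ii}-uE_{n,-n}-u^{-1}E_{-n,n},$$ $$Z^\pi(u)=\sum_{i\in\langle N\rangle}(-1)^{i+1}(-\vartheta u)^{\delta_{i<0}}E_{i-\mathrm{sgn}(i)(n+1),\,i}.$$ Each element of $\Sigma_A$ is written as $\rho^m$ ($0\le m\le n$); $1,\phi_1$; $1,\pi$; or, for $\mathfrak{so}_{2n}$, as one of $1,\ \phi_1,\ \pi,\ \phi_1\pi,\ \pi\phi_1,\ \phi_1\pi\phi_1,\ \pi\phi_1\pi,\ \phi_1\pi\phi_1\pi$, where a product $g_1g_2\cdots g_k$ in this list denotes the permutation obtained by applying first $g_1$, then $g_2$, and so on. For $\sigma=g_1\cdots g_k$ in this form the rotation matrix is $Z^\sigma(u)=Z^{g_1}(u)\cdots Z^{g_k}(u)$, which is invertible. **Quantum pair algebras.** Let $Q=\bigoplus_{i\in I}\mathbb Z\alpha_i$,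 $(\alpha_i,\alpha_j)=d_ia_{ij}$, $r_i(\alpha_j)=\alpha_j-a_{ij}\alpha_i$, $\sigma(\alpha_i)=\alpha_{\sigma(i)}$ for $\sigma\in\mathrm{Aut}(A)$, and $k_\mu=\prod_ik_i^{m_i}$ for $\mu=\sum_i m_i\alpha_i\in Q$. Let $T_i$ be Lusztig's automorphism $T''_{i,1}$ of $U_q(\mathfrak g)$: $T_i(x_i)=-y_ik_i$, $T_i(y_i)=-k_i^{-1}x_i$, $T_i(k_\mu)=k_{r_i(\mu)}$ and, for $j\ne i$, $T_i(x_j)=\sum_{r=0}^{-a_{ij}}(-q_i)^{-r}x_i^{(-a_{ij}-r)}x_jx_i^{(r)}$, $T_i(y_j)=\sum_{r=0}^{-a_{ij}}(-q_i)^ry_i^{(r)}y_jy_i^{(-a_{ij}-r)}$; and let $T_w=T_{i_1}\cdots T_{i_l}$ for a reduced expression $w=r_{i_1}\cdots r_{i_l}$. Let $X\subseteq I$ be such that $A_X=(a_{ij})_{i,j\in X}$ is of finite type, i.e. $\det A_Y\ne0$ for all $Y\subseteq X$, and let $w_X$ be the longest element of $W_X=\langle r_i\rangle_{i\in X}$.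 Let $\tau\in\mathrm{Aut}(A)$ with $\tau^2=\mathrm{id}$ and $-w_X(\alpha_i)=\alpha_{\tau(i)}$ for all $i\in X$, and put $\theta=-w_X\tau$ on $Q$. Then $(X,\tau)$ is a *generalized Satake diagram* if for all $(i,j)\in X\times(I\setminus X)$, $\theta(\alpha_j)=-(\alpha_i+\alpha_j)$ implies $a_{ji}\ne-1$. Let $\theta_q=T_{w_X}\,\tau\,\omega_q$, where $\omega_q$ is the algebra automorphism with $\omega_q(x_i)=-k_i^{-1}y_i$, $\omega_q(y_i)=-x_ik_i$, $\omega_q(k_i)=k_i^{-1}$. For $\boldsymbol c\in(\mathbb K^\times)^{I\setminus X}$ and $\boldsymbol s\in\mathbb K^{I\setminus X}$ set $b_i=y_i$ if $i\in X$, and $b_i=y_i+c_i\theta_q(y_ik_i)k_i^{-1}-s_ik_i^{-1}$ otherwise. Let $B_{\boldsymbol c,\boldsymbol s}(X,\tau)\subseteq U_q(\mathfrak g)$ be the subalgebra generated by the $x_i$ ($i\in X$), the elements of $U_q(\mathfrak h)=\langle k_i^{\pm1}\rangle_{i\in I}$ fixed by $\theta_q$, and all $b_i$ ($i\in I$). Choose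 $I^*\subseteq I\setminus X$ containing precisely one element of every $\tau$-orbit in $I\setminus X$, and put $$I_{\rm diff}=\{j\in I^*: j\ne\tau(j),\ (\alpha_j,\theta(\alpha_j))\ne0\},\quad I_{\rm ns}=\{j\in I^*: j=\tau(j),\ a_{ij}=0\ \forall i\in X\},\quad I_{\rm nsf}=\{j\in I_{\rm ns}: a_{ij}\in2\mathbb Z\ \forall i\in I_{\rm ns}\},$$ $$\mathcal C=\{\boldsymbol c:\ \forall j\in I^*,\ c_j\ne c_{\tau(j)}\Rightarrow j\in I_{\rm diff}\},\qquad \mathcal S=\{\boldsymbol s:\ \forall j\in I^*,\ s_j\ne0\Rightarrow j\in I_{\rm nsf}\}.$$ **Boundary intertwining equations.** Let $B\subseteq U_q(\mathfrak g)$ be a subalgebra, $\eta\in\mathbb K^\times$, and let $K(u)$ be an $N\times N$ matrix with entries in $\mathbb K(u)$. The pair $(K(u),\eta)$ solves the *untwisted* equation for $B$ if $K(u)\,T_{\eta u}(b)=T_{\eta/u}(b)\,K(u)$ for all $b\in B$, and the *twisted* equation for $B$ if $K(u)\,T_{\eta u}(b)=T_{\eta/u}(S(b))^{\mathsf t}\,K(u)$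 for all $b\in B$, where $\mathsf t$ is the matrix transpose; these are equations of matrices over $\mathbb K(u)$. **Proposition.** Let $\sigma\in\Sigma_A$, let $(X,\tau)$ be a generalized Satake diagram, $\boldsymbol c\in\mathcal C$ and $\boldsymbol s\in\mathcal S$. Let $\eta\in\mathbb K^\times$ and let $K(u)$ be an $N\times N$ matrix over $\mathbb K(u)$. 1. $(K(u),\eta)$ solves the untwisted boundary intertwining equation for $B_{\boldsymbol c,\boldsymbol s}(X,\tau)$ if and only if $\big(Z^\sigma(\tfrac\eta u)^{-1}K(u)\,Z^\sigma(\eta u),\ \eta\big)$ solves the untwisted boundary intertwining equation for $\sigma(B_{\boldsymbol c,\boldsymbol s}(X,\tau))$. 2. $(K(u),\eta)$ solves the twisted boundary intertwining equation for $B_{\boldsymbol c,\boldsymbol s}(X,\tau)$ if and only if $\big(Z^\sigma(\tfrac\eta u)^{\mathsf t}K(u)\,Z^\sigma(\eta u),\ \eta\big)$ solves the twisted boundary intertwining equation for $\sigma(B_{\boldsymbol c,\boldsymbol s}(X,\tau))$. -/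

import Mathlib

namespace QPair
noncomputable section
open scoped Polynomial

/-- The ground field: an algebraic closure of `ℂ(q)`. -/
abbrev Kq : Type := AlgebraicClosure (RatFunc ℂ)
/-- The indeterminate `q`. -/
def q : Kq := algebraMap (RatFunc ℂ) Kq RatFunc.X
theorem exists_qHalf : ∃ t : Kq, t ^ 2 = q := IsAlgClosed.exists_pow_nat_eq q two_pos
/-- A square root of `q`. -/
def qHalf : Kq := exists_qHalf.choose
theorem qHalf_sq : qHalf ^ 2 = q := exists_qHalf.choose_spec
theorem exists_cRoot : ∃ c : Kq, c ^ 2 = qHalf + qHalf⁻¹ :=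
  IsAlgClosed.exists_pow_nat_eq _ two_pos
/-- A square root of `q^{1/2} + q^{-1/2}`. -/
def cRoot : Kq := exists_cRoot.choose
theorem cRoot_sq : cRoot ^ 2 = qHalf + qHalf⁻¹ := exists_cRoot.choose_spec

theorem q_pow_ne_one {m : ℕ} (hm : m ≠ 0) : q ^ m ≠ 1 := by
  intro h
  have h1 : (RatFunc.X : RatFunc ℂ) ^ m = 1 := by
    apply (algebraMap (RatFunc ℂ) Kq).injective
    simpa [q] using h
  rw [← RatFunc.algebraMap_X, ← map_pow] at h1
  have h2 : (Polynomial.X : ℂ[X]) ^ m = 1 :=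
    RatFunc.algebraMap_injective ℂ (by simpa using h1)
  have := congrArg Polynomial.natDegree h2
  simp at this; exact hm this

theorem qHalf_ne_zero : qHalf ≠ 0 := by
  intro h
  have h1 := qHalf_sq
  rw [h] at h1
  have : (RatFunc.X : RatFunc ℂ) = 0 := by
    apply (algebraMap (RatFunc ℂ) Kq).injective
    simpa [q] using h1.symm
  exact RatFunc.X_ne_zero this

theorem qHalf_pow_sub_ne_zero {m : ℕ} (hm : m ≠ 0) : qHalf ^ m - (qHalf ^ m)⁻¹ ≠ 0 := by
  intro h
  have h0 : qHalf ^ m ≠ 0 := pow_ne_zero _ qHalf_ne_zero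
  have h1 : qHalf ^ m * qHalf ^ m = 1 := by
    rw [sub_eq_zero] at h
    nth_rewrite 2 [h]; exact mul_inv_cancel₀ h0
  apply q_pow_ne_one hm
  rw [← qHalf_sq, ← pow_mul, mul_comm, pow_mul, pow_two, h1]

/-! ### Untwisted affine Cartan matrices of classical type -/

/-- The four classical families. -/
inductive Family
  | A | B | C | D

/-- An untwisted affine Cartan datum of classical Lie type: `A_n` with `n ≥ 1`, `B_n` with `n ≥ 2`,
`C_n` with `n ≥ 1`, `D_n` with `n ≥ 3` (all superscripted by `(1)`); the finite type Lie algebra is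
`sl_{n+1}`, `so_{2n+1}`, `sp_{2n}`, `so_{2n}`, respectively. -/
structure Datum where
  family : Family
  n : ℕ
  rank_ok : (match family with | .A => 1 | .B => 2 | .C => 1 | .D => 3) ≤ n

namespace Datum

variable (D : Datum)

/-- The nodes `0, 1, …, n` of the affine Dynkin diagram. -/
abbrev I : Type := Fin (D.n + 1)

/-- The bonds of the Dynkin diagram, in the direction of increasing labels. For `B_2`, `C_1`, `D_3`
one obtains the degenerate diagrams `0 ⇒ 2 ⇐ 1`, the diagram of `A_1`, and the 4-cycle
`0 - 2 - 1 - 3 - 0`. -/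
def Bond (i j : ℤ) : Prop :=
  match D.family with
  | .A => j = i + 1 ∨ (i = 0 ∧ j = D.n)
  | .B => (i = 0 ∧ j = 2) ∨ (1 ≤ i ∧ j = i + 1)
  | .C => j = i + 1
  | .D => (i = 0 ∧ j = 2) ∨ (1 ≤ i ∧ j = i + 1 ∧ j < D.n) ∨ (i + 2 = D.n ∧ j = D.n) ∨
      (D.n = 3 ∧ i = 0 ∧ j = 3)

instance (i j : ℤ) : Decidable (D.Bond i j) := Classical.propDecidable _

/-- The Cartan integer `a_{ij}` of a pair of bonded nodes. -/
def bondValue (i j : ℤ) : ℤ :=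
  match D.family with
  | .A => if D.n = 1 then -2 else -1
  | .B => if i = D.n then -2 else -1
  | .C => if j = 0 ∨ j = D.n then -2 else -1
  | .D => -1

/-- The Cartan integers on integer labels. -/
def cartanZ (i j : ℤ) : ℤ :=
  if i = j then 2 else if D.Bond i j ∨ D.Bond j i then D.bondValue i j else 0

/-- The generalized Cartan matrix `A = (a_{ij})`. -/
def cartan (i j : D.I) : ℤ := D.cartanZ (i : ℕ) (j : ℕ)

/-- `2 d_i` on integer labels. -/
def twoDZ (i : ℤ) : ℤ :=
  match D.family with
  | .A => 2
  | .B => if i = D.n then 1 else 2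
  | .C => if i = 0 ∨ i = D.n then 4 else 2
  | .D => 2

/-- The integers `2 d_i`, where `(d_i)` are the chosen symmetrizers of the Cartan matrix. -/
def twoD (i : D.I) : ℤ := D.twoDZ (i : ℕ)

/-- `q_i = q^{d_i}`. -/
def qi (i : D.I) : Kq := qHalf ^ D.twoD i

theorem cartan_self (i : D.I) : D.cartan i i = 2 := by simp [cartan, cartanZ]

theorem cartan_symm (i j : D.I) : D.twoD i * D.cartan i j = D.twoD j * D.cartan j i := by
  by_cases hij : i = j
  · rw [hij]
  have hij' : ((i : ℕ) : ℤ) ≠ j := fun h => hij (Fin.ext (by exact_mod_cast h))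
  simp only [cartan, cartanZ, if_neg hij', if_neg hij'.symm]
  by_cases hb : D.Bond (i : ℕ) (j : ℕ) ∨ D.Bond (j : ℕ) (i : ℕ)
  · rw [if_pos hb, if_pos hb.symm]
    obtain ⟨fam, n, h⟩ := D
    have h1 := i.2
    have h2 := j.2
    cases fam <;> simp only [twoD, twoDZ, bondValue, Bond] at * <;> (try split_ifs) <;> omega
  · rw [if_neg hb, if_neg (fun h => hb h.symm)]; simp

theorem cartan_cases {i j : D.I} (hij : i ≠ j) :
    D.cartan i j = 0 ∨ D.cartan i j = -1 ∨ D.cartan i j = -2 := by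
  have hij' : ((i : ℕ) : ℤ) ≠ j := fun h => hij (Fin.ext (by exact_mod_cast h))
  simp only [cartan, cartanZ, if_neg hij']
  obtain ⟨fam, n, h⟩ := D
  cases fam <;> simp only [bondValue] <;> split_ifs <;> simp

/-- The group `Aut(A)` of diagram automorphisms. -/
def Aut : Subgroup (Equiv.Perm D.I) where
  carrier := {σ | ∀ i j, D.cartan (σ i) (σ j) = D.cartan i j}
  mul_mem' := fun {a b} ha hb i j => by simp only [Equiv.Perm.mul_apply]; rw [ha, hb]
  one_mem' := fun i j => rfl
  inv_mem' := fun {a} ha i j => by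
    have := ha (a⁻¹ i) (a⁻¹ j); simpa using this.symm

end Datum

/-! ### The quantum group -/

/-- `[r]_Q = (Q^r - Q^{-r}) / (Q - Q^{-1})`. -/
def qInt (Q : Kq) (r : ℕ) : Kq := (Q ^ r - Q⁻¹ ^ r) / (Q - Q⁻¹)

/-- `[r]_Q! = [r]_Q [r-1]_Q ⋯ [1]_Q`. -/
def qFact (Q : Kq) (r : ℕ) : Kq := ∏ s ∈ Finset.range r, qInt Q (s + 1)

/-- The divided power `x^{(r)} = x^r / [r]_Q!`. -/
def divPow {R : Type*} [Ring R] [Algebra Kq R] (Q : Kq) (x : R) (r : ℕ) : R := (qFact Q r)⁻¹ • x ^ r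

/-- The quantum Serre expression `∑_{r=0}^{m} (-1)^r x^{(m-r)} y x^{(r)}`. -/
def serre {R : Type*} [Ring R] [Algebra Kq R] (Q : Kq) (m : ℕ) (x y : R) : R :=
  ∑ r ∈ Finset.range (m + 1), (-1 : Kq) ^ r • (divPow Q x (m - r) * y * divPow Q x r)

/-- Labels of the generators `x_i`, `y_i`, `k_i`, `k_i^{-1}`. -/
inductive Gen (I : Type)
  | x (i : I)
  | y (i : I)
  | k (i : I)
  | kinv (i : I)

namespace Datum

variable (D : Datum)

/-- The quantum group relations for a family of elements of a `Kq`-algebra. -/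
structure UqRelations {R : Type*} [Ring R] [Algebra Kq R] (f : Gen D.I → R) : Prop where
  k_kinv : ∀ i, f (.k i) * f (.kinv i) = 1
  kinv_k : ∀ i, f (.kinv i) * f (.k i) = 1
  k_k : ∀ i j, f (.k i) * f (.k j) = f (.k j) * f (.k i)
  k_x : ∀ i j, f (.k i) * f (.x j) = (D.qi i ^ D.cartan i j) • (f (.x j) * f (.k i))
  k_y : ∀ i j, f (.k i) * f (.y j) = (D.qi i ^ (-D.cartan i j)) • (f (.y j) * f (.k i))
  x_y_self : ∀ i, f (.x i) * f (.y i) - f (.y i) * f (.x i) =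
    (D.qi i - (D.qi i)⁻¹)⁻¹ • (f (.k i) - f (.kinv i))
  x_y : ∀ i j, i ≠ j → f (.x i) * f (.y j) - f (.y j) * f (.x i) = 0
  serre_x : ∀ i j, i ≠ j → serre (D.qi i) (1 - D.cartan i j).toNat (f (.x i)) (f (.x j)) = 0
  serre_y : ∀ i j, i ≠ j → serre (D.qi i) (1 - D.cartan i j).toNat (f (.y i)) (f (.y j)) = 0

/-- The defining relations of `U_q(g)`, imposed on the free algebra. -/
inductive Rel : FreeAlgebra Kq (Gen D.I) → FreeAlgebra Kq (Gen D.I) → Prop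
  | k_kinv (i) : Rel (.ι Kq (.k i) * .ι Kq (.kinv i)) 1
  | kinv_k (i) : Rel (.ι Kq (.kinv i) * .ι Kq (.k i)) 1
  | k_k (i j) : Rel (.ι Kq (.k i) * .ι Kq (.k j)) (.ι Kq (.k j) * .ι Kq (.k i))
  | k_x (i j) : Rel (.ι Kq (.k i) * .ι Kq (.x j))
      ((D.qi i ^ D.cartan i j) • (.ι Kq (.x j) * .ι Kq (.k i)))
  | k_y (i j) : Rel (.ι Kq (.k i) * .ι Kq (.y j))
      ((D.qi i ^ (-D.cartan i j)) • (.ι Kq (.y j) * .ι Kq (.k i)))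
  | x_y_self (i) : Rel (.ι Kq (.x i) * .ι Kq (.y i) - .ι Kq (.y i) * .ι Kq (.x i))
      ((D.qi i - (D.qi i)⁻¹)⁻¹ • (.ι Kq (.k i) - .ι Kq (.kinv i)))
  | x_y (i j) (h : i ≠ j) : Rel (.ι Kq (.x i) * .ι Kq (.y j) - .ι Kq (.y j) * .ι Kq (.x i)) 0
  | serre_x (i j) (h : i ≠ j) :
      Rel (serre (D.qi i) (1 - D.cartan i j).toNat (.ι Kq (.x i)) (.ι Kq (.x j))) 0
  | serre_y (i j) (h : i ≠ j) :
      Rel (serre (D.qi i) (1 - D.cartan i j).toNat (.ι Kq (.y i)) (.ι Kq (.y j))) 0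

/-- The Drinfeld-Jimbo quantum group `U_q(g)` as an algebra. -/
def Uq : Type := RingQuot D.Rel

instance : Ring D.Uq := inferInstanceAs (Ring (RingQuot D.Rel))

instance : Algebra Kq D.Uq := inferInstanceAs (Algebra Kq (RingQuot D.Rel))

/-- The quotient map. -/
def toUq : FreeAlgebra Kq (Gen D.I) →ₐ[Kq] D.Uq := RingQuot.mkAlgHom Kq D.Rel

/-- The generators of `U_q(g)`. -/
def gen (g : Gen D.I) : D.Uq := D.toUq (.ι Kq g)

theorem toUq_rel {a b : FreeAlgebra Kq (Gen D.I)} (h : D.Rel a b) : D.toUq a = D.toUq b :=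
  RingQuot.mkAlgHom_rel Kq h

end Datum

theorem map_serre {R S : Type*} [Ring R] [Algebra Kq R] [Ring S] [Algebra Kq S] (φ : R →ₐ[Kq] S)
    (Q : Kq) (m : ℕ) (x y : R) : φ (serre Q m x y) = serre Q m (φ x) (φ y) := by
  simp [serre, divPow, map_sum, map_smul]

namespace Datum

variable (D : Datum)

theorem gen_relations : D.UqRelations D.gen where
  k_kinv i := by simpa [gen] using D.toUq_rel (Rel.k_kinv (D := D) i)
  kinv_k i := by simpa [gen] using D.toUq_rel (Rel.kinv_k (D := D) i)
  k_k i j := by simpa [gen] using D.toUq_rel (Rel.k_k (D := D) i j)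
  k_x i j := by simpa [gen] using D.toUq_rel (Rel.k_x (D := D) i j)
  k_y i j := by simpa [gen] using D.toUq_rel (Rel.k_y (D := D) i j)
  x_y_self i := by simpa [gen] using D.toUq_rel (Rel.x_y_self (D := D) i)
  x_y i j h := by simpa [gen] using D.toUq_rel (Rel.x_y (D := D) i j h)
  serre_x i j h := by
    simpa [gen, map_serre] using D.toUq_rel (Rel.serre_x (D := D) i j h)
  serre_y i j h := by
    simpa [gen, map_serre] using D.toUq_rel (Rel.serre_y (D := D) i j h)

/-- Descent of algebra homomorphisms to the quotient. -/
def liftMk {R : Type*} [Ring R] [Algebra Kq R]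
    (φ : {φ : FreeAlgebra Kq (Gen D.I) →ₐ[Kq] R // ∀ ⦃a b⦄, D.Rel a b → φ a = φ b}) :
    D.Uq →ₐ[Kq] R :=
  RingQuot.liftAlgHom Kq φ

theorem liftMk_mk {R : Type*} [Ring R] [Algebra Kq R]
    (φ : {φ : FreeAlgebra Kq (Gen D.I) →ₐ[Kq] R // ∀ ⦃a b⦄, D.Rel a b → φ a = φ b})
    (a : FreeAlgebra Kq (Gen D.I)) : D.liftMk φ (D.toUq a) = φ.1 a :=
  RingQuot.liftAlgHom_mkAlgHom_apply Kq φ.1 φ.2 a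

/-- The universal property of `U_q(g)`. -/
def lift {R : Type*} [Ring R] [Algebra Kq R] {f : Gen D.I → R} (hf : D.UqRelations f) :
    D.Uq →ₐ[Kq] R :=
  liftMk D ⟨FreeAlgebra.lift Kq f, fun {a b} h => by
    cases h with
    | k_kinv i => simpa using hf.k_kinv i
    | kinv_k i => simpa using hf.kinv_k i
    | k_k i j => simpa using hf.k_k i j
    | k_x i j => simpa using hf.k_x i j
    | k_y i j => simpa using hf.k_y i j
    | x_y_self i => simpa using hf.x_y_self i
    | x_y i j h => simpa using hf.x_y i j h
    | serre_x i j h => simpa [map_serre] using hf.serre_x i j h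
    | serre_y i j h => simpa [map_serre] using hf.serre_y i j h⟩

@[simp] theorem lift_gen {R : Type*} [Ring R] [Algebra Kq R] {f : Gen D.I → R}
    (hf : D.UqRelations f) (g : Gen D.I) : D.lift hf (D.gen g) = f g := by
  simp [lift, gen, liftMk_mk]

theorem hom_ext {R : Type*} [Ring R] [Algebra Kq R] {φ ψ : D.Uq →ₐ[Kq] R}
    (h : ∀ g, φ (D.gen g) = ψ (D.gen g)) : φ = ψ :=
  RingQuot.ringQuot_ext' Kq φ ψ (FreeAlgebra.hom_ext (funext h) :
    φ.comp D.toUq = ψ.comp D.toUq)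

/-- The action of a diagram automorphism on the labels of the generators. -/
def permGen (σ : Equiv.Perm D.I) : Gen D.I → Gen D.I
  | .x i => .x (σ i)
  | .y i => .y (σ i)
  | .k i => .k (σ i)
  | .kinv i => .kinv (σ i)

theorem twoD_aut_B {n : ℕ} {h} (i : Fin (n + 1)) :
    ((⟨.B, n, h⟩ : Datum).twoD i = 1 ↔ ∃ j, (⟨.B, n, h⟩ : Datum).cartan i j = -2) := by
  simp only at h
  have hi' : (i : ℕ) < n + 1 := i.2
  simp only [twoD, twoDZ, cartan, cartanZ, bondValue, Bond]
  constructor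
  · intro hi
    refine ⟨⟨n - 1, show n - 1 < n + 1 by omega⟩, ?_⟩
    simp only
    omega
  · rintro ⟨j, hj⟩
    have hj' : (j : ℕ) < n + 1 := j.2
    omega

theorem twoD_aut_C {n : ℕ} {h} (i : Fin (n + 1)) :
    ((⟨.C, n, h⟩ : Datum).twoD i = 4 ↔ ∃ j, (⟨.C, n, h⟩ : Datum).cartan j i = -2) := by
  simp only at h
  have hi' : (i : ℕ) < n + 1 := i.2
  simp only [twoD, twoDZ, cartan, cartanZ, bondValue, Bond]
  constructor
  · intro hi
    by_cases h0 : (i : ℕ) = 0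
    · refine ⟨⟨1, show 1 < n + 1 by omega⟩, ?_⟩
      simp only
      omega
    · refine ⟨⟨n - 1, show n - 1 < n + 1 by omega⟩, ?_⟩
      simp only
      omega
  · rintro ⟨j, hj⟩
    have hj' : (j : ℕ) < n + 1 := j.2
    omega

theorem twoD_aut {σ : Equiv.Perm D.I} (hσ : σ ∈ D.Aut) (i : D.I) :
    D.twoD (σ i) = D.twoD i := by
  have hc : ∀ i j, D.cartan (σ i) (σ j) = D.cartan i j := hσ
  obtain ⟨fam, n, h⟩ := D
  cases fam
  · rfl
  · have key : (⟨.B, n, h⟩ : Datum).twoD (σ i) = 1 ↔ (⟨.B, n, h⟩ : Datum).twoD i = 1 := by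
      rw [twoD_aut_B, twoD_aut_B]
      constructor
      · rintro ⟨j, hj⟩
        exact ⟨σ.symm j, by rw [← hc]; simpa using hj⟩
      · rintro ⟨j, hj⟩
        exact ⟨σ j, by rw [hc]; exact hj⟩
    simp only [twoD, twoDZ] at key ⊢
    split_ifs at key ⊢ <;> simp_all
  · have key : (⟨.C, n, h⟩ : Datum).twoD (σ i) = 4 ↔ (⟨.C, n, h⟩ : Datum).twoD i = 4 := by
      rw [twoD_aut_C, twoD_aut_C]
      constructor
      · rintro ⟨j, hj⟩
        exact ⟨σ.symm j, by rw [← hc]; simpa using hj⟩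
      · rintro ⟨j, hj⟩
        exact ⟨σ j, by rw [hc]; exact hj⟩
    simp only [twoD, twoDZ] at key ⊢
    split_ifs at key ⊢ <;> simp_all
  · rfl

/-- The algebra automorphism of `U_q(g)` induced by a diagram automorphism:
`x_i ↦ x_{σ(i)}`, `y_i ↦ y_{σ(i)}`, `k_i ↦ k_{σ(i)}`. -/
def diagramHom (σ : D.Aut) : D.Uq →ₐ[Kq] D.Uq :=
  D.lift (f := fun g => D.gen (D.permGen σ g)) <| by
    have hq : ∀ i, D.qi (σ.1 i) = D.qi i := fun i => by rw [qi, qi, D.twoD_aut σ.2]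
    have hc : ∀ i j, D.cartan (σ.1 i) (σ.1 j) = D.cartan i j := σ.2
    have H := D.gen_relations
    exact
      { k_kinv := fun i => H.k_kinv _
        kinv_k := fun i => H.kinv_k _
        k_k := fun i j => H.k_k _ _
        k_x := fun i j => by rw [← hc, ← hq]; exact H.k_x _ _
        k_y := fun i j => by rw [← hc, ← hq]; exact H.k_y _ _
        x_y_self := fun i => by rw [← hq]; exact H.x_y_self _
        x_y := fun i j h => H.x_y _ _ (σ.1.injective.ne h)
        serre_x := fun i j h => by rw [← hc, ← hq]; exact H.serre_x _ _ (σ.1.injective.ne h)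
        serre_y := fun i j h => by rw [← hc, ← hq]; exact H.serre_y _ _ (σ.1.injective.ne h) }

end Datum

/-! ### The antipode and the quantum Chevalley involution -/

section Twist

variable {R : Type*} [Ring R] [Algebra Kq R]

theorem pow_mul_of_skew {x κ : R} {b : Kq} (h : x * κ = b • (κ * x)) (r : ℕ) :
    x ^ r * κ = b ^ r • (κ * x ^ r) := by
  induction r with
  | zero => simp
  | succ r ih =>
    rw [pow_succ, mul_assoc, h, mul_smul_comm, ← mul_assoc, ih, smul_mul_assoc, smul_smul,
      mul_assoc, pow_succ, mul_comm b]

theorem mul_pow_of_skew {x κ : R} {b : Kq} (h : x * κ = b • (κ * x)) (s : ℕ) :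
    x * κ ^ s = b ^ s • (κ ^ s * x) := by
  induction s with
  | zero => simp
  | succ s ih =>
    rw [pow_succ, ← mul_assoc, ih, smul_mul_assoc, mul_assoc, h, mul_smul_comm, smul_smul,
      ← mul_assoc, pow_succ]

theorem skew_mul_pow {x κ : R} {a : Kq} (h : x * κ = a ^ 2 • (κ * x)) (r : ℕ) :
    (κ * x) ^ r = a ^ (r * (r - 1)) • (κ ^ r * x ^ r) := by
  induction r with
  | zero => simp
  | succ r ih =>
    rw [pow_succ, ih, smul_mul_assoc, mul_assoc, ← mul_assoc (x ^ r), pow_mul_of_skew h,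
      smul_mul_assoc, mul_smul_comm, smul_smul, mul_assoc κ, ← pow_succ, ← mul_assoc, ← pow_succ,
      ← pow_mul, ← pow_add]
    congr 2
    cases r with
    | zero => simp
    | succ r => simp; ring

theorem skew_term {x y κ l : R} {a c : Kq} {m : ℕ} (h1 : x * κ = a ^ 2 • (κ * x))
    (h2 : x * l = c • (l * x)) (h3 : y * κ = c • (κ * y)) (h4 : l * κ = κ * l)
    (hc : a ^ (m - 1) * c = 1) {r s : ℕ} (hrs : r + s = m) :
    (κ * x) ^ r * (l * y) * (κ * x) ^ s = κ ^ m * l * (x ^ r * y * x ^ s) := by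
  have e1 : x ^ r * κ ^ s = (a ^ 2) ^ (r * s) • (κ ^ s * x ^ r) := by
    rw [mul_pow_of_skew (pow_mul_of_skew h1 r), ← pow_mul]
  have e2 := pow_mul_of_skew h2 r
  have e3 := mul_pow_of_skew h3 s
  have e4 : l * κ ^ s = κ ^ s * l := (Commute.pow_right h4 s).eq
  rw [skew_mul_pow h1, skew_mul_pow h1]
  have : κ ^ r * x ^ r * (l * y) * (κ ^ s * x ^ s) =
      (c ^ r * c ^ s * (a ^ 2) ^ (r * s)) • (κ ^ m * l * (x ^ r * y * x ^ s)) := by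
    calc κ ^ r * x ^ r * (l * y) * (κ ^ s * x ^ s)
        = κ ^ r * (x ^ r * l) * (y * κ ^ s) * x ^ s := by noncomm_ring
      _ = (c ^ r * c ^ s) • (κ ^ r * l * (x ^ r * κ ^ s) * y * x ^ s) := by
          rw [e2, e3]; simp only [mul_smul_comm, smul_mul_assoc, smul_smul]
          rw [mul_comm (c ^ s)]; congr 1; noncomm_ring
      _ = (c ^ r * c ^ s * (a ^ 2) ^ (r * s)) • (κ ^ r * (l * κ ^ s) * x ^ r * y * x ^ s) := by
          rw [e1]; simp only [mul_smul_comm, smul_mul_assoc, smul_smul]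
          congr 1; noncomm_ring
      _ = _ := by
          rw [e4, ← hrs, pow_add]; congr 1; noncomm_ring
  simp only [mul_smul_comm, smul_mul_assoc, smul_smul]
  rw [this, smul_smul]
  convert one_smul Kq _ using 2
  have e5 : r * (r - 1) + s * (s - 1) + 2 * (r * s) = (m - 1) * m := by
    subst hrs
    cases r <;> cases s <;> simp <;> ring
  calc a ^ (s * (s - 1)) * a ^ (r * (r - 1)) * (c ^ r * c ^ s * (a ^ 2) ^ (r * s))
      = a ^ (r * (r - 1) + s * (s - 1) + 2 * (r * s)) * c ^ m := by
        rw [← hrs, pow_add, pow_add, pow_add, ← pow_mul]; ring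
    _ = 1 := by rw [e5, pow_mul, ← mul_pow, hc, one_pow]

theorem serre_skew {x y κ l : R} {Q a c : Kq} {m : ℕ} (h1 : x * κ = a ^ 2 • (κ * x))
    (h2 : x * l = c • (l * x)) (h3 : y * κ = c • (κ * y)) (h4 : l * κ = κ * l)
    (hc : a ^ (m - 1) * c = 1) :
    serre Q m (κ * x) (l * y) = κ ^ m * l * serre Q m x y := by
  rw [serre, serre, Finset.mul_sum]
  refine Finset.sum_congr rfl fun r hr => ?_
  have hr' : m - r + r = m := by have := Finset.mem_range.1 hr; omega
  have := skew_term h1 h2 h3 h4 hc hr'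
  simp only [divPow, mul_smul_comm, smul_mul_assoc, this]

theorem serre_smul (x y : R) (Q s t : Kq) (m : ℕ) :
    serre Q m (s • x) (t • y) = (s ^ m * t) • serre Q m x y := by
  rw [serre, serre, Finset.smul_sum]
  refine Finset.sum_congr rfl fun r hr => ?_
  have hr' : m - r + r = m := by have := Finset.mem_range.1 hr; omega
  simp only [divPow, mul_smul_comm, smul_mul_assoc, smul_smul, smul_pow]
  congr 1
  conv_rhs => rw [← hr', pow_add]
  rw [hr']; ring

theorem serre_neg (x y : R) (Q : Kq) (m : ℕ) :
    serre Q m (-x) (-y) = ((-1) ^ m * (-1) : Kq) • serre Q m x y := by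
  rw [← serre_smul]; simp

theorem serre_op (x y : R) (Q : Kq) (m : ℕ) :
    serre Q m (MulOpposite.op x) (MulOpposite.op y) =
      (-1 : Kq) ^ m • MulOpposite.op (serre Q m x y) := by
  rw [serre, serre, ← Finset.sum_range_reflect, Finset.op_sum, Finset.smul_sum]
  refine Finset.sum_congr rfl fun r hr => ?_
  have hr' : r ≤ m := by have := Finset.mem_range.1 hr; omega
  have e1 : m + 1 - 1 - r = m - r := by omega
  have e2 : m - (m - r) = r := by omega
  simp only [e1, e2, divPow, MulOpposite.op_smul, MulOpposite.op_mul, MulOpposite.op_pow,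
    mul_assoc, smul_smul, mul_smul_comm, smul_mul_assoc]
  congr 1
  have : (-1 : Kq) ^ (m - r) = (-1) ^ m * (-1) ^ r := by
    rw [← Nat.sub_add_cancel hr', pow_add, Nat.add_sub_cancel, mul_assoc, ← mul_pow]; simp
  rw [this]; ring

end Twist

namespace Datum

variable (D : Datum)

theorem qi_ne_zero (i : D.I) : D.qi i ≠ 0 := zpow_ne_zero _ qHalf_ne_zero

theorem qi_symm (i j : D.I) : D.qi i ^ D.cartan i j = D.qi j ^ D.cartan j i := by
  rw [qi, qi, ← zpow_mul, ← zpow_mul, D.cartan_symm]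

section UqLemmas

variable {D}

/-- `a = q_i^{-1}`-form of `x_i k_j^{-1} = q_i^{a_{ij}} k_j^{-1} x_i`. -/
theorem UqRelations.x_kinv {R : Type*} [Ring R] [Algebra Kq R] {f : Gen D.I → R}
    (H : D.UqRelations f) (i j : D.I) :
    f (.x j) * f (.kinv i) = (D.qi i ^ D.cartan i j) • (f (.kinv i) * f (.x j)) := by
  have h := H.k_x i j
  calc f (.x j) * f (.kinv i) = f (.kinv i) * (f (.k i) * f (.x j)) * f (.kinv i) := by
        rw [← mul_assoc, H.kinv_k, one_mul]
    _ = (D.qi i ^ D.cartan i j) • (f (.kinv i) * f (.x j) * (f (.k i) * f (.kinv i))) := by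
        rw [h]; simp only [mul_smul_comm, smul_mul_assoc, mul_assoc]
    _ = _ := by rw [H.k_kinv, mul_one]

theorem UqRelations.y_kinv {R : Type*} [Ring R] [Algebra Kq R] {f : Gen D.I → R}
    (H : D.UqRelations f) (i j : D.I) :
    f (.y j) * f (.kinv i) = (D.qi i ^ (-D.cartan i j)) • (f (.kinv i) * f (.y j)) := by
  have h := H.k_y i j
  calc f (.y j) * f (.kinv i) = f (.kinv i) * (f (.k i) * f (.y j)) * f (.kinv i) := by
        rw [← mul_assoc, H.kinv_k, one_mul]
    _ = (D.qi i ^ (-D.cartan i j)) • (f (.kinv i) * f (.y j) * (f (.k i) * f (.kinv i))) := by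
        rw [h]; simp only [mul_smul_comm, smul_mul_assoc, mul_assoc]
    _ = _ := by rw [H.k_kinv, mul_one]

theorem UqRelations.x_k {R : Type*} [Ring R] [Algebra Kq R] {f : Gen D.I → R}
    (H : D.UqRelations f) (i j : D.I) :
    f (.x j) * f (.k i) = (D.qi i ^ (-D.cartan i j)) • (f (.k i) * f (.x j)) := by
  rw [H.k_x, smul_smul, ← zpow_add₀ (D.qi_ne_zero i)]; simp

theorem UqRelations.y_k {R : Type*} [Ring R] [Algebra Kq R] {f : Gen D.I → R}
    (H : D.UqRelations f) (i j : D.I) :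
    f (.y j) * f (.k i) = (D.qi i ^ (D.cartan i j)) • (f (.k i) * f (.y j)) := by
  rw [H.k_y, smul_smul, ← zpow_add₀ (D.qi_ne_zero i)]; simp

theorem UqRelations.kinv_kinv {R : Type*} [Ring R] [Algebra Kq R] {f : Gen D.I → R}
    (H : D.UqRelations f) (i j : D.I) :
    f (.kinv i) * f (.kinv j) = f (.kinv j) * f (.kinv i) := by
  calc f (.kinv i) * f (.kinv j)
      = f (.kinv i) * f (.kinv j) * (f (.k i) * f (.k j)) * f (.kinv j) * f (.kinv i) := by
        rw [mul_assoc (_ * _), mul_assoc (_ * _) (f (.k i) * f (.k j)), mul_assoc (f (.k i)),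
          ← mul_assoc (f (.k j)), H.k_kinv, one_mul, H.k_kinv, mul_one]
    _ = f (.kinv j) * f (.kinv i) := by
        rw [H.k_k, ← mul_assoc, mul_assoc (f (.kinv i)), H.kinv_k, mul_one, H.kinv_k, one_mul]

theorem UqRelations.k_kinv' {R : Type*} [Ring R] [Algebra Kq R] {f : Gen D.I → R}
    (H : D.UqRelations f) (i j : D.I) :
    f (.k i) * f (.kinv j) = f (.kinv j) * f (.k i) := by
  calc f (.k i) * f (.kinv j) = f (.kinv j) * (f (.k j) * f (.k i)) * f (.kinv j) := by
        rw [← mul_assoc, H.kinv_k, one_mul]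
    _ = _ := by rw [H.k_k, ← mul_assoc, mul_assoc, H.k_kinv, mul_one]

theorem serre_exp {i j : D.I} (hij : i ≠ j) (Q : Kq) (hQ : Q ≠ 0) :
    Q ^ ((1 - D.cartan i j).toNat - 1) * Q ^ D.cartan i j = 1 := by
  rw [← zpow_natCast, ← zpow_add₀ hQ]
  convert zpow_zero Q using 2
  rcases D.cartan_cases hij with h | h | h <;> rw [h] <;> rfl

theorem UqRelations.serre_kinv_x {R : Type*} [Ring R] [Algebra Kq R] {f : Gen D.I → R}
    (H : D.UqRelations f) {i j : D.I} (hij : i ≠ j) :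
    serre (D.qi i) (1 - D.cartan i j).toNat (f (.kinv i) * f (.x i)) (f (.kinv j) * f (.x j)) = 0 := by
  rw [serre_skew (a := D.qi i) (c := D.qi i ^ D.cartan i j), H.serre_x i j hij, mul_zero]
  · rw [H.x_kinv, D.cartan_self]; norm_cast
  · rw [H.x_kinv, D.qi_symm]
  · rw [H.x_kinv]
  · exact H.kinv_kinv _ _
  · exact serre_exp hij _ (D.qi_ne_zero i)

theorem UqRelations.serre_kinv_y {R : Type*} [Ring R] [Algebra Kq R] {f : Gen D.I → R}
    (H : D.UqRelations f) {i j : D.I} (hij : i ≠ j) :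
    serre (D.qi i) (1 - D.cartan i j).toNat (f (.kinv i) * f (.y i)) (f (.kinv j) * f (.y j)) = 0 := by
  rw [serre_skew (a := (D.qi i)⁻¹) (c := (D.qi i)⁻¹ ^ D.cartan i j), H.serre_y i j hij, mul_zero]
  · rw [H.y_kinv, D.cartan_self, ← inv_zpow']; norm_cast
  · rw [H.y_kinv, ← inv_zpow', inv_zpow, inv_zpow, D.qi_symm]
  · rw [H.y_kinv, inv_zpow']
  · exact H.kinv_kinv _ _
  · exact serre_exp hij _ (inv_ne_zero (D.qi_ne_zero i))

theorem UqRelations.serre_k_x {R : Type*} [Ring R] [Algebra Kq R] {f : Gen D.I → R}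
    (H : D.UqRelations f) {i j : D.I} (hij : i ≠ j) :
    serre (D.qi i) (1 - D.cartan i j).toNat (f (.k i) * f (.x i)) (f (.k j) * f (.x j)) = 0 := by
  rw [serre_skew (a := (D.qi i)⁻¹) (c := (D.qi i)⁻¹ ^ D.cartan i j), H.serre_x i j hij, mul_zero]
  · rw [H.x_k, D.cartan_self, ← inv_zpow']; norm_cast
  · rw [H.x_k, ← inv_zpow', inv_zpow, inv_zpow, D.qi_symm]
  · rw [H.x_k, inv_zpow']
  · exact H.k_k _ _
  · exact serre_exp hij _ (inv_ne_zero (D.qi_ne_zero i))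

theorem UqRelations.serre_k_y {R : Type*} [Ring R] [Algebra Kq R] {f : Gen D.I → R}
    (H : D.UqRelations f) {i j : D.I} (hij : i ≠ j) :
    serre (D.qi i) (1 - D.cartan i j).toNat (f (.k i) * f (.y i)) (f (.k j) * f (.y j)) = 0 := by
  rw [serre_skew (a := D.qi i) (c := D.qi i ^ D.cartan i j), H.serre_y i j hij, mul_zero]
  · rw [H.y_k, D.cartan_self]; norm_cast
  · rw [H.y_k, D.qi_symm]
  · rw [H.y_k]
  · exact H.k_k _ _
  · exact serre_exp hij _ (D.qi_ne_zero i)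

end UqLemmas

/-- The values of the quantum Chevalley involution on the generators. -/
def omegaGen : Gen D.I → D.Uq
  | .x i => -(D.gen (.kinv i) * D.gen (.y i))
  | .y i => -(D.gen (.x i) * D.gen (.k i))
  | .k i => D.gen (.kinv i)
  | .kinv i => D.gen (.k i)

/-- The values of the antipode on the generators. -/
def antipodeGen : Gen D.I → D.Uq
  | .x i => -(D.gen (.kinv i) * D.gen (.x i))
  | .y i => -(D.gen (.y i) * D.gen (.k i))
  | .k i => D.gen (.kinv i)
  | .kinv i => D.gen (.k i)

theorem gen_x_mul_k (i : D.I) : -(D.gen (.x i) * D.gen (.k i)) =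
    (-(D.qi i ^ (-2 : ℤ))) • (D.gen (.k i) * D.gen (.x i)) := by
  rw [D.gen_relations.x_k, D.cartan_self, neg_smul]

theorem gen_y_mul_k (i : D.I) : -(D.gen (.y i) * D.gen (.k i)) =
    (-(D.qi i ^ (2 : ℤ))) • (D.gen (.k i) * D.gen (.y i)) := by
  rw [D.gen_relations.y_k, D.cartan_self, neg_smul]

/-- For `i, j`, the elements `k_i^{-1} y_i` and `x_j k_j` (and similar ones) multiply like
`y_i` and `x_j`, up to a common torus factor. -/
theorem kinv_y_x_k (i j : D.I) : D.gen (.kinv i) * D.gen (.y i) * (D.gen (.x j) * D.gen (.k j)) =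
    D.gen (.kinv i) * (D.gen (.y i) * D.gen (.x j)) * D.gen (.k j) := by noncomm_ring

theorem x_k_kinv_y (i j : D.I) : D.gen (.x j) * D.gen (.k j) * (D.gen (.kinv i) * D.gen (.y i)) =
    D.gen (.kinv i) * (D.gen (.x j) * D.gen (.y i)) * D.gen (.k j) := by
  have H := D.gen_relations
  calc _ = D.gen (.x j) * (D.gen (.k j) * D.gen (.kinv i)) * D.gen (.y i) := by noncomm_ring
    _ = D.gen (.x j) * D.gen (.kinv i) * (D.gen (.k j) * D.gen (.y i)) := by
      rw [H.k_kinv']; noncomm_ring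
    _ = D.gen (.kinv i) * (D.gen (.x j) * D.gen (.y i)) * D.gen (.k j) := by
      rw [H.x_kinv, H.k_y, ← D.qi_symm]
      simp only [smul_mul_assoc, mul_smul_comm, smul_smul]
      rw [← zpow_add₀ (D.qi_ne_zero j), neg_add_cancel, zpow_zero, one_smul]
      noncomm_ring

theorem omega_relations : D.UqRelations D.omegaGen := by
  have H := D.gen_relations
  have xy : ∀ i j, D.omegaGen (.x i) * D.omegaGen (.y j) - D.omegaGen (.y j) * D.omegaGen (.x i) =
      - (D.gen (.kinv i) * (D.gen (.x j) * D.gen (.y i) - D.gen (.y i) * D.gen (.x j)) *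
        D.gen (.k j)) := by
    intro i j
    simp only [omegaGen, neg_mul_neg]
    rw [kinv_y_x_k, x_k_kinv_y]; noncomm_ring
  refine ⟨fun i => H.kinv_k i, fun i => H.k_kinv i, fun i j => H.kinv_kinv i j, fun i j => ?_,
    fun i j => ?_, fun i => ?_, fun i j h => ?_, fun i j h => ?_, fun i j h => ?_⟩
  · have h := H.y_kinv i j
    simp only [omegaGen]
    have : D.gen (.kinv i) * D.gen (.y j) =
        D.qi i ^ D.cartan i j • (D.gen (.y j) * D.gen (.kinv i)) := by
      rw [h, smul_smul, ← zpow_add₀ (D.qi_ne_zero i)]; simp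
    rw [mul_neg, neg_mul, smul_neg, ← mul_assoc, H.kinv_kinv, mul_assoc, this, mul_smul_comm,
      mul_assoc]
  · have h := H.x_kinv i j
    simp only [omegaGen]
    have : D.gen (.kinv i) * D.gen (.x j) =
        D.qi i ^ (-D.cartan i j) • (D.gen (.x j) * D.gen (.kinv i)) := by
      rw [h, smul_smul, ← zpow_add₀ (D.qi_ne_zero i)]; simp
    rw [mul_neg, neg_mul, smul_neg, ← mul_assoc, this, smul_mul_assoc, mul_assoc,
      ← H.k_kinv', ← mul_assoc]
  · rw [xy, H.x_y_self, mul_smul_comm, smul_mul_assoc, ← smul_neg]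
    congr 1
    rw [mul_sub, sub_mul, H.kinv_k, one_mul, mul_assoc, H.kinv_k, mul_one]
    simp [omegaGen]
  · rw [xy, H.x_y j i h.symm]; simp
  · simp only [omegaGen]
    rw [serre_neg, H.serre_kinv_y h, smul_zero]
  · simp only [omegaGen]
    rw [gen_x_mul_k, gen_x_mul_k, serre_smul, H.serre_k_x h, smul_zero]

/-- The algebra automorphism `ω_q`: `x_i ↦ -k_i^{-1} y_i`, `y_i ↦ -x_i k_i`, `k_i ↦ k_i^{-1}`. -/
def omegaq : D.Uq →ₐ[Kq] D.Uq := D.lift D.omega_relations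

theorem antipode_relations :
    D.UqRelations (fun g => MulOpposite.op (D.antipodeGen g)) := by
  have H := D.gen_relations
  have hsw : ∀ i j, D.gen (.kinv i) * D.gen (.x i) * (D.gen (.y j) * D.gen (.k j)) =
      D.gen (.kinv i) * (D.gen (.x i) * D.gen (.y j)) * D.gen (.k j) := fun i j => by noncomm_ring
  have hsw' : ∀ i j, D.gen (.y j) * D.gen (.k j) * (D.gen (.kinv i) * D.gen (.x i)) =
      D.gen (.kinv i) * (D.gen (.y j) * D.gen (.x i)) * D.gen (.k j) := by
    intro i j
    calc _ = D.gen (.y j) * (D.gen (.k j) * D.gen (.kinv i)) * D.gen (.x i) := by noncomm_ring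
      _ = D.gen (.y j) * D.gen (.kinv i) * (D.gen (.k j) * D.gen (.x i)) := by
        rw [H.k_kinv']; noncomm_ring
      _ = D.gen (.kinv i) * (D.gen (.y j) * D.gen (.x i)) * D.gen (.k j) := by
        rw [H.y_kinv, H.k_x]
        simp only [smul_mul_assoc, mul_smul_comm, smul_smul]
        rw [D.qi_symm j i, ← zpow_add₀ (D.qi_ne_zero i), add_neg_cancel, zpow_zero, one_smul]
        noncomm_ring
  have xy : ∀ i j, D.antipodeGen (.y j) * D.antipodeGen (.x i) -
      D.antipodeGen (.x i) * D.antipodeGen (.y j) =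
      - (D.gen (.kinv i) * (D.gen (.x i) * D.gen (.y j) - D.gen (.y j) * D.gen (.x i)) *
        D.gen (.k j)) := by
    intro i j
    simp only [antipodeGen, neg_mul_neg]
    rw [hsw, hsw']; noncomm_ring
  refine ⟨fun i => ?_, fun i => ?_, fun i j => ?_, fun i j => ?_, fun i j => ?_, fun i => ?_,
    fun i j h => ?_, fun i j h => ?_, fun i j h => ?_⟩
  · simp [antipodeGen, ← MulOpposite.op_mul, H.k_kinv]
  · simp [antipodeGen, ← MulOpposite.op_mul, H.kinv_k]
  · simp only [antipodeGen, ← MulOpposite.op_mul, H.kinv_kinv j i]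
  · simp only [antipodeGen, ← MulOpposite.op_mul, ← MulOpposite.op_smul]
    congr 1
    rw [mul_neg, neg_mul, smul_neg, mul_assoc, H.x_kinv, mul_smul_comm, ← mul_assoc,
      H.kinv_kinv, mul_assoc]
  · simp only [antipodeGen, ← MulOpposite.op_mul, ← MulOpposite.op_smul]
    congr 1
    rw [mul_neg, neg_mul, smul_neg, mul_assoc, H.k_kinv', ← mul_assoc, H.y_kinv, smul_mul_assoc,
      mul_assoc]
  · simp only [← MulOpposite.op_mul, ← MulOpposite.op_smul, ← MulOpposite.op_sub]
    congr 1
    rw [xy, H.x_y_self, mul_smul_comm, smul_mul_assoc, ← smul_neg]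
    congr 1
    rw [mul_sub, sub_mul, H.kinv_k, one_mul, mul_assoc, H.kinv_k, mul_one]
    simp [antipodeGen]
  · simp only [← MulOpposite.op_mul, ← MulOpposite.op_sub]
    rw [xy, H.x_y i j h]; simp
  · simp only [antipodeGen]
    rw [serre_op, serre_neg, H.serre_kinv_x h]; simp
  · simp only [antipodeGen]
    rw [serre_op, gen_y_mul_k, gen_y_mul_k, serre_smul, H.serre_k_y h]; simp

/-- The antipode `S` of `U_q(g)`, as an algebra homomorphism to the opposite algebra:
`S(x_i) = -k_i^{-1} x_i`, `S(y_i) = -y_i k_i`, `S(k_i) = k_i^{-1}`. -/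
def antipodeHom : D.Uq →ₐ[Kq] D.Uqᵐᵒᵖ := D.lift D.antipode_relations

/-- The antipode `S` of `U_q(g)`. -/
def antipode (a : D.Uq) : D.Uq := (D.antipodeHom a).unop

end Datum

set_option linter.unusedSectionVars false
set_option linter.unusedSimpArgs false

/-! ### The vector representation -/

namespace Datum

variable (D : Datum)

/-- The labels of the standard basis of the vector space carrying the vector representation:
`1, …, n+1` for `sl_{n+1}`; `-n, …, n` for `so_{2n+1}`; the same without `0` for `sp_{2n}` and
`so_{2n}`. -/
def basisSet : Finset ℤ :=
  match D.family with
  | .A => Finset.Icc 1 (D.n + 1)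
  | .B => Finset.Icc (-D.n : ℤ) D.n
  | .C => (Finset.Icc (-D.n : ℤ) D.n).erase 0
  | .D => (Finset.Icc (-D.n : ℤ) D.n).erase 0

/-- The index set of the standard basis. -/
abbrev Basis : Type := {a : ℤ // a ∈ D.basisSet}

section VecRep

variable (L : Type) [CommRing L] [Algebra Kq L]

/-- The elementary matrix `E_{ab}`. -/
def E (a b : ℤ) : Matrix D.Basis D.Basis L :=
  Matrix.of fun k l => if k.1 = a ∧ l.1 = b then 1 else 0

/-- `ϑ_a`, equal to `sgn(a)` in the symplectic case and to `1` in the orthogonal cases. -/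
def signZ (a : ℤ) : ℤ :=
  match D.family with
  | .C => a.sign
  | _ => 1

/-- `F_{ab} = E_{ab} - ϑ_a ϑ_b E_{-b,-a}`. -/
def F (a b : ℤ) : Matrix D.Basis D.Basis L :=
  D.E L a b - (D.signZ a * D.signZ b) • D.E L (-b) (-a)

/-- The diagonal entries of `E_{ii}`. -/
def eDiag (i a : ℤ) : ℤ := if a = i then 1 else 0

/-- The diagonal entries of `F_{ii}`, `i ≠ 0`. -/
def fDiag (i a : ℤ) : ℤ := eDiag i a - eDiag (-i) a

/-- The diagonal entries of the matrix `h` such that `k_i` acts as `q^h`. -/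
def kWeight (i a : ℤ) : ℤ :=
  match D.family with
  | .A => if i = 0 then eDiag (D.n + 1) a - eDiag 1 a else eDiag i a - eDiag (i + 1) a
  | .B => if i = 0 then fDiag (D.n - 1) a + fDiag D.n a
      else if i = D.n then -fDiag 1 a
      else fDiag (D.n + 1 - i - 1) a - fDiag (D.n + 1 - i) a
  | .C => if i = 0 then 2 * fDiag D.n a
      else if i = D.n then -2 * fDiag 1 a
      else fDiag (D.n + 1 - i - 1) a - fDiag (D.n + 1 - i) a
  | .D => if i = 0 then fDiag (D.n - 1) a + fDiag D.n a
      else if i = D.n then -fDiag 1 a - fDiag 2 a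
      else fDiag (D.n + 1 - i - 1) a - fDiag (D.n + 1 - i) a

/-- The action of `x_i` at spectral parameter `v`. -/
def vecX (v : Lˣ) (i : ℤ) : Matrix D.Basis D.Basis L :=
  match D.family with
  | .A => if i = 0 then (v : L) • D.E L (D.n + 1) 1 else D.E L i (i + 1)
  | .B => if i = 0 then (v : L) • D.F L (D.n - 1) (-D.n)
      else if i = D.n then cRoot • (D.E L (-1) 0 - qHalf⁻¹ • D.E L 0 1)
      else D.F L (-(D.n + 1 - i)) (-(D.n + 1 - i) + 1)
  | .C => if i = 0 then (2⁻¹ : Kq) • (v : L) • D.F L D.n (-D.n)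
      else if i = D.n then (2⁻¹ : Kq) • D.F L (-1) 1
      else D.F L (-(D.n + 1 - i)) (-(D.n + 1 - i) + 1)
  | .D => if i = 0 then (v : L) • D.F L (D.n - 1) (-D.n)
      else if i = D.n then D.F L (-2) 1
      else D.F L (-(D.n + 1 - i)) (-(D.n + 1 - i) + 1)

/-- The action of `y_i` at spectral parameter `v`. -/
def vecY (v : Lˣ) (i : ℤ) : Matrix D.Basis D.Basis L :=
  match D.family with
  | .A => if i = 0 then ((v⁻¹ : Lˣ) : L) • D.E L 1 (D.n + 1) else D.E L (i + 1) i
  | .B => if i = 0 then ((v⁻¹ : Lˣ) : L) • D.F L (-D.n) (D.n - 1)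
      else if i = D.n then cRoot • (D.E L 0 (-1) - qHalf • D.E L 1 0)
      else D.F L (-(D.n + 1 - i) + 1) (-(D.n + 1 - i))
  | .C => if i = 0 then (2⁻¹ : Kq) • ((v⁻¹ : Lˣ) : L) • D.F L (-D.n) D.n
      else if i = D.n then (2⁻¹ : Kq) • D.F L 1 (-1)
      else D.F L (-(D.n + 1 - i) + 1) (-(D.n + 1 - i))
  | .D => if i = 0 then ((v⁻¹ : Lˣ) : L) • D.F L (-D.n) (D.n - 1)
      else if i = D.n then D.F L 1 (-2)
      else D.F L (-(D.n + 1 - i) + 1) (-(D.n + 1 - i))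

/-- The matrices of the generators in the vector representation, evaluated at the spectral
parameter `v`. -/
def vecGen (v : Lˣ) : Gen D.I → Matrix D.Basis D.Basis L
  | .x i => D.vecX L v (i : ℕ)
  | .y i => D.vecY L v (i : ℕ)
  | .k i => Matrix.diagonal fun a => algebraMap Kq L (q ^ D.kWeight (i : ℕ) a.1)
  | .kinv i => Matrix.diagonal fun a => algebraMap Kq L (q ^ (-D.kWeight (i : ℕ) a.1))

variable {L}

/-- `M` has nonzero entries only at positions related by `R`. -/
def Supp (M : Matrix D.Basis D.Basis L) (R : ℤ → ℤ → Prop) : Prop :=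
  ∀ a b : D.Basis, ¬ R a b → M a b = 0

variable {D}

theorem Supp.mul3 {M N P : Matrix D.Basis D.Basis L} {R S T : ℤ → ℤ → Prop} (hM : D.Supp M R)
    (hN : D.Supp N S) (hP : D.Supp P T) (h : ∀ a b c d, R a b → S b c → T c d → False) :
    M * N * P = 0 := by
  ext a d
  rw [Matrix.mul_apply]
  refine Finset.sum_eq_zero fun c _ => ?_
  rw [Matrix.mul_apply, Finset.sum_mul]
  refine Finset.sum_eq_zero fun b _ => ?_
  by_contra hne
  refine h a b c d (not_not.1 fun h' => hne ?_) (not_not.1 fun h' => hne ?_)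
    (not_not.1 fun h' => hne ?_)
  · rw [hM _ _ h']; ring
  · rw [hN _ _ h']; ring
  · rw [hP _ _ h']; ring

theorem Supp.mul4 {M N P P' : Matrix D.Basis D.Basis L} {R S T U : ℤ → ℤ → Prop}
    (hM : D.Supp M R) (hN : D.Supp N S) (hP : D.Supp P T) (hP' : D.Supp P' U)
    (h : ∀ a b c d e, R a b → S b c → T c d → U d e → False) :
    M * N * P * P' = 0 := by
  have hMN : D.Supp (M * N) (fun a c => ∃ b, R a b ∧ S b c) := by
    intro a c hac
    rw [Matrix.mul_apply]
    refine Finset.sum_eq_zero fun b _ => ?_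
    by_contra hne
    exact hac ⟨b, not_not.1 fun h' => hne (by rw [hM _ _ h']; ring),
      not_not.1 fun h' => hne (by rw [hN _ _ h']; ring)⟩
  exact hMN.mul3 hP hP' fun a c d e ⟨b, h1, h2⟩ h3 h4 => h a b c d e h1 h2 h3 h4

theorem Supp.mul2 {M N : Matrix D.Basis D.Basis L} {R S : ℤ → ℤ → Prop} (hM : D.Supp M R)
    (hN : D.Supp N S) (h : ∀ a b c, R a b → S b c → False) : M * N = 0 := by
  ext a c
  rw [Matrix.mul_apply]
  refine Finset.sum_eq_zero fun b _ => ?_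
  by_contra hne
  exact h a b c (not_not.1 fun h' => hne (by rw [hM _ _ h']; ring))
    (not_not.1 fun h' => hne (by rw [hN _ _ h']; ring))

variable (D)

/-- The positions of the nonzero entries of `x_i`. -/
def edge (i a b : ℤ) : Prop :=
  match D.family with
  | .A => (i = 0 ∧ a = D.n + 1 ∧ b = 1) ∨ (i ≠ 0 ∧ a = i ∧ b = i + 1)
  | .B => (i = 0 ∧ ((a = D.n - 1 ∧ b = -D.n) ∨ (a = D.n ∧ b = 1 - D.n))) ∨
      (i = D.n ∧ ((a = -1 ∧ b = 0) ∨ (a = 0 ∧ b = 1))) ∨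
      (i ≠ 0 ∧ i ≠ D.n ∧ ((a = i - D.n - 1 ∧ b = i - D.n) ∨ (a = D.n - i ∧ b = D.n + 1 - i)))
  | .C => (i = 0 ∧ a = D.n ∧ b = -D.n) ∨ (i = D.n ∧ a = -1 ∧ b = 1) ∨
      (i ≠ 0 ∧ i ≠ D.n ∧ ((a = i - D.n - 1 ∧ b = i - D.n) ∨ (a = D.n - i ∧ b = D.n + 1 - i)))
  | .D => (i = 0 ∧ ((a = D.n - 1 ∧ b = -D.n) ∨ (a = D.n ∧ b = 1 - D.n))) ∨
      (i = D.n ∧ ((a = -2 ∧ b = 1) ∨ (a = -1 ∧ b = 2))) ∨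
      (i ≠ 0 ∧ i ≠ D.n ∧ ((a = i - D.n - 1 ∧ b = i - D.n) ∨ (a = D.n - i ∧ b = D.n + 1 - i)))

theorem mem_basisSet (a : ℤ) : a ∈ D.basisSet ↔
    match D.family with
    | .A => 1 ≤ a ∧ a ≤ D.n + 1
    | .B => -D.n ≤ a ∧ a ≤ D.n
    | .C => a ≠ 0 ∧ -D.n ≤ a ∧ a ≤ D.n
    | .D => a ≠ 0 ∧ -D.n ≤ a ∧ a ≤ D.n := by
  obtain ⟨fam, n, h⟩ := D
  cases fam <;> simp [basisSet]

variable (L)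

/-- `E_{ab} - E_{-b,-a}`. -/
def P (a b : ℤ) : Matrix D.Basis D.Basis L := D.E L a b - D.E L (-b) (-a)

/-- The matrices `x_i` with a single nonzero entry. -/
structure Single (v : Lˣ) (i : ℤ) (α : Lˣ) (s t : ℤ) : Prop where
  x : D.vecX L v i = (α : L) • D.E L s t
  y : D.vecY L v i = ((α⁻¹ : Lˣ) : L) • D.E L t s
  ne : s ≠ t
  mem_s : s ∈ D.basisSet
  mem_t : t ∈ D.basisSet
  edge : ∀ a b, D.edge i a b ↔ a = s ∧ b = t
  weight : ∀ a, 2 * D.kWeight i a = D.twoDZ i * (eDiag s a - eDiag t a)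

/-- The matrices `x_i` with two nonzero entries related by a sign. -/
structure Double (v : Lˣ) (i : ℤ) (α : Lˣ) (s t : ℤ) : Prop where
  x : D.vecX L v i = (α : L) • D.P L s t
  y : D.vecY L v i = ((α⁻¹ : Lˣ) : L) • D.P L t s
  ne : s ≠ t
  ne' : s ≠ -t
  s0 : s ≠ 0
  t0 : t ≠ 0
  mem_s : s ∈ D.basisSet
  mem_t : t ∈ D.basisSet
  mem_ns : -s ∈ D.basisSet
  mem_nt : -t ∈ D.basisSet
  edge : ∀ a b, D.edge i a b ↔ (a = s ∧ b = t) ∨ (a = -t ∧ b = -s)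
  weight : ∀ a, 2 * D.kWeight i a =
    D.twoDZ i * (eDiag s a - eDiag t a + eDiag (-t) a - eDiag (-s) a)

theorem two_half_smul (M : Matrix D.Basis D.Basis L) : (2⁻¹ : Kq) • (M + M) = M := by
  rw [← two_smul Kq M, smul_smul]; simp

theorem F_eq_P (hs : D.family ≠ .C) (a b : ℤ) : D.F L a b = D.P L a b := by
  obtain ⟨fam, n, h⟩ := D
  cases fam <;> simp_all [F, P, signZ]

theorem F_eq_P_C {a b : ℤ} (h : D.signZ a * D.signZ b = 1) : D.F L a b = D.P L a b := by
  simp [F, P, h]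

theorem F_C (hs : D.family = .C) {a : ℤ} (ha : a ≠ 0) :
    D.F L a (-a) = D.E L a (-a) + D.E L a (-a) := by
  obtain ⟨fam, n, h⟩ := D
  simp only at hs
  subst hs
  have : Int.sign a * Int.sign a = 1 := by
    rcases lt_trichotomy a 0 with h | h | h
    · simp [Int.sign_eq_neg_one_of_neg h]
    · exact absurd h ha
    · simp [Int.sign_eq_one_of_pos h]
  simp [F, signZ, this]

theorem shape (v : Lˣ) (i : ℤ) (h0 : 0 ≤ i) (hn : i ≤ D.n) :
    (∃ α s t, D.Single L v i α s t) ∨ (∃ α s t, D.Double L v i α s t) ∨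
      (D.family = .B ∧ i = D.n) := by
  obtain ⟨fam, n, h⟩ := D
  simp only at h hn
  cases fam
  · left
    have h1 : 1 ≤ n := h
    by_cases hi : i = 0
    · have ht : (⟨.A, n, h⟩ : Datum).twoDZ i = 2 := rfl
      refine ⟨v, n + 1, 1, by simp [vecX, hi], by simp [vecY, hi], ?_, ?_, ?_, fun a b => ?_,
        fun a => ?_⟩ <;> first | omega | (simp only [mem_basisSet]; omega) | (simp only [Datum.edge]; omega) |
          (simp only [ht, kWeight, eDiag]; omega)
    · have ht : (⟨.A, n, h⟩ : Datum).twoDZ i = 2 := rfl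
      refine ⟨1, i, i + 1, by simp [vecX, hi], by simp [vecY, hi], ?_, ?_, ?_, fun a b => ?_,
        fun a => ?_⟩ <;> first | omega | (simp only [mem_basisSet]; omega) | (simp only [Datum.edge]; omega) |
          (simp only [ht, kWeight, eDiag]; omega)
  · have h1 : 2 ≤ n := h
    have hF := F_eq_P ⟨.B, n, h⟩ L (by simp)
    by_cases hi : i = 0
    · right; left
      have ht : (⟨.B, n, h⟩ : Datum).twoDZ i = 2 := by simp only [twoDZ]; omega
      refine ⟨v, n - 1, -n, by simp [vecX, hi, hF], by simp [vecY, hi, hF], ?_, ?_, ?_, ?_, ?_, ?_,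
        ?_, ?_, fun a b => ?_, fun a => ?_⟩ <;>
        first | omega | (simp only [mem_basisSet]; omega) | (simp only [Datum.edge]; omega) |
          (simp only [ht, kWeight, fDiag, eDiag]; omega)
    by_cases hi' : i = n
    · right; right; exact ⟨rfl, hi'⟩
    · right; left
      have e1 : -((n : ℤ) + 1 - i) = i - n - 1 := by ring
      have e2 : -((n : ℤ) + 1 - i) + 1 = i - n := by ring
      have ht : (⟨.B, n, h⟩ : Datum).twoDZ i = 2 := by simp only [twoDZ]; omega
      refine ⟨1, i - n - 1, i - n, by simp only [vecX, hi, hi', e2, hF]; simp [e1],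
        by simp only [vecY, hi, hi', e2, hF]; simp [e1], ?_, ?_, ?_, ?_, ?_, ?_,
        ?_, ?_, fun a b => ?_, fun a => ?_⟩ <;>
        first | omega | (simp only [mem_basisSet]; omega) | (simp only [Datum.edge]; omega) |
          (simp only [ht, kWeight, fDiag, eDiag]; omega)
  · have h1 : 1 ≤ n := h
    by_cases hi : i = 0
    · left
      have e := F_C ⟨.C, n, h⟩ L rfl (a := n) (by omega)
      have e' := F_C ⟨.C, n, h⟩ L rfl (a := -n) (by omega)
      rw [neg_neg] at e'
      have ht : (⟨.C, n, h⟩ : Datum).twoDZ i = 4 := by simp only [twoDZ]; omega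
      refine ⟨v, n, -n, ?_, ?_, ?_, ?_, ?_, fun a b => ?_, fun a => ?_⟩
      · simp only [vecX, hi, if_true, e]; rw [smul_add, two_half_smul]
      · simp only [vecY, hi, if_true, e']; rw [smul_add, two_half_smul]
      all_goals first | omega | (simp only [mem_basisSet]; omega) | (simp only [Datum.edge]; omega) |
          (simp only [ht, kWeight, fDiag, eDiag]; omega)
    by_cases hi' : i = n
    · left
      have e := F_C ⟨.C, n, h⟩ L rfl (a := 1) (by omega)
      have e' := F_C ⟨.C, n, h⟩ L rfl (a := -1) (by omega)
      rw [neg_neg] at e'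
      have hn0 : (n : ℤ) ≠ 0 := by omega
      have ht : (⟨.C, n, h⟩ : Datum).twoDZ i = 4 := by simp only [twoDZ]; omega
      refine ⟨1, -1, 1, ?_, ?_, ?_, ?_, ?_, fun a b => ?_, fun a => ?_⟩
      · simp only [vecX, hi', hn0, if_true, if_false, e', two_half_smul]; simp
      · simp only [vecY, hi', hn0, if_true, if_false, e, two_half_smul]; simp
      all_goals
        first | omega | (simp only [mem_basisSet]; omega) | (simp only [Datum.edge]; omega) |
          (simp only [ht, kWeight, fDiag, eDiag]; omega)
    · right; left
      have e1 : -((n : ℤ) + 1 - i) = i - n - 1 := by ring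
      have e2 : -((n : ℤ) + 1 - i) + 1 = i - n := by ring
      have s1 : Int.sign (i - n - 1) = -1 := Int.sign_eq_neg_one_of_neg (by omega)
      have s2 : Int.sign (i - n) = -1 := Int.sign_eq_neg_one_of_neg (by omega)
      have hF := F_eq_P_C ⟨.C, n, h⟩ L (a := i - n - 1) (b := i - n) (by simp [signZ, s1, s2])
      have hF' := F_eq_P_C ⟨.C, n, h⟩ L (a := i - n) (b := i - n - 1) (by simp [signZ, s1, s2])
      have ht : (⟨.C, n, h⟩ : Datum).twoDZ i = 2 := by simp only [twoDZ]; omega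
      refine ⟨1, i - n - 1, i - n, by simp only [vecX, hi, hi', e2]; simp [e1, hF],
        by simp only [vecY, hi, hi', e2]; simp [e1, hF'], ?_, ?_, ?_, ?_, ?_, ?_,
        ?_, ?_, fun a b => ?_, fun a => ?_⟩ <;>
        first | omega | (simp only [mem_basisSet]; omega) | (simp only [Datum.edge]; omega) |
          (simp only [ht, kWeight, fDiag, eDiag]; omega)
  · right; left
    have h1 : 3 ≤ n := h
    have hF := F_eq_P ⟨.D, n, h⟩ L (by simp)
    by_cases hi : i = 0
    · have ht : (⟨.D, n, h⟩ : Datum).twoDZ i = 2 := rfl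
      refine ⟨v, n - 1, -n, by simp [vecX, hi, hF], by simp [vecY, hi, hF], ?_, ?_, ?_, ?_, ?_, ?_,
        ?_, ?_, fun a b => ?_, fun a => ?_⟩ <;>
        first | omega | (simp only [mem_basisSet]; omega) | (simp only [Datum.edge]; omega) |
          (simp only [ht, kWeight, fDiag, eDiag]; omega)
    have hn0 : (n : ℤ) ≠ 0 := by omega
    by_cases hi' : i = n
    · have ht : (⟨.D, n, h⟩ : Datum).twoDZ i = 2 := rfl
      refine ⟨1, -2, 1, by simp only [vecX, hi', hn0, hF]; simp,
        by simp only [vecY, hi', hn0, hF]; simp, ?_, ?_, ?_, ?_, ?_, ?_,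
        ?_, ?_, fun a b => ?_, fun a => ?_⟩ <;>
        first | omega | (simp only [mem_basisSet]; omega) | (simp only [Datum.edge]; omega) |
          (simp only [ht, kWeight, fDiag, eDiag]; omega)
    · have e1 : -((n : ℤ) + 1 - i) = i - n - 1 := by ring
      have e2 : -((n : ℤ) + 1 - i) + 1 = i - n := by ring
      have ht : (⟨.D, n, h⟩ : Datum).twoDZ i = 2 := rfl
      refine ⟨1, i - n - 1, i - n, by simp only [vecX, hi, hi', e2, hF]; simp [e1],
        by simp only [vecY, hi, hi', e2, hF]; simp [e1], ?_, ?_, ?_, ?_, ?_, ?_,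
        ?_, ?_, fun a b => ?_, fun a => ?_⟩ <;>
        first | omega | (simp only [mem_basisSet]; omega) | (simp only [Datum.edge]; omega) |
          (simp only [ht, kWeight, fDiag, eDiag]; omega)

variable {L}

theorem E_supp (s t : ℤ) : D.Supp (D.E L s t) (fun a b => a = s ∧ b = t) := by
  intro a b hab
  simp only [E, Matrix.of_apply]
  exact if_neg hab

theorem vecX_supp (v : Lˣ) (i : ℤ) (h0 : 0 ≤ i) (hn : i ≤ D.n) :
    D.Supp (D.vecX L v i) (D.edge i) := by
  intro a b hab
  rcases D.shape L v i h0 hn with ⟨α, s, t, H⟩ | ⟨α, s, t, H⟩ | ⟨hB, hi⟩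
  · rw [H.edge] at hab
    rw [H.x, Matrix.smul_apply, D.E_supp s t a b hab, smul_zero]
  · rw [H.edge, not_or] at hab
    rw [H.x, Matrix.smul_apply, P, Matrix.sub_apply, D.E_supp s t a b hab.1,
      D.E_supp (-t) (-s) a b hab.2, sub_zero, smul_zero]
  · obtain ⟨fam, n, h⟩ := D
    simp only at hB hi h
    subst hB hi
    have h1 : 2 ≤ n := h
    have hn0 : (n : ℤ) ≠ 0 := by omega
    simp only [Datum.edge, hn0] at hab
    simp only [vecX, hn0, if_true, if_false]
    rw [Matrix.smul_apply, Matrix.sub_apply, Matrix.smul_apply, E_supp _ _ _ a b (by tauto),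
      E_supp _ _ _ a b (by tauto)]
    simp

theorem vecY_supp (v : Lˣ) (i : ℤ) (h0 : 0 ≤ i) (hn : i ≤ D.n) :
    D.Supp (D.vecY L v i) (fun a b => D.edge i b a) := by
  intro a b hab
  beta_reduce at hab
  rcases D.shape L v i h0 hn with ⟨α, s, t, H⟩ | ⟨α, s, t, H⟩ | ⟨hB, hi⟩
  · rw [H.edge] at hab
    rw [H.y, Matrix.smul_apply, D.E_supp t s a b (by tauto), smul_zero]
  · rw [H.edge, not_or] at hab
    rw [H.y, Matrix.smul_apply, P, Matrix.sub_apply, D.E_supp t s a b (by tauto),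
      D.E_supp (-s) (-t) a b (by tauto), sub_zero, smul_zero]
  · obtain ⟨fam, n, h⟩ := D
    simp only at hB hi h
    subst hB hi
    have h1 : 2 ≤ n := h
    have hn0 : (n : ℤ) ≠ 0 := by omega
    simp only [Datum.edge, hn0] at hab
    simp only [vecY, hn0, if_true, if_false]
    rw [Matrix.smul_apply, Matrix.sub_apply, Matrix.smul_apply, E_supp _ _ _ a b (by tauto),
      E_supp _ _ _ a b (by tauto)]
    simp

theorem E_mul_same (a d : ℤ) {b : ℤ} (hb : b ∈ D.basisSet) :
    D.E L a b * D.E L b d = D.E L a d := by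
  ext k l
  rw [Matrix.mul_apply, Finset.sum_eq_single (⟨b, hb⟩ : D.Basis)]
  · simp only [E, Matrix.of_apply]
    split_ifs <;> simp_all
  · intro c _ hc
    have : c.1 ≠ b := fun h => hc (Subtype.ext h)
    simp [E, this]
  · simp

theorem E_mul_ne (a d : ℤ) {b c : ℤ} (h : b ≠ c) : D.E L a b * D.E L c d = 0 :=
  (D.E_supp a b).mul2 (D.E_supp c d) fun _ _ _ h1 h2 => h (h1.2.symm.trans h2.1)

theorem E_diag (a : ℤ) : D.E L a a = Matrix.diagonal fun k => ((eDiag a k.1 : ℤ) : L) := by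
  ext k l
  rcases eq_or_ne k l with rfl | hkl
  · simp [E, eDiag]
  · have : ¬ (k.1 = a ∧ l.1 = a) := fun h => hkl (Subtype.ext (h.1.trans h.2.symm))
    simp [E, this, hkl]

theorem P_neg (a b : ℤ) : D.P L (-b) (-a) = -D.P L a b := by simp [P]

theorem commute_P {a b : ℤ} (hb : b ∈ D.basisSet) (hnb : -b ∈ D.basisSet) (h1 : a ≠ b) (h2 : a ≠ -b) (h3 : a ≠ 0) (h4 : b ≠ 0) :
    Commute (D.P L a b) (D.P L b (-a)) := by
  simp only [Commute, SemiconjBy, P, sub_mul, mul_sub, neg_neg]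
  rw [D.E_mul_same _ _ hb, D.E_mul_ne _ _ (b := b) (c := a) h1.symm,
    D.E_mul_ne _ _ (b := -a) (c := b) (by omega), D.E_mul_ne _ _ (b := -a) (c := a) (by omega),
    D.E_mul_ne _ _ (b := -b) (c := a) (by omega), D.E_mul_ne _ _ (b := -a) (c := -b) (by omega),
    D.E_mul_same _ _ hnb, D.E_mul_ne _ _ (b := -a) (c := a) (by omega)]
  simp

theorem commutator_single {a b : ℤ} (ha : a ∈ D.basisSet) (hb : b ∈ D.basisSet) :
    D.E L a b * D.E L b a - D.E L b a * D.E L a b =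
      Matrix.diagonal fun k => ((eDiag a k.1 - eDiag b k.1 : ℤ) : L) := by
  rw [D.E_mul_same _ _ hb, D.E_mul_same _ _ ha, E_diag, E_diag, Matrix.diagonal_sub]
  simp

theorem commutator_double {a b : ℤ} (ha : a ∈ D.basisSet) (hb : b ∈ D.basisSet)
    (hna : -a ∈ D.basisSet) (hnb : -b ∈ D.basisSet) (h2 : a ≠ -b) (h3 : a ≠ 0) (h4 : b ≠ 0) :
    D.P L a b * D.P L b a - D.P L b a * D.P L a b =
      Matrix.diagonal fun k =>
        ((eDiag a k.1 - eDiag b k.1 + eDiag (-b) k.1 - eDiag (-a) k.1 : ℤ) : L) := by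
  simp only [P, sub_mul, mul_sub]
  rw [D.E_mul_same _ _ hb, D.E_mul_same _ _ ha, D.E_mul_same _ _ hna, D.E_mul_same _ _ hnb,
    D.E_mul_ne _ _ (b := b) (c := -a) (by omega), D.E_mul_ne _ _ (b := -a) (c := b) (by omega),
    D.E_mul_ne _ _ (b := a) (c := -b) (by omega), D.E_mul_ne _ _ (b := -b) (c := a) (by omega),
    E_diag, E_diag, E_diag, E_diag]
  simp only [sub_zero, zero_sub, Matrix.diagonal_sub, Matrix.diagonal_neg, sub_neg_eq_add]
  congr 1
  funext k
  push_cast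
  ring

theorem eDiag_cases (s t a : ℤ) : eDiag s a - eDiag t a = 0 ∨
    eDiag s a - eDiag t a = 1 ∨ eDiag s a - eDiag t a = -1 := by
  simp only [eDiag]; omega

theorem eDiag_cases' (s t a : ℤ) (h1 : s ≠ -t) (h2 : s ≠ 0) (h3 : t ≠ 0) :
    eDiag s a - eDiag t a + eDiag (-t) a - eDiag (-s) a = 0 ∨
    eDiag s a - eDiag t a + eDiag (-t) a - eDiag (-s) a = 1 ∨
    eDiag s a - eDiag t a + eDiag (-t) a - eDiag (-s) a = -1 := by
  simp only [eDiag]; omega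

theorem qi_sub_inv (i : D.I) : D.qi i - (D.qi i)⁻¹ ≠ 0 := by
  have h : 0 < D.twoD i := by
    obtain ⟨fam, n, h⟩ := D
    cases fam <;> simp only [twoD, twoDZ] <;> omega
  rw [qi, ← Int.toNat_of_nonneg h.le, zpow_natCast]
  exact qHalf_pow_sub_ne_zero (by omega)

theorem q_zpow (w : ℤ) : q ^ w = qHalf ^ (2 * w) := by
  rw [← qHalf_sq, zpow_mul, zpow_ofNat]

theorem qi_quot (i : D.I) {w d : ℤ} (h : 2 * w = D.twoD i * d) (hd : d = 0 ∨ d = 1 ∨ d = -1) :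
    (D.qi i - (D.qi i)⁻¹)⁻¹ * (q ^ w - q ^ (-w)) = d := by
  have h' : 2 * -w = D.twoD i * -d := by rw [mul_neg, h]; ring
  have hne := D.qi_sub_inv i
  rw [q_zpow, q_zpow, h, h', zpow_mul, zpow_mul, ← qi]
  rcases hd with rfl | rfl | rfl
  · simp
  · simp [inv_mul_cancel₀ hne]
  · have : D.qi i ^ (-1 : ℤ) - D.qi i ^ (- -1 : ℤ) = -(D.qi i - (D.qi i)⁻¹) := by simp
    rw [this, mul_neg, inv_mul_cancel₀ hne]; simp

theorem add_sub_add_left_eq_sub_aux {M : Type*} [AddCommGroup M] (a b c : M) :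
    a + b - (b + c) = a - c := by abel

theorem vec_x_y_self (v : Lˣ) (i : D.I) :
    D.vecGen L v (.x i) * D.vecGen L v (.y i) - D.vecGen L v (.y i) * D.vecGen L v (.x i) =
    (D.qi i - (D.qi i)⁻¹)⁻¹ • (D.vecGen L v (.k i) - D.vecGen L v (.kinv i)) := by
  have key : ∀ (M : Matrix D.Basis D.Basis L) (δ : ℤ → ℤ),
      M = Matrix.diagonal (fun k => ((δ k.1 : ℤ) : L)) →
      (∀ a, 2 * D.kWeight (i : ℕ) a = D.twoD i * δ a) →
      (∀ a, δ a = 0 ∨ δ a = 1 ∨ δ a = -1) →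
      M = (D.qi i - (D.qi i)⁻¹)⁻¹ • (D.vecGen L v (.k i) - D.vecGen L v (.kinv i)) := by
    intro M δ hM h1 h2
    rw [hM]
    simp only [vecGen]
    rw [Matrix.diagonal_sub, ← Matrix.diagonal_smul]
    congr 1
    funext k
    have := D.qi_quot i (h1 k.1) (h2 k.1)
    simp only [Pi.smul_apply]
    rw [← map_sub, Algebra.smul_def, ← map_mul, this]
    simp
  have hi : ((i : ℕ) : ℤ) ≤ D.n := by have := i.2; omega
  rcases D.shape L v (i : ℕ) (by omega) hi with ⟨α, s, t, H⟩ | ⟨α, s, t, H⟩ | ⟨hB, hi⟩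
  · refine key _ (fun a => eDiag s a - eDiag t a) ?_ H.weight fun a => eDiag_cases s t a
    rw [← D.commutator_single H.mem_s H.mem_t]
    simp only [vecGen, H.x, H.y, smul_mul_smul_comm, Units.mul_inv, Units.inv_mul, one_smul]
  · refine key _ (fun a => eDiag s a - eDiag t a + eDiag (-t) a - eDiag (-s) a) ?_ H.weight
      fun a => eDiag_cases' s t a H.ne' H.s0 H.t0
    rw [← D.commutator_double H.mem_s H.mem_t H.mem_ns H.mem_nt H.ne' H.s0 H.t0]
    simp only [vecGen, H.x, H.y, smul_mul_smul_comm, Units.mul_inv, Units.inv_mul, one_smul]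
  · clear key
    obtain ⟨fam, n, h⟩ := D
    simp only at hB
    subst hB
    have h1 : 2 ≤ n := h
    simp only at hi
    have hn0 : (n : ℤ) ≠ 0 := by omega
    have hq : (⟨.B, n, h⟩ : Datum).qi i = qHalf := by simp [qi, twoD, twoDZ, hi]
    have m0 : (0 : ℤ) ∈ (⟨.B, n, h⟩ : Datum).basisSet := by rw [mem_basisSet]; simp
    have m1 : (1 : ℤ) ∈ (⟨.B, n, h⟩ : Datum).basisSet := by
      rw [mem_basisSet]; simp only; omega
    have m2 : (-1 : ℤ) ∈ (⟨.B, n, h⟩ : Datum).basisSet := by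
      rw [mem_basisSet]; simp only; omega
    have e1 := qHalf_ne_zero
    have e2 : qHalf - qHalf⁻¹ ≠ 0 := by simpa using qHalf_pow_sub_ne_zero one_ne_zero
    simp only [vecGen, hq, vecX, vecY, hi, hn0, if_true, if_false]
    rw [Matrix.diagonal_sub, ← Matrix.diagonal_smul]
    simp only [sub_mul, mul_sub, smul_mul_assoc, mul_smul_comm, smul_smul]
    rw [E_mul_same _ _ _ m0, E_mul_same _ _ _ m0, E_mul_same _ _ _ m1, E_mul_same _ _ _ m2,
      E_mul_ne _ _ _ (by norm_num), E_mul_ne _ _ _ (by norm_num), E_mul_ne _ _ _ (by norm_num),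
      E_mul_ne _ _ _ (by norm_num), E_diag, E_diag, E_diag]
    have hc : cRoot * cRoot = qHalf + qHalf⁻¹ := by rw [← pow_two, cRoot_sq]
    have hc1 : cRoot * (qHalf * cRoot * qHalf⁻¹) = qHalf + qHalf⁻¹ := by
      rw [← hc]; field_simp
    have hc2 : cRoot * (qHalf⁻¹ * cRoot * qHalf) = qHalf + qHalf⁻¹ := by
      rw [← hc]; field_simp
    simp only [smul_zero, sub_zero, zero_sub, smul_neg, sub_neg_eq_add, smul_add, smul_smul, hc,
      hc1, hc2]
    rw [add_sub_add_left_eq_sub_aux, ← smul_sub, Matrix.diagonal_sub, ← Matrix.diagonal_smul]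
    congr 1
    funext k
    have hw : (⟨.B, n, h⟩ : Datum).kWeight n k.1 = eDiag (-1) k.1 - eDiag 1 k.1 := by
      simp only [kWeight, fDiag, eDiag, hn0, if_true, if_false]; omega
    simp only [Pi.smul_apply]
    rw [hw, ← map_sub, Algebra.smul_def, Algebra.smul_def, ← map_mul]
    have hq2 : q - q⁻¹ = (qHalf - qHalf⁻¹) * (qHalf + qHalf⁻¹) := by
      rw [← qHalf_sq]; field_simp; ring
    rw [← Int.cast_sub, ← map_intCast (algebraMap Kq L), ← map_mul]
    congr 1
    rcases eDiag_cases (-1) 1 k.1 with hd | hd | hd <;> rw [hd]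
    · simp
    · rw [zpow_one, zpow_neg, zpow_one, hq2, inv_mul_cancel_left₀ e2]; simp
    · have : q ^ (-1 : ℤ) - q ^ (- -1 : ℤ) = -(q - q⁻¹) := by simp
      rw [this, hq2, mul_neg, inv_mul_cancel_left₀ e2]; simp

theorem edge_weight_A {n : ℕ} {hn} (i j a b : ℤ) (hi : 0 ≤ i) (hi' : i ≤ n) (hj : 0 ≤ j)
    (hj' : j ≤ n) (h : (⟨.A, n, hn⟩ : Datum).edge j a b) :
    2 * ((⟨.A, n, hn⟩ : Datum).kWeight i a - (⟨.A, n, hn⟩ : Datum).kWeight i b) =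
      (⟨.A, n, hn⟩ : Datum).twoDZ i * (⟨.A, n, hn⟩ : Datum).cartanZ i j := by
  have h1 : 1 ≤ n := hn
  simp only [Datum.edge, twoDZ, cartanZ, kWeight, Bond, bondValue, eDiag] at h ⊢
  rcases h with ⟨rfl, rfl, rfl⟩ | ⟨h0, rfl, rfl⟩
  · by_cases h2 : i = 0
    · subst h2; simp only [if_true, true_and, false_and, and_true, and_false, true_or, or_true, false_or, or_false]; omega
    · simp only [h2, if_false, true_and, false_and, and_true, and_false, true_or, or_true, false_or,
        or_false]; omega
  · by_cases h2 : i = 0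
    · subst h2; simp only [if_true, true_and, false_and, and_true, and_false, true_or, or_true, false_or, or_false]; omega
    · simp only [h2, if_false, true_and, false_and, and_true, and_false, true_or, or_true, false_or,
        or_false]; omega

theorem edge_weight_B {n : ℕ} {hn} (i j a b : ℤ) (hi : 0 ≤ i) (hi' : i ≤ n) (hj : 0 ≤ j)
    (hj' : j ≤ n) (h : (⟨.B, n, hn⟩ : Datum).edge j a b) :
    2 * ((⟨.B, n, hn⟩ : Datum).kWeight i a - (⟨.B, n, hn⟩ : Datum).kWeight i b) =
      (⟨.B, n, hn⟩ : Datum).twoDZ i * (⟨.B, n, hn⟩ : Datum).cartanZ i j := by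
  have h1 : 2 ≤ n := hn
  have hn0 : (n : ℤ) ≠ 0 := by omega
  simp only [Datum.edge, cartanZ, kWeight, Bond, bondValue, eDiag, fDiag] at h ⊢
  by_cases h2 : i = 0
  · have ht : (⟨.B, n, hn⟩ : Datum).twoDZ i = 2 := by simp only [twoDZ]; omega
    rw [ht]; subst h2
    simp only [if_true, true_and, false_and, and_true, and_false, true_or, or_true, false_or, or_false]
    rcases h with ⟨rfl, ⟨rfl, rfl⟩ | ⟨rfl, rfl⟩⟩ | ⟨rfl, ⟨rfl, rfl⟩ | ⟨rfl, rfl⟩⟩ |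
      ⟨h3, h4, ⟨rfl, rfl⟩ | ⟨rfl, rfl⟩⟩ <;> omega
  by_cases h2' : i = n
  · have ht : (⟨.B, n, hn⟩ : Datum).twoDZ i = 1 := by simp only [twoDZ]; omega
    rw [ht]; subst h2'
    simp only [if_true, hn0, if_false, true_and, false_and, and_true, and_false, true_or,
      or_true, false_or, or_false]
    rcases h with ⟨rfl, ⟨rfl, rfl⟩ | ⟨rfl, rfl⟩⟩ | ⟨rfl, ⟨rfl, rfl⟩ | ⟨rfl, rfl⟩⟩ |
      ⟨h3, h4, ⟨rfl, rfl⟩ | ⟨rfl, rfl⟩⟩ <;> omega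
  · have ht : (⟨.B, n, hn⟩ : Datum).twoDZ i = 2 := by simp only [twoDZ]; omega
    rw [ht]
    simp only [h2, h2', if_false, true_and, false_and, and_true, and_false, true_or, or_true,
      false_or, or_false]
    rcases h with ⟨rfl, ⟨rfl, rfl⟩ | ⟨rfl, rfl⟩⟩ | ⟨rfl, ⟨rfl, rfl⟩ | ⟨rfl, rfl⟩⟩ |
      ⟨h3, h4, ⟨rfl, rfl⟩ | ⟨rfl, rfl⟩⟩ <;> omega

theorem edge_weight_C {n : ℕ} {hn} (i j a b : ℤ) (hi : 0 ≤ i) (hi' : i ≤ n) (hj : 0 ≤ j)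
    (hj' : j ≤ n) (h : (⟨.C, n, hn⟩ : Datum).edge j a b) :
    2 * ((⟨.C, n, hn⟩ : Datum).kWeight i a - (⟨.C, n, hn⟩ : Datum).kWeight i b) =
      (⟨.C, n, hn⟩ : Datum).twoDZ i * (⟨.C, n, hn⟩ : Datum).cartanZ i j := by
  have h1 : 1 ≤ n := hn
  have hn0 : (n : ℤ) ≠ 0 := by omega
  simp only [Datum.edge, cartanZ, kWeight, Bond, bondValue, eDiag, fDiag] at h ⊢
  by_cases h2 : i = 0
  · have ht : (⟨.C, n, hn⟩ : Datum).twoDZ i = 4 := by simp only [twoDZ]; omega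
    rw [ht]; subst h2
    simp only [if_true, true_and, false_and, and_true, and_false, true_or, or_true, false_or, or_false]
    rcases h with ⟨rfl, rfl, rfl⟩ | ⟨rfl, rfl, rfl⟩ |
      ⟨h3, h4, ⟨rfl, rfl⟩ | ⟨rfl, rfl⟩⟩ <;> omega
  by_cases h2' : i = n
  · have ht : (⟨.C, n, hn⟩ : Datum).twoDZ i = 4 := by simp only [twoDZ]; omega
    rw [ht]; subst h2'
    simp only [if_true, hn0, if_false, true_and, false_and, and_true, and_false, true_or,
      or_true, false_or, or_false]
    rcases h with ⟨rfl, rfl, rfl⟩ | ⟨rfl, rfl, rfl⟩ |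
      ⟨h3, h4, ⟨rfl, rfl⟩ | ⟨rfl, rfl⟩⟩ <;> omega
  · have ht : (⟨.C, n, hn⟩ : Datum).twoDZ i = 2 := by simp only [twoDZ]; omega
    rw [ht]
    simp only [h2, h2', if_false, true_and, false_and, and_true, and_false, true_or, or_true,
      false_or, or_false]
    rcases h with ⟨rfl, rfl, rfl⟩ | ⟨rfl, rfl, rfl⟩ |
      ⟨h3, h4, ⟨rfl, rfl⟩ | ⟨rfl, rfl⟩⟩ <;> omega

theorem kWeight_neg (hA : D.family ≠ .A) (i a : ℤ) : D.kWeight i (-a) = -D.kWeight i a := by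
  have h : ∀ p : ℤ, fDiag p (-a) = -fDiag p a := fun p => by
    simp only [fDiag, eDiag]; omega
  obtain ⟨fam, n, hn⟩ := D
  cases fam
  · exact absurd rfl hA
  all_goals
    simp only [kWeight, h]
    split_ifs <;> ring

theorem fDiag_of_neg {p a : ℤ} (hp : 0 < p) (ha : a < 0) : fDiag p a = -eDiag (-p) a := by
  simp only [fDiag, eDiag]; omega

theorem kWeight_D_of_neg {n : ℕ} {hn} (i a : ℤ) (hi' : i ≤ n) (ha : a < 0) :
    (⟨.D, n, hn⟩ : Datum).kWeight i a = if i = 0 then -eDiag (1 - n) a - eDiag (-n) a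
      else if i = n then eDiag (-1) a + eDiag (-2) a
      else eDiag (i - n - 1) a - eDiag (i - n) a := by
  have h0 : 3 ≤ n := hn
  simp only [kWeight]
  split_ifs
  · rw [fDiag_of_neg (by omega) ha, fDiag_of_neg (by omega) ha]; simp [sub_eq_add_neg, add_comm]
  · rw [fDiag_of_neg (by omega) ha, fDiag_of_neg (by omega) ha]; simp
  · rw [fDiag_of_neg (by omega) ha, fDiag_of_neg (by omega) ha]
    rw [show -((n : ℤ) + 1 - i - 1) = i - n by ring, show -((n : ℤ) + 1 - i) = i - n - 1 by ring]
    ring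

theorem eDiag_eq {x y z w : ℤ} (h : y = x ↔ w = z) : eDiag x y = eDiag z w := by
  simp only [eDiag, h]

theorem eDiag_ne {x y : ℤ} (h : y ≠ x) : eDiag x y = 0 := by
  simp only [eDiag, if_neg h]

theorem bond_D {n : ℕ} {hn} (i j : ℤ) : (⟨.D, n, hn⟩ : Datum).Bond i j ↔
    (i = 0 ∧ j = 2) ∨ (1 ≤ i ∧ j = i + 1 ∧ j < n) ∨ (i + 2 = n ∧ j = n) ∨
      (n = 3 ∧ i = 0 ∧ j = 3) := Iff.rfl

theorem cartan_D_zero {n : ℕ} {hn} (j : ℤ) (hj : 0 ≤ j) (hj' : j ≤ n) :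
    (⟨.D, n, hn⟩ : Datum).cartanZ 0 j = 2 * eDiag 0 j - eDiag 2 j -
      (if n = 3 then eDiag 3 j else 0) := by
  have h0 : 3 ≤ n := hn
  have hb : ((⟨.D, n, hn⟩ : Datum).Bond 0 j ∨ (⟨.D, n, hn⟩ : Datum).Bond j 0) ↔
      j = 2 ∨ (n = 3 ∧ j = 3) := by
    rw [bond_D, bond_D]; omega
  simp only [cartanZ, hb, bondValue, eDiag]; split_ifs <;> omega

theorem cartan_D_n {n : ℕ} {hn} (j : ℤ) (hj : 0 ≤ j) (hj' : j ≤ n) :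
    (⟨.D, n, hn⟩ : Datum).cartanZ n j = 2 * eDiag n j - eDiag (n - 2) j -
      (if n = 3 then eDiag 0 j else 0) := by
  have h0 : 3 ≤ n := hn
  have hb : ((⟨.D, n, hn⟩ : Datum).Bond n j ∨ (⟨.D, n, hn⟩ : Datum).Bond j n) ↔
      j = n - 2 ∨ (n = 3 ∧ j = 0) := by
    rw [bond_D, bond_D]; omega
  simp only [cartanZ, hb, bondValue, eDiag]; split_ifs <;> omega

theorem cartan_D_mid {n : ℕ} {hn} (i j : ℤ) (hi : 0 < i) (hi' : i < n) (hj : 0 < j) (hj' : j < n) :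
    (⟨.D, n, hn⟩ : Datum).cartanZ i j = 2 * eDiag i j - eDiag (i + 1) j - eDiag (i - 1) j := by
  have h0 : 3 ≤ n := hn
  have hb : ((⟨.D, n, hn⟩ : Datum).Bond i j ∨ (⟨.D, n, hn⟩ : Datum).Bond j i) ↔
      j = i + 1 ∨ j = i - 1 := by
    rw [bond_D, bond_D]; omega
  simp only [cartanZ, hb, bondValue, eDiag]; split_ifs <;> omega

theorem cartanZ_comm_D {n : ℕ} {hn} (i j : ℤ) :
    (⟨.D, n, hn⟩ : Datum).cartanZ i j = (⟨.D, n, hn⟩ : Datum).cartanZ j i := by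
  simp only [cartanZ, bondValue, eq_comm, or_comm]

theorem edge_weight_D_aux {n : ℕ} {hn} (i j : ℤ) (hi : 0 ≤ i) (hi' : i ≤ n) (hj : 0 ≤ j)
    (hj' : j ≤ n) : 2 * (if j = 0 then -(⟨.D, n, hn⟩ : Datum).kWeight i (1 - n) -
        (⟨.D, n, hn⟩ : Datum).kWeight i (-n) else if j = n then
        (⟨.D, n, hn⟩ : Datum).kWeight i (-2) + (⟨.D, n, hn⟩ : Datum).kWeight i (-1)
        else (⟨.D, n, hn⟩ : Datum).kWeight i (j - n - 1) -
          (⟨.D, n, hn⟩ : Datum).kWeight i (j - n)) =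
      2 * (⟨.D, n, hn⟩ : Datum).cartanZ i j := by
  have h0 : 3 ≤ n := hn
  have hn0 : (n : ℤ) ≠ 0 := by omega
  congr 1
  split_ifs with h1 h2
  · subst h1
    rw [kWeight_D_of_neg i _ hi' (by omega), kWeight_D_of_neg i _ hi' (by omega),
      cartanZ_comm_D, cartan_D_zero i hi hi']
    split_ifs <;> simp only [eDiag] <;> split_ifs <;> omega
  · subst h2
    rw [kWeight_D_of_neg i _ hi' (by omega), kWeight_D_of_neg i _ hi' (by omega),
      cartanZ_comm_D, cartan_D_n i hi hi']
    split_ifs <;> simp only [eDiag] <;> split_ifs <;> omega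
  · rw [kWeight_D_of_neg i _ hi' (by omega), kWeight_D_of_neg i _ hi' (by omega)]
    split_ifs with h3 h4
    · subst h3
      rw [cartan_D_zero j hj hj']
      simp only [eDiag]; split_ifs <;> omega
    · subst h4
      rw [cartan_D_n j hj hj']
      simp only [eDiag]; split_ifs <;> omega
    · rw [cartan_D_mid i j (by omega) (by omega) (by omega) (by omega)]
      rw [eDiag_eq (x := i - n - 1) (y := j - n - 1) (z := i) (w := j) (by omega),
        eDiag_eq (x := i - n) (y := j - n - 1) (z := i + 1) (w := j) (by omega),
        eDiag_eq (x := i - n - 1) (y := j - n) (z := i - 1) (w := j) (by omega),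
        eDiag_eq (x := i - n) (y := j - n) (z := i) (w := j) (by omega)]
      ring

theorem edge_weight_D {n : ℕ} {hn} (i j a b : ℤ) (hi : 0 ≤ i) (hi' : i ≤ n) (hj : 0 ≤ j)
    (hj' : j ≤ n) (h : (⟨.D, n, hn⟩ : Datum).edge j a b) :
    2 * ((⟨.D, n, hn⟩ : Datum).kWeight i a - (⟨.D, n, hn⟩ : Datum).kWeight i b) =
      (⟨.D, n, hn⟩ : Datum).twoDZ i * (⟨.D, n, hn⟩ : Datum).cartanZ i j := by
  have h1 : 3 ≤ n := hn
  have hn0 : (n : ℤ) ≠ 0 := by omega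
  have K := fun a => kWeight_neg ⟨.D, n, hn⟩ (by simp) i a
  have A := edge_weight_D_aux (hn := hn) i j hi hi' hj hj'
  have e1 := K (n - 1)
  have e2 := K n
  have e3 := K 1
  have e4 := K 2
  have e5 := K (n - j)
  have e6 := K (n + 1 - j)
  rw [neg_sub] at e1 e5 e6
  rw [show j - ((n : ℤ) + 1) = j - n - 1 by ring] at e6
  simp only [Datum.edge, twoDZ] at h ⊢
  rw [← A]
  rcases h with ⟨rfl, ⟨rfl, rfl⟩ | ⟨rfl, rfl⟩⟩ | ⟨rfl, ⟨rfl, rfl⟩ | ⟨rfl, rfl⟩⟩ |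
      ⟨h3, h4, ⟨rfl, rfl⟩ | ⟨rfl, rfl⟩⟩
  · rw [if_pos rfl]; linarith
  · rw [if_pos rfl]; linarith
  · rw [if_neg hn0, if_pos rfl]; linarith
  · rw [if_neg hn0, if_pos rfl]; linarith
  · rw [if_neg h3, if_neg h4]
  · rw [if_neg h3, if_neg h4]; linarith

theorem edge_weight (i j a b : ℤ) (hi : 0 ≤ i) (hi' : i ≤ D.n) (hj : 0 ≤ j) (hj' : j ≤ D.n)
    (h : D.edge j a b) :
    2 * (D.kWeight i a - D.kWeight i b) = D.twoDZ i * D.cartanZ i j := by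
  obtain ⟨fam, n, hn⟩ := D
  cases fam
  · exact edge_weight_A i j a b hi hi' hj hj' h
  · exact edge_weight_B i j a b hi hi' hj hj' h
  · exact edge_weight_C i j a b hi hi' hj hj' h
  · exact edge_weight_D i j a b hi hi' hj hj' h

/-- The pairs of commuting generators whose products do not vanish. -/
def Special (i j : ℤ) : Prop :=
  match D.family with
  | .A => False
  | .B => i = 0 ∧ j = 1
  | .C => False
  | .D => (i = 0 ∧ j = 1) ∨ (i = D.n - 1 ∧ j = D.n)

theorem no_path_xx (i j a b c : ℤ) (hi : 0 ≤ i) (hi' : i ≤ D.n) (hj : 0 ≤ j) (hj' : j ≤ D.n)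
    (hij : i ≠ j) (h : D.cartanZ i j = 0) (hs : ¬ D.Special i j) (hs' : ¬ D.Special j i)
    (h1 : D.edge i a b) (h2 : D.edge j b c) : False := by
  obtain ⟨fam, n, hn⟩ := D
  cases fam
  · have h0 : 1 ≤ n := hn
    simp only [Datum.edge, cartanZ, Bond, bondValue, Special] at *
    rw [if_neg hij] at h
    omega
  · have h0 : 2 ≤ n := hn
    simp only [Datum.edge, cartanZ, Bond, bondValue, Special] at *
    rw [if_neg hij] at h
    omega
  · have h0 : 1 ≤ n := hn
    simp only [Datum.edge, cartanZ, Bond, bondValue, Special] at *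
    rw [if_neg hij] at h
    omega
  · have h0 : 3 ≤ n := hn
    have key : (i = 0 → j ≠ 2 ∧ (n = 3 → j ≠ 3)) ∧ (j = 0 → i ≠ 2 ∧ (n = 3 → i ≠ 3)) ∧
        (i = n → j ≠ n - 2) ∧ (j = n → i ≠ n - 2) ∧
        (0 < i → i < n → 0 < j → j < n → j ≠ i + 1 ∧ j ≠ i - 1) := by
      simp only at hi' hj'
      have h' := h
      rw [cartanZ_comm_D] at h'
      refine ⟨?_, ?_, ?_, ?_, ?_⟩
      · rintro rfl
        rw [cartan_D_zero j hj hj'] at h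
        simp only [eDiag] at h; clear h'; omega
      · rintro rfl
        rw [cartan_D_zero i hi hi'] at h'
        simp only [eDiag] at h'; clear h; omega
      · rintro rfl
        rw [cartan_D_n j hj hj'] at h
        simp only [eDiag] at h; clear h'; omega
      · rintro rfl
        rw [cartan_D_n i hi hi'] at h'
        simp only [eDiag] at h'; clear h; omega
      · intro a1 a2 a3 a4
        rw [cartan_D_mid i j a1 a2 a3 a4] at h
        simp only [eDiag] at h; clear h'; omega
    clear h
    obtain ⟨k1, k2, k3, k4, k5⟩ := key
    simp only [Datum.edge, Special] at h1 h2 hs hs'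
    simp only at hi' hj'
    simp only [not_or, not_and] at hs hs'
    rcases h1 with ⟨rfl, h1⟩ | ⟨rfl, h1⟩ | ⟨e1, e2, h1⟩
    · clear k5 k3 k4
      have k1 := k1 rfl
      rcases h2 with ⟨rfl, h2⟩ | ⟨rfl, h2⟩ | ⟨e3, e4, h2⟩ <;> omega
    · clear k5 k1
      have k3 := k3 rfl
      rcases h2 with ⟨rfl, h2⟩ | ⟨rfl, h2⟩ | ⟨e3, e4, h2⟩ <;> omega
    · clear k1 k3
      rcases h2 with ⟨rfl, h2⟩ | ⟨rfl, h2⟩ | ⟨e3, e4, h2⟩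
      · have k2 := k2 rfl
        clear k4 k5
        omega
      · have k4 := k4 rfl
        clear k2 k5
        omega
      · have k5 := k5 (by omega) (by omega) (by omega) (by omega)
        clear k2 k4
        omega

theorem no_path_xy (i j a b c : ℤ) (hi : 0 ≤ i) (hi' : i ≤ D.n) (hj : 0 ≤ j) (hj' : j ≤ D.n)
    (hij : i ≠ j) (hs : ¬ D.Special i j) (hs' : ¬ D.Special j i)
    (h1 : D.edge i a b) (h2 : D.edge j c b) : False := by
  obtain ⟨fam, n, hn⟩ := D
  cases fam
  · have h0 : 1 ≤ n := hn
    simp only [Datum.edge, Special] at *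
    omega
  · have h0 : 2 ≤ n := hn
    simp only [Datum.edge, Special] at *
    omega
  · have h0 : 1 ≤ n := hn
    simp only [Datum.edge, Special] at *
    omega
  · have h0 : 3 ≤ n := hn
    simp only [Datum.edge, Special] at *
    omega

theorem no_path_yx (i j a b c : ℤ) (hi : 0 ≤ i) (hi' : i ≤ D.n) (hj : 0 ≤ j) (hj' : j ≤ D.n)
    (hij : i ≠ j) (hs : ¬ D.Special i j) (hs' : ¬ D.Special j i)
    (h1 : D.edge i b a) (h2 : D.edge j b c) : False := by
  obtain ⟨fam, n, hn⟩ := D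
  cases fam
  · have h0 : 1 ≤ n := hn
    simp only [Datum.edge, Special] at *
    omega
  · have h0 : 2 ≤ n := hn
    simp only [Datum.edge, Special] at *
    omega
  · have h0 : 1 ≤ n := hn
    simp only [Datum.edge, Special] at *
    omega
  · have h0 : 3 ≤ n := hn
    simp only [Datum.edge, Special] at *
    omega

/-- There is no path of edges labelled `i, i, j`, in any order, except possibly if
`a_{ij} = -2`. -/
theorem no_path_two (i j a b c d : ℤ) (hi : 0 ≤ i) (hi' : i ≤ D.n) (hj : 0 ≤ j) (hj' : j ≤ D.n)
    (hij : i ≠ j) (h : D.cartanZ i j = -1) :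
    (D.edge i a b → D.edge i b c → D.edge j c d → False) ∧
    (D.edge i a b → D.edge j b c → D.edge i c d → False) ∧
    (D.edge j a b → D.edge i b c → D.edge i c d → False) := by
  obtain ⟨fam, n, hn⟩ := D
  cases fam
  · have h0 : 1 ≤ n := hn
    simp only [Datum.edge, cartanZ, Bond, bondValue] at *
    rw [if_neg hij] at h
    refine ⟨fun h1 h2 h3 => ?_, fun h1 h2 h3 => ?_, fun h1 h2 h3 => ?_⟩ <;> omega
  · have h0 : 2 ≤ n := hn
    simp only [Datum.edge, cartanZ, Bond, bondValue] at *
    rw [if_neg hij] at h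
    refine ⟨fun h1 h2 h3 => ?_, fun h1 h2 h3 => ?_, fun h1 h2 h3 => ?_⟩ <;> omega
  · have h0 : 1 ≤ n := hn
    simp only [Datum.edge, cartanZ, Bond, bondValue] at *
    rw [if_neg hij] at h
    refine ⟨fun h1 h2 h3 => ?_, fun h1 h2 h3 => ?_, fun h1 h2 h3 => ?_⟩ <;> omega
  · have h0 : 3 ≤ n := hn
    simp only [Datum.edge, cartanZ, Bond, bondValue] at *
    rw [if_neg hij] at h
    refine ⟨fun h1 h2 h3 => ?_, fun h1 h2 h3 => ?_, fun h1 h2 h3 => ?_⟩ <;> omega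

/-- There is no path of edges labelled `i, i, i, j`, in any order. -/
theorem no_path_three (i j a b c d e : ℤ) (hi : 0 ≤ i) (hi' : i ≤ D.n) (hj : 0 ≤ j)
    (hj' : j ≤ D.n) (hij : i ≠ j) (h : D.cartanZ i j = -2) :
    (D.edge i a b → D.edge i b c → D.edge i c d → D.edge j d e → False) ∧
    (D.edge i a b → D.edge i b c → D.edge j c d → D.edge i d e → False) ∧
    (D.edge i a b → D.edge j b c → D.edge i c d → D.edge i d e → False) ∧
    (D.edge j a b → D.edge i b c → D.edge i c d → D.edge i d e → False) := by
  obtain ⟨fam, n, hn⟩ := D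
  cases fam
  · have h0 : 1 ≤ n := hn
    simp only [Datum.edge, cartanZ, Bond, bondValue] at *
    rw [if_neg hij] at h
    refine ⟨fun h1 h2 h3 h4 => ?_, fun h1 h2 h3 h4 => ?_, fun h1 h2 h3 h4 => ?_,
      fun h1 h2 h3 h4 => ?_⟩ <;> omega
  · have h0 : 2 ≤ n := hn
    simp only [Datum.edge, cartanZ, Bond, bondValue] at *
    rw [if_neg hij] at h
    have : i = n := by omega
    subst this
    refine ⟨fun h1 h2 h3 h4 => ?_, fun h1 h2 h3 h4 => ?_, fun h1 h2 h3 h4 => ?_,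
      fun h1 h2 h3 h4 => ?_⟩ <;> omega
  · have h0 : 1 ≤ n := hn
    simp only [Datum.edge, cartanZ, Bond, bondValue] at *
    rw [if_neg hij] at h
    have : j = 0 ∨ j = n := by omega
    refine ⟨fun h1 h2 h3 h4 => ?_, fun h1 h2 h3 h4 => ?_, fun h1 h2 h3 h4 => ?_,
      fun h1 h2 h3 h4 => ?_⟩ <;> omega
  · have h0 : 3 ≤ n := hn
    simp only [Datum.edge, cartanZ, Bond, bondValue] at *
    rw [if_neg hij] at h
    omega

/-- The products of special pairs of generators commute. -/
theorem special_commute (v : Lˣ) {i j : ℤ} (h : D.Special i j) :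
    Commute (D.vecX L v i) (D.vecX L v j) ∧ Commute (D.vecY L v i) (D.vecY L v j) ∧
    Commute (D.vecX L v i) (D.vecY L v j) ∧ Commute (D.vecX L v j) (D.vecY L v i) := by
  have key : ∀ (a b : ℤ) (α α' β β' : L), a ∈ D.basisSet → b ∈ D.basisSet → -a ∈ D.basisSet →
      -b ∈ D.basisSet → a ≠ b → a ≠ -b → a ≠ 0 → b ≠ 0 →
      Commute (α • D.P L a b) (β • D.P L b (-a)) ∧ Commute (α' • D.P L b a) (β' • D.P L (-a) b) ∧
      Commute (α • D.P L a b) (β' • D.P L (-a) b) ∧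
      Commute (β • D.P L b (-a)) (α' • D.P L b a) := by
    intro a b α α' β β' ha hb hna hnb h1 h2 h3 h4
    have c1 := D.commute_P (L := L) hb hnb h1 h2 h3 h4
    have c2 := D.commute_P (L := L) (a := -a) (b := b) hb hnb (by omega) (by omega) (by omega) h4
    have c3 := D.commute_P (L := L) (a := -b) (b := a) ha hna (by omega) (by omega) (by omega) h3
    have c4 := D.commute_P (L := L) (a := b) (b := -a) hna (by simpa using ha) (by omega)
      (by omega) h4 (by omega)
    have e3 : D.P L (-b) a = -D.P L (-a) b := by
      rw [← D.P_neg (-a) b, neg_neg]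
    have e4 : D.P L (-a) (-b) = -D.P L b a := D.P_neg b a
    rw [neg_neg] at c2 c3
    rw [e3] at c3
    rw [e4] at c4
    refine ⟨(c1.smul_left _).smul_right _, (c2.symm.smul_left _).smul_right _,
      ((by simpa using c3.neg_left.symm : Commute _ _).smul_left _).smul_right _,
      ((by simpa using c4.neg_right : Commute _ _).smul_left _).smul_right _⟩
  obtain ⟨fam, n, hn⟩ := D
  cases fam
  · exact h.elim
  · obtain ⟨rfl, rfl⟩ := h
    have h0 : 2 ≤ n := hn
    have hF := F_eq_P ⟨.B, n, hn⟩ L (by simp)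
    have e : (1 : ℤ) ≠ n := by omega
    have := key (n - 1) (-n) (v : L) ((v⁻¹ : Lˣ) : L) 1 1
    simp only [mem_basisSet] at this
    have := this (by omega) (by omega) (by omega) (by omega) (by omega) (by omega) (by omega)
      (by omega)
    simp only [vecX, vecY, hF, e, if_true, if_false, one_ne_zero]
    rw [show -((n : ℤ) + 1 - 1) = -n by ring, show -(n : ℤ) + 1 = -(n - 1) by ring]
    simpa only [one_smul] using this
  · exact h.elim
  · have h0 : 3 ≤ n := hn
    have hF := F_eq_P ⟨.D, n, hn⟩ L (by simp)
    rcases h with ⟨rfl, rfl⟩ | ⟨h1, h2⟩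
    · have e : (1 : ℤ) ≠ n := by omega
      have := key (n - 1) (-n) (v : L) ((v⁻¹ : Lˣ) : L) 1 1
      simp only [mem_basisSet] at this
      have := this (by omega) (by omega) (by omega) (by omega) (by omega) (by omega) (by omega)
        (by omega)
      simp only [vecX, vecY, hF, e, if_true, if_false, one_ne_zero]
      rw [show -((n : ℤ) + 1 - 1) = -n by ring, show -(n : ℤ) + 1 = -(n - 1) by ring]
      simpa only [one_smul] using this
    · simp only at h1 h2
      have e0 : i ≠ 0 := by omega
      have e1 : i ≠ n := by omega
      have e2 : j ≠ 0 := by omega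
      have := key (-2) (-1) (1 : L) 1 (-1) (-1)
      simp only [mem_basisSet] at this
      have := this (by omega) (by omega) (by omega) (by omega) (by omega) (by omega) (by omega)
        (by omega)
      have p1 : (⟨.D, n, hn⟩ : Datum).P L (-1) 2 = -(⟨.D, n, hn⟩ : Datum).P L (-2) 1 := by
        rw [← P_neg]; simp
      have p2 : (⟨.D, n, hn⟩ : Datum).P L 2 (-1) = -(⟨.D, n, hn⟩ : Datum).P L 1 (-2) := by
        rw [← P_neg]; simp
      simp only [neg_neg, one_smul, neg_smul, p1, p2] at this
      simp only [vecX, vecY, hF, e0, e1, e2, h2, if_true, if_false]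
      rw [if_neg (show (n : ℤ) ≠ 0 by omega), if_neg (show (n : ℤ) ≠ 0 by omega), h1,
        show -((n : ℤ) + 1 - (n - 1)) = -2 by ring, show -(2 : ℤ) + 1 = -1 by ring]
      exact this

theorem vec_commute_xx (v : Lˣ) {i j : ℤ} (hi : 0 ≤ i) (hi' : i ≤ D.n) (hj : 0 ≤ j)
    (hj' : j ≤ D.n) (hij : i ≠ j) (h : D.cartanZ i j = 0) (h' : D.cartanZ j i = 0) :
    Commute (D.vecX L v i) (D.vecX L v j) ∧ Commute (D.vecY L v i) (D.vecY L v j) := by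
  by_cases hs : D.Special i j
  · exact ⟨(D.special_commute v hs).1, (D.special_commute v hs).2.1⟩
  by_cases hs' : D.Special j i
  · exact ⟨(D.special_commute v hs').1.symm, (D.special_commute v hs').2.1.symm⟩
  have X := D.vecX_supp (L := L) v i hi hi'
  have X' := D.vecX_supp (L := L) v j hj hj'
  have Y := D.vecY_supp (L := L) v i hi hi'
  have Y' := D.vecY_supp (L := L) v j hj hj'
  constructor
  · rw [Commute, SemiconjBy,
      X.mul2 X' fun a b c => D.no_path_xx i j a b c hi hi' hj hj' hij h hs hs',
      X'.mul2 X fun a b c => D.no_path_xx j i a b c hj hj' hi hi' hij.symm h' hs' hs]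
  · rw [Commute, SemiconjBy,
      Y.mul2 Y' fun a b c h1 h2 => D.no_path_xx j i c b a hj hj' hi hi' hij.symm h' hs' hs h2 h1,
      Y'.mul2 Y fun a b c h1 h2 => D.no_path_xx i j c b a hi hi' hj hj' hij h hs hs' h2 h1]

theorem vec_commute_xy (v : Lˣ) {i j : ℤ} (hi : 0 ≤ i) (hi' : i ≤ D.n) (hj : 0 ≤ j)
    (hj' : j ≤ D.n) (hij : i ≠ j) : Commute (D.vecX L v i) (D.vecY L v j) := by
  by_cases hs : D.Special i j
  · exact (D.special_commute v hs).2.2.1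
  by_cases hs' : D.Special j i
  · exact (D.special_commute v hs').2.2.2
  have X := D.vecX_supp (L := L) v i hi hi'
  have Y' := D.vecY_supp (L := L) v j hj hj'
  rw [Commute, SemiconjBy,
    X.mul2 Y' fun a b c => D.no_path_xy i j a b c hi hi' hj hj' hij hs hs',
    Y'.mul2 X fun a b c => D.no_path_yx j i a b c hj hj' hi hi' hij.symm hs' hs]

section SerreZero

variable {R : Type*} [Ring R] [Algebra Kq R]

theorem serre_one_of_commute {x y : R} (h : Commute x y) (Q : Kq) : serre Q 1 x y = 0 := by
  have := h.eq
  simp [serre, divPow, Finset.sum_range_succ, this, smul_comm (qFact Q 0)⁻¹]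

theorem serre_zero_of {x y : R} (Q : Kq) (m : ℕ)
    (h : ∀ r ≤ m, x ^ (m - r) * y * x ^ r = 0) : serre Q m x y = 0 := by
  rw [serre]
  refine Finset.sum_eq_zero fun r hr => ?_
  have := h r (by have := Finset.mem_range.1 hr; omega)
  simp [divPow, this]

theorem serre_two_of {x y : R} (Q : Kq) (h1 : x * x * y = 0) (h2 : x * y * x = 0)
    (h3 : y * x * x = 0) : serre Q 2 x y = 0 := by
  refine serre_zero_of Q 2 fun r hr => ?_
  interval_cases r
  · simpa [pow_two] using h1
  · simpa using h2
  · simpa [pow_two, ← mul_assoc] using h3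

theorem serre_three_of {x y : R} (Q : Kq) (h1 : x * x * x * y = 0) (h2 : x * x * y * x = 0)
    (h3 : x * y * x * x = 0) (h4 : y * x * x * x = 0) : serre Q 3 x y = 0 := by
  refine serre_zero_of Q 3 fun r hr => ?_
  interval_cases r
  · simpa [pow_succ, ← mul_assoc] using h1
  · simpa [pow_succ, ← mul_assoc] using h2
  · simpa [pow_succ, ← mul_assoc] using h3
  · simpa [pow_succ, ← mul_assoc] using h4

end SerreZero

theorem vec_serre (v : Lˣ) (i j : D.I) (hij : i ≠ j) :
    serre (D.qi i) (1 - D.cartan i j).toNat (D.vecGen L v (.x i)) (D.vecGen L v (.x j)) = 0 ∧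
    serre (D.qi i) (1 - D.cartan i j).toNat (D.vecGen L v (.y i)) (D.vecGen L v (.y j)) = 0 := by
  have hi' : ((i : ℕ) : ℤ) ≤ D.n := by have := i.2; omega
  have hj' : ((j : ℕ) : ℤ) ≤ D.n := by have := j.2; omega
  have hi : 0 ≤ ((i : ℕ) : ℤ) := by omega
  have hj : 0 ≤ ((j : ℕ) : ℤ) := by omega
  have hij' : ((i : ℕ) : ℤ) ≠ (j : ℕ) := fun h => hij (Fin.ext (by exact_mod_cast h))
  have X := D.vecX_supp (L := L) v _ hi hi'
  have X' := D.vecX_supp (L := L) v _ hj hj'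
  have Y := D.vecY_supp (L := L) v _ hi hi'
  have Y' := D.vecY_supp (L := L) v _ hj hj'
  rcases D.cartan_cases hij with h | h | h
  · have h' : D.cartan j i = 0 := by
      have := D.cartan_symm i j
      rw [h, mul_zero, eq_comm, mul_eq_zero] at this
      refine this.resolve_left fun h0 => ?_
      have := D.qi_sub_inv j
      rw [qi, h0] at this
      simp at this
    have C := D.vec_commute_xx (L := L) v hi hi' hj hj' hij' h h'
    rw [h]
    exact ⟨serre_one_of_commute C.1 _, serre_one_of_commute C.2 _⟩
  · have p := fun a b c d => D.no_path_two _ _ a b c d hi hi' hj hj' hij' h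
    rw [h]
    constructor
    · exact serre_two_of _ (X.mul3 X X' fun a b c d => (p a b c d).1)
        (X.mul3 X' X fun a b c d => (p a b c d).2.1) (X'.mul3 X X fun a b c d => (p a b c d).2.2)
    · exact serre_two_of _ (Y.mul3 Y Y' fun a b c d h1 h2 h3 => (p d c b a).2.2 h3 h2 h1)
        (Y.mul3 Y' Y fun a b c d h1 h2 h3 => (p d c b a).2.1 h3 h2 h1)
        (Y'.mul3 Y Y fun a b c d h1 h2 h3 => (p d c b a).1 h3 h2 h1)
  · have p := fun a b c d e => D.no_path_three _ _ a b c d e hi hi' hj hj' hij' h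
    rw [h]
    constructor
    · exact serre_three_of _ (X.mul4 X X X' fun a b c d e => (p a b c d e).1)
        (X.mul4 X X' X fun a b c d e => (p a b c d e).2.1)
        (X.mul4 X' X X fun a b c d e => (p a b c d e).2.2.1)
        (X'.mul4 X X X fun a b c d e => (p a b c d e).2.2.2)
    · exact serre_three_of _
        (Y.mul4 Y Y Y' fun a b c d e h1 h2 h3 h4 => (p e d c b a).2.2.2 h4 h3 h2 h1)
        (Y.mul4 Y Y' Y fun a b c d e h1 h2 h3 h4 => (p e d c b a).2.2.1 h4 h3 h2 h1)
        (Y.mul4 Y' Y Y fun a b c d e h1 h2 h3 h4 => (p e d c b a).2.1 h4 h3 h2 h1)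
        (Y'.mul4 Y Y Y fun a b c d e h1 h2 h3 h4 => (p e d c b a).1 h4 h3 h2 h1)

theorem vec_weight (i j : D.I) {a b : ℤ} (h : D.edge (j : ℕ) a b) :
    q ^ D.kWeight (i : ℕ) a = D.qi i ^ D.cartan i j * q ^ D.kWeight (i : ℕ) b := by
  have hi' : ((i : ℕ) : ℤ) ≤ D.n := by have := i.2; omega
  have hj' : ((j : ℕ) : ℤ) ≤ D.n := by have := j.2; omega
  have := D.edge_weight (i : ℕ) (j : ℕ) a b (by omega) hi' (by omega) hj' h
  rw [q_zpow, q_zpow, qi, ← zpow_mul, ← zpow_add₀ qHalf_ne_zero]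
  congr 1
  simp only [twoD, cartan]
  linarith

variable (L)

theorem vec_relations (v : Lˣ) : D.UqRelations (D.vecGen L v) where
  k_kinv i := by
    have hq : q ≠ 0 := by rw [← qHalf_sq]; exact pow_ne_zero _ qHalf_ne_zero
    simp only [vecGen, Matrix.diagonal_mul_diagonal, ← map_mul, ← zpow_add₀ hq, add_neg_cancel,
      neg_add_cancel, zpow_zero, map_one, Matrix.diagonal_one]
  kinv_k i := by
    have hq : q ≠ 0 := by rw [← qHalf_sq]; exact pow_ne_zero _ qHalf_ne_zero
    simp only [vecGen, Matrix.diagonal_mul_diagonal, ← map_mul, ← zpow_add₀ hq, add_neg_cancel,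
      neg_add_cancel, zpow_zero, map_one, Matrix.diagonal_one]
  k_k i j := by
    simp only [vecGen, Matrix.diagonal_mul_diagonal, mul_comm]
  k_x i j := by
    have hj' : ((j : ℕ) : ℤ) ≤ D.n := by have := j.2; omega
    ext a b
    simp only [vecGen, Matrix.diagonal_mul, Matrix.smul_apply, Matrix.mul_diagonal]
    by_cases h : D.edge (j : ℕ) a b
    · rw [D.vec_weight i j h, map_mul, Algebra.smul_def]; ring
    · rw [D.vecX_supp v _ (by omega) hj' a b h]; simp
  k_y i j := by
    have hj' : ((j : ℕ) : ℤ) ≤ D.n := by have := j.2; omega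
    ext a b
    simp only [vecGen, Matrix.diagonal_mul, Matrix.smul_apply, Matrix.mul_diagonal]
    by_cases h : D.edge (j : ℕ) b a
    · rw [D.vec_weight i j h, map_mul, Algebra.smul_def]
      have : algebraMap Kq L (D.qi i ^ (-D.cartan i j)) * algebraMap Kq L (D.qi i ^ D.cartan i j)
          = 1 := by
        rw [← map_mul, ← zpow_add₀ (D.qi_ne_zero i)]; simp
      linear_combination (-(algebraMap Kq L (q ^ D.kWeight (i : ℕ) a)) *
        D.vecY L v (j : ℕ) a b) * this
    · rw [D.vecY_supp v _ (by omega) hj' a b h]; simp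
  x_y_self i := D.vec_x_y_self v i
  x_y i j h := by
    have hi' : ((i : ℕ) : ℤ) ≤ D.n := by have := i.2; omega
    have hj' : ((j : ℕ) : ℤ) ≤ D.n := by have := j.2; omega
    have hij' : ((i : ℕ) : ℤ) ≠ (j : ℕ) := fun h' => h (Fin.ext (by exact_mod_cast h'))
    exact sub_eq_zero.2 (D.vec_commute_xy v (by omega) hi' (by omega) hj' hij').eq
  serre_x i j h := (D.vec_serre v i j h).1
  serre_y i j h := (D.vec_serre v i j h).2

/-- The vector representation of `U_q(g)`, evaluated at an invertible element `v` of a commutative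
`Kq`-algebra. -/
def vecRep (v : Lˣ) : D.Uq →ₐ[Kq] Matrix D.Basis D.Basis L := D.lift (D.vec_relations L v)

end VecRep

/-! ### Rotational symmetries and rotation matrices -/

/-- Names for the generating diagram automorphisms `ρ`, `φ₁`, `π`. -/
inductive Rot
  | rho
  | phi
  | pi

/-- `ρ = (0 1 … n)`, `φ₁ = (0 1)`, and `π`, which maps `i` to `n - i`. -/
def rotPerm : Rot → Equiv.Perm D.I
  | .rho => finRotate (D.n + 1)
  | .phi => Equiv.swap 0 1
  | .pi => Fin.revPerm

/-- The generators used for the group of rotational symmetries. -/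
def rotGens : Set Rot :=
  match D.family with
  | .A => {.rho}
  | .B => {.phi}
  | .C => {.pi}
  | .D => {.phi, .pi}

/-- The group `Σ_A` of rotational symmetries: `⟨ρ⟩`, `⟨φ₁⟩`, `⟨π⟩`, `⟨φ₁, π⟩` for `sl`, `so_{2n+1}`,
`sp`, `so_{2n}`, respectively. -/
def Sigma : Subgroup (Equiv.Perm D.I) := Subgroup.closure (D.rotPerm '' D.rotGens)

theorem rho_val {n : ℕ} (i : Fin (n + 1)) :
    ((finRotate (n + 1) i : ℕ) : ℤ) = if ((i : ℕ) : ℤ) = n then 0 else ((i : ℕ) : ℤ) + 1 := by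
  split_ifs with h
  · have : i = Fin.last n := Fin.ext (by simpa using h)
    rw [this, finRotate_last]; simp
  · have h2 := i.2
    have : (i : ℕ) < n := by omega
    rw [finRotate_of_lt this]; simp

theorem phi_val {n : ℕ} (hn : 1 ≤ n) (i : Fin (n + 1)) :
    ((Equiv.swap (0 : Fin (n + 1)) 1 i : ℕ) : ℤ) =
      if ((i : ℕ) : ℤ) = 0 then 1 else if ((i : ℕ) : ℤ) = 1 then 0 else ((i : ℕ) : ℤ) := by
  obtain ⟨m, rfl⟩ : ∃ m, n = m + 1 := ⟨n - 1, by omega⟩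
  rw [Equiv.swap_apply_def]
  have e0 : i = 0 ↔ ((i : ℕ) : ℤ) = 0 := by rw [Fin.ext_iff]; simp
  have e1 : i = 1 ↔ ((i : ℕ) : ℤ) = 1 := by rw [Fin.ext_iff]; simp
  simp only [e0, e1]
  split_ifs <;> simp

theorem pi_val {n : ℕ} (i : Fin (n + 1)) :
    ((Fin.revPerm i : ℕ) : ℤ) = n - ((i : ℕ) : ℤ) := by
  have := i.2
  rw [Fin.revPerm_apply, Fin.val_rev]; omega

theorem cartan_eq_of {i j i' j' : D.I} (h1 : (i : ℕ) = (j : ℕ) ↔ (i' : ℕ) = (j' : ℕ))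
    (h2 : (D.Bond (i : ℕ) (j : ℕ) ∨ D.Bond (j : ℕ) (i : ℕ)) ↔
      (D.Bond (i' : ℕ) (j' : ℕ) ∨ D.Bond (j' : ℕ) (i' : ℕ)))
    (h3 : D.Bond (i : ℕ) (j : ℕ) ∨ D.Bond (j : ℕ) (i : ℕ) →
      D.bondValue (i : ℕ) (j : ℕ) = D.bondValue (i' : ℕ) (j' : ℕ)) :
    D.cartan i j = D.cartan i' j' := by
  simp only [cartan, cartanZ, Nat.cast_inj, h1, ← h2]
  split_ifs with a b
  · rfl
  · exact h3 b
  · rfl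

theorem bond_pi {n : ℕ} {hn} {x y x' y' : ℤ} (hx : x' = n - x) (hy : y' = n - y)
    (h1 : x ≤ n) (h3 : y ≤ n) (h : (⟨.D, n, hn⟩ : Datum).Bond x y) :
    (⟨.D, n, hn⟩ : Datum).Bond x' y' ∨ (⟨.D, n, hn⟩ : Datum).Bond y' x' := by
  have h0 : 3 ≤ n := hn
  subst hx hy
  rw [bond_D] at h
  rcases h with h | h | h | h
  · right; rw [bond_D]; omega
  · right; rw [bond_D]; omega
  · right; rw [bond_D]; omega
  · right; rw [bond_D]; omega

theorem bond_phi {n : ℕ} {hn} {x y x' y' : ℤ}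
    (hx : x' = if x = 0 then 1 else if x = 1 then 0 else x)
    (hy : y' = if y = 0 then 1 else if y = 1 then 0 else y) (h1 : x ≤ n) (h3 : y ≤ n) (h : (⟨.D, n, hn⟩ : Datum).Bond x y) :
    (⟨.D, n, hn⟩ : Datum).Bond x' y' ∨ (⟨.D, n, hn⟩ : Datum).Bond y' x' := by
  have h0 : 3 ≤ n := hn
  rw [bond_D] at h
  rcases h with ⟨rfl, rfl⟩ | ⟨h4, rfl, h5⟩ | ⟨h4, rfl⟩ | ⟨h4, rfl, rfl⟩
  · left
    simp only [if_true] at hx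
    rw [if_neg (by omega), if_neg (by omega)] at hy
    rw [bond_D]; omega
  · left
    rw [if_neg (by omega), if_neg (by omega)] at hy
    by_cases h6 : x = 1
    · rw [if_neg (by omega), if_pos h6] at hx
      rw [bond_D]; omega
    · rw [if_neg (by omega), if_neg (by omega)] at hx
      rw [bond_D]; omega
  · left
    rw [if_neg (by omega), if_neg (by omega)] at hy
    by_cases h6 : x = 1
    · rw [if_neg (by omega), if_pos h6] at hx
      rw [bond_D]; omega
    · rw [if_neg (by omega), if_neg (by omega)] at hx
      rw [bond_D]; omega
  · left
    simp only [if_true] at hx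
    rw [if_neg (by omega), if_neg (by omega)] at hy
    rw [bond_D]; omega

theorem rotPerm_mem_Aut {g : Rot} (hg : g ∈ D.rotGens) : D.rotPerm g ∈ D.Aut := by
  intro i j
  have inj : (D.rotPerm g i : ℕ) = (D.rotPerm g j : ℕ) ↔ (i : ℕ) = (j : ℕ) := by
    rw [← Fin.ext_iff, ← Fin.ext_iff, (D.rotPerm g).injective.eq_iff]
  obtain ⟨fam, n, hn⟩ := D
  have hi : (i : ℕ) < n + 1 := i.2
  have hj : (j : ℕ) < n + 1 := j.2
  have hi' : (rotPerm ⟨fam, n, hn⟩ g i : ℕ) < n + 1 := Fin.isLt _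
  have hj' : (rotPerm ⟨fam, n, hn⟩ g j : ℕ) < n + 1 := Fin.isLt _
  cases fam
  · have h0 : 1 ≤ n := hn
    obtain rfl : g = .rho := hg
    have vi : ((rotPerm ⟨.A, n, hn⟩ .rho i : ℕ) : ℤ) = _ := rho_val (n := n) i
    have vj : ((rotPerm ⟨.A, n, hn⟩ .rho j : ℕ) : ℤ) = _ := rho_val (n := n) j
    refine cartan_eq_of _ inj ?_ fun _ => rfl
    simp only [Bond]
    omega
  · have h0 : 2 ≤ n := hn
    have h1 : 1 ≤ n := by omega
    obtain rfl : g = .phi := hg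
    have vi : ((rotPerm ⟨.B, n, hn⟩ .phi i : ℕ) : ℤ) = _ := phi_val (n := n) h1 i
    have vj : ((rotPerm ⟨.B, n, hn⟩ .phi j : ℕ) : ℤ) = _ := phi_val (n := n) h1 j
    refine cartan_eq_of _ inj ?_ ?_ <;> simp only [Bond, bondValue] <;> omega
  · have h0 : 1 ≤ n := hn
    obtain rfl : g = .pi := hg
    have vi : ((rotPerm ⟨.C, n, hn⟩ .pi i : ℕ) : ℤ) = _ := pi_val (n := n) i
    have vj : ((rotPerm ⟨.C, n, hn⟩ .pi j : ℕ) : ℤ) = _ := pi_val (n := n) j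
    refine cartan_eq_of _ inj ?_ ?_ <;> simp only [Bond, bondValue] <;> omega
  · have h0 : 3 ≤ n := hn
    have h1 : 1 ≤ n := by omega
    rcases hg with rfl | rfl
    · have vi : ((rotPerm ⟨.D, n, hn⟩ .phi i : ℕ) : ℤ) = _ := phi_val (n := n) h1 i
      have vj : ((rotPerm ⟨.D, n, hn⟩ .phi j : ℕ) : ℤ) = _ := phi_val (n := n) h1 j
      have wi : ((i : ℕ) : ℤ) = if ((rotPerm ⟨.D, n, hn⟩ .phi i : ℕ) : ℤ) = 0 then 1 else
          if ((rotPerm ⟨.D, n, hn⟩ .phi i : ℕ) : ℤ) = 1 then 0 else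
          ((rotPerm ⟨.D, n, hn⟩ .phi i : ℕ) : ℤ) := by omega
      have wj : ((j : ℕ) : ℤ) = if ((rotPerm ⟨.D, n, hn⟩ .phi j : ℕ) : ℤ) = 0 then 1 else
          if ((rotPerm ⟨.D, n, hn⟩ .phi j : ℕ) : ℤ) = 1 then 0 else
          ((rotPerm ⟨.D, n, hn⟩ .phi j : ℕ) : ℤ) := by omega
      refine cartan_eq_of _ inj ⟨?_, ?_⟩ fun _ => rfl
      · rintro (h | h)
        · exact bond_phi wi wj (by omega) (by omega) h
        · exact (bond_phi wj wi (by omega) (by omega) h).symm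
      · rintro (h | h)
        · exact bond_phi vi vj (by omega) (by omega) h
        · exact (bond_phi vj vi (by omega) (by omega) h).symm
    · have vi : ((rotPerm ⟨.D, n, hn⟩ .pi i : ℕ) : ℤ) = _ := pi_val (n := n) i
      have vj : ((rotPerm ⟨.D, n, hn⟩ .pi j : ℕ) : ℤ) = _ := pi_val (n := n) j
      refine cartan_eq_of _ inj ⟨?_, ?_⟩ fun _ => rfl
      · rintro (h | h)
        · exact bond_pi (x := ((rotPerm ⟨.D, n, hn⟩ .pi i : ℕ) : ℤ))
            (y := ((rotPerm ⟨.D, n, hn⟩ .pi j : ℕ) : ℤ)) (by omega) (by omega) (by omega)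
            (by omega) h
        · exact (bond_pi (x := ((rotPerm ⟨.D, n, hn⟩ .pi j : ℕ) : ℤ))
            (y := ((rotPerm ⟨.D, n, hn⟩ .pi i : ℕ) : ℤ)) (by omega) (by omega) (by omega)
            (by omega) h).symm
      · rintro (h | h)
        · exact bond_pi vi vj (by omega) (by omega) h
        · exact (bond_pi vj vi (by omega) (by omega) h).symm

theorem Sigma_le_Aut : D.Sigma ≤ D.Aut :=
  (Subgroup.closure_le _).2 (by rintro _ ⟨g, hg, rfl⟩; exact D.rotPerm_mem_Aut hg)

/-- The chosen expressions for the elements of `Σ_A` in terms of the generators: the powers of `ρ`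
with exponents `0, …, n` for `sl_{n+1}`; `1, φ₁` for `so_{2n+1}`; `1, π` for `sp_{2n}`;
`1, φ₁, π, φ₁π, πφ₁, φ₁πφ₁, πφ₁π, φ₁πφ₁π` for `so_{2n}`. -/
def rotWords : List (List Rot) :=
  match D.family with
  | .A => (List.range (D.n + 1)).map fun m => List.replicate m .rho
  | .B => [[], [.phi]]
  | .C => [[], [.pi]]
  | .D => [[], [.phi], [.pi], [.phi, .pi], [.pi, .phi], [.phi, .pi, .phi], [.pi, .phi, .pi],
      [.phi, .pi, .phi, .pi]]

/-- The diagram automorphism represented by a word, where products are read from left to right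
(that is, the leftmost factor acts first). -/
def wordPerm : List Rot → Equiv.Perm D.I
  | [] => 1
  | g :: w => wordPerm w * D.rotPerm g

/-- The chosen expression for an element of `Σ_A`. -/
def rotWord (σ : Equiv.Perm D.I) : List Rot :=
  (D.rotWords.find? fun w => D.wordPerm w = σ).getD []

theorem rho_pow_val {n : ℕ} (m : ℕ) (i : Fin (n + 1)) :
    (((finRotate (n + 1)) ^ m) i : ℕ) = ((i : ℕ) + m) % (n + 1) := by
  induction m with
  | zero => simp [Nat.mod_eq_of_lt i.2]
  | succ m ih =>
    rw [pow_succ', Equiv.Perm.mul_apply]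
    have h := rho_val ((finRotate (n + 1) ^ m) i)
    rw [ih] at h
    have e : ((i : ℕ) + (m + 1)) % (n + 1) = (((i : ℕ) + m) % (n + 1) + 1) % (n + 1) := by
      rw [Nat.mod_add_mod, add_assoc]
    rw [e]
    have lt : ((i : ℕ) + m) % (n + 1) < n + 1 := Nat.mod_lt _ (by omega)
    by_cases hc : ((i : ℕ) + m) % (n + 1) = n
    · rw [hc] at h ⊢
      rw [if_pos rfl] at h
      have h' : (finRotate (n + 1) ((finRotate (n + 1) ^ m) i) : ℕ) = 0 := by exact_mod_cast h
      rw [h', Nat.mod_self]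
    · rw [Nat.mod_eq_of_lt (by omega)]
      rw [if_neg (by omega)] at h
      omega

theorem rho_pow_order (n : ℕ) : (finRotate (n + 1)) ^ (n + 1) = 1 := by
  ext i
  rw [rho_pow_val]
  simp [Nat.mod_eq_of_lt i.2]

theorem wordPerm_replicate (m : ℕ) (g : Rot) :
    D.wordPerm (List.replicate m g) = D.rotPerm g ^ m := by
  induction m with
  | zero => rfl
  | succ m ih => rw [List.replicate_succ, wordPerm, ih, pow_succ]

theorem phi_sq : D.rotPerm .phi * D.rotPerm .phi = 1 := by
  simp [rotPerm]

theorem pi_sq : D.rotPerm .pi * D.rotPerm .pi = 1 := by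
  ext i; simp [rotPerm]

/-- The braid relation of the dihedral group of order 8. -/
theorem phi_pi (hn : 3 ≤ D.n) : D.rotPerm .phi * D.rotPerm .pi * D.rotPerm .phi * D.rotPerm .pi =
    D.rotPerm .pi * D.rotPerm .phi * D.rotPerm .pi * D.rotPerm .phi := by
  ext i
  have h1 : 1 ≤ D.n := by omega
  have hi := i.2
  have p : ∀ i, ((D.rotPerm .phi i : ℕ) : ℤ) = _ := fun i => phi_val h1 i
  have r : ∀ i, ((D.rotPerm .pi i : ℕ) : ℤ) = _ := fun i => pi_val (n := D.n) i
  simp only [Equiv.Perm.mul_apply]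
  zify
  rw [p, r, p, r, r, p, r, p]
  omega

/-- The chosen expressions exhaust `Σ_A`. -/
theorem exists_rotWord {σ : Equiv.Perm D.I} (hσ : σ ∈ D.Sigma) :
    ∃ w ∈ D.rotWords, D.wordPerm w = σ := by
  have closed : (∀ g ∈ D.rotGens, ∀ w ∈ D.rotWords, ∃ w' ∈ D.rotWords,
      D.wordPerm w' = D.wordPerm w * D.rotPerm g) := by
    obtain ⟨fam, n, hn⟩ := D
    cases fam
    · rintro g hg w hw
      obtain rfl : g = .rho := hg
      simp only [rotWords, List.mem_map, List.mem_range] at hw ⊢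
      obtain ⟨m, hm, rfl⟩ := hw
      by_cases hmn : m + 1 < n + 1
      · exact ⟨_, ⟨m + 1, hmn, rfl⟩, by rw [wordPerm_replicate, wordPerm_replicate, pow_succ]⟩
      · refine ⟨_, ⟨0, by omega, rfl⟩, ?_⟩
        obtain rfl : m = n := by omega
        rw [wordPerm_replicate, wordPerm_replicate, ← pow_succ, pow_zero]
        exact (rho_pow_order m).symm
    · rintro g hg w hw
      obtain rfl : g = .phi := hg
      have := phi_sq ⟨.B, n, hn⟩
      simp only [rotWords, List.mem_cons, List.not_mem_nil, or_false] at hw ⊢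
      rcases hw with rfl | rfl
      · exact ⟨_, Or.inr rfl, by simp [wordPerm]⟩
      · exact ⟨_, Or.inl rfl, by simp [wordPerm, this]⟩
    · rintro g hg w hw
      obtain rfl : g = .pi := hg
      have := pi_sq ⟨.C, n, hn⟩
      simp only [rotWords, List.mem_cons, List.not_mem_nil, or_false] at hw ⊢
      rcases hw with rfl | rfl
      · exact ⟨_, Or.inr rfl, by simp [wordPerm]⟩
      · exact ⟨_, Or.inl rfl, by simp [wordPerm, this]⟩
    · have h1 := phi_sq ⟨.D, n, hn⟩
      have h2 := pi_sq ⟨.D, n, hn⟩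
      have h3 := phi_pi ⟨.D, n, hn⟩ hn
      generalize hP : rotPerm ⟨.D, n, hn⟩ .phi = P at h1 h3
      generalize hQ : rotPerm ⟨.D, n, hn⟩ .pi = Q at h2 h3
      have k1 : ∀ x, x * P * P = x := fun x => by rw [mul_assoc, h1, mul_one]
      have k2 : ∀ x, x * Q * Q = x := fun x => by rw [mul_assoc, h2, mul_one]
      have k3 : Q * P * Q * P * Q = P * Q * P := by rw [← h3, k2]
      have k4 : P * Q * P * Q * P = Q * P * Q := by rw [h3, k1]
      rintro g hg w hw
      simp only [rotWords, List.mem_cons, List.not_mem_nil, or_false] at hw ⊢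
      rcases hg with rfl | rfl
      · rcases hw with rfl | rfl | rfl | rfl | rfl | rfl | rfl | rfl
        · exact ⟨[.phi], by simp, by simp [wordPerm]⟩
        · exact ⟨[], by simp, by simp [wordPerm, hP, h1]⟩
        · exact ⟨[.phi, .pi], by simp, by simp [wordPerm]⟩
        · exact ⟨[.pi], by simp, by simp [wordPerm, hP, hQ, k1]⟩
        · exact ⟨[.phi, .pi, .phi], by simp, by simp [wordPerm]⟩
        · exact ⟨[.pi, .phi], by simp, by simp [wordPerm, hP, hQ, k1]⟩
        · exact ⟨[.phi, .pi, .phi, .pi], by simp, by simp [wordPerm, mul_assoc]⟩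
        · exact ⟨[.pi, .phi, .pi], by simp, by simp [wordPerm, hP, hQ, k1]⟩
      · rcases hw with rfl | rfl | rfl | rfl | rfl | rfl | rfl | rfl
        · exact ⟨[.pi], by simp, by simp [wordPerm]⟩
        · exact ⟨[.pi, .phi], by simp, by simp [wordPerm]⟩
        · exact ⟨[], by simp, by simp [wordPerm, hQ, h2]⟩
        · exact ⟨[.pi, .phi, .pi], by simp, by simp [wordPerm]⟩
        · exact ⟨[.phi], by simp, by simp [wordPerm, hP, hQ, k2]⟩
        · exact ⟨[.phi, .pi, .phi, .pi], by simp, by simp [wordPerm, hP, hQ, h3]⟩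
        · exact ⟨[.phi, .pi], by simp, by simp [wordPerm, hP, hQ, k2]⟩
        · exact ⟨[.phi, .pi, .phi], by simp, by simp [wordPerm, hP, hQ, k3]⟩
  have inv : ∀ g ∈ D.rotGens, ∃ m : ℕ, (D.rotPerm g)⁻¹ = D.rotPerm g ^ m := fun g _ =>
    ⟨orderOf (D.rotPerm g) - 1, inv_eq_of_mul_eq_one_right (by
      rw [← pow_succ', Nat.sub_add_cancel (orderOf_pos _), pow_orderOf_eq_one])⟩
  induction hσ using Subgroup.closure_induction_right with
  | one =>
    refine ⟨[], ?_, rfl⟩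
    obtain ⟨fam, n, hn⟩ := D
    cases fam
    · simp only [rotWords, List.mem_map, List.mem_range]
      exact ⟨0, by omega, rfl⟩
    all_goals simp [rotWords]
  | mul_right x hx y hy ih =>
    obtain ⟨g, hg, rfl⟩ := hy
    obtain ⟨w, hw, rfl⟩ := ih
    exact closed g hg w hw
  | mul_inv_cancel x hx y hy ih =>
    obtain ⟨g, hg, rfl⟩ := hy
    obtain ⟨m, hm⟩ := inv g hg
    rw [hm]
    clear hm
    induction m with
    | zero => simpa using ih
    | succ m ihm =>
      obtain ⟨w, hw, hw'⟩ := ihm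
      obtain ⟨w', hw1, hw2⟩ := closed g hg w hw
      exact ⟨w', hw1, by rw [hw2, hw', pow_succ, mul_assoc]⟩

theorem wordPerm_rotWord {σ : Equiv.Perm D.I} (hσ : σ ∈ D.Sigma) :
    D.wordPerm (D.rotWord σ) = σ := by
  obtain ⟨w, hw, hwσ⟩ := D.exists_rotWord hσ
  rw [rotWord]
  cases h : D.rotWords.find? fun w => D.wordPerm w = σ with
  | none =>
    rw [List.find?_eq_none] at h
    exact absurd (by simpa using hwσ) (h w hw)
  | some w' => simpa using List.find?_some h

section RotMatrix

variable (L : Type) [CommRing L] [Algebra Kq L]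

/-- `-ϑ v`, where `ϑ = -1` in the symplectic and `ϑ = 1` in the orthogonal case. -/
def signPi (v : Lˣ) : L :=
  match D.family with
  | .C => v
  | _ => -v

/-- The rotation matrices of the generators. -/
def rotGenMatrix (v : Lˣ) : Rot → Matrix D.Basis D.Basis L
  | .rho => ∑ i ∈ Finset.Icc (1 : ℤ) D.n, D.E L i (i + 1) + (v : L) • D.E L (D.n + 1) 1
  | .phi => ∑ i ∈ D.basisSet with |i| < (D.n : ℤ), D.E L i i - (v : L) • D.E L D.n (-D.n) -
      ((v⁻¹ : Lˣ) : L) • D.E L (-D.n) D.n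
  | .pi => ∑ i ∈ D.basisSet, ((-1) ^ (i + 1) : Kq) •
      (if i < 0 then D.signPi L v else 1) • D.E L (i - i.sign * (D.n + 1)) i

/-- The matrix represented by a word in the generators. -/
def wordMatrix (v : Lˣ) : List Rot → Matrix D.Basis D.Basis L
  | [] => 1
  | g :: w => D.rotGenMatrix L v g * wordMatrix v w

/-- The rotation matrix `Z^σ(v)`. -/
def rotationMatrix (σ : Equiv.Perm D.I) (v : Lˣ) : Matrix D.Basis D.Basis L :=
  D.wordMatrix L v (D.rotWord σ)


/-- A matrix with exactly one nonzero entry, which is invertible, in each row and column. -/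
theorem isUnit_of_monomial {ι : Type} [Fintype ι] [DecidableEq ι] (M : Matrix ι ι L)
    (g : ι → ι) (hg : g.Injective) (c : ι → Lˣ)
    (h : ∀ k l, M k l = if k = g l then (c l : L) else 0) : IsUnit M := by
  obtain ⟨g, rfl⟩ : ∃ g' : Equiv.Perm ι, g = g' :=
    ⟨Equiv.ofBijective g (Finite.injective_iff_bijective.1 hg), rfl⟩
  have e : M = (Equiv.Perm.permMatrix L g.symm) * Matrix.diagonal (fun l => (c l : L)) := by
    ext k l
    rw [Matrix.mul_diagonal, h]
    simp only [Equiv.Perm.permMatrix, PEquiv.toMatrix_apply, Equiv.toPEquiv_apply,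
      Option.mem_def, Option.some.injEq, Equiv.symm_apply_eq]
    split_ifs <;> simp
  rw [e]
  refine IsUnit.mul ?_ ?_
  · rw [Matrix.isUnit_iff_isUnit_det, Matrix.det_permutation]
    exact ((Equiv.Perm.sign g.symm).isUnit).map (Int.castRingHom L)
  · rw [Matrix.isUnit_diagonal, Pi.isUnit_iff]
    exact fun l => (c l).isUnit

theorem E_apply (a b : ℤ) (k l : D.Basis) :
    D.E L a b k l = if k.1 = a ∧ l.1 = b then 1 else 0 := rfl

theorem sum_E_apply (S : Finset ℤ) (f : ℤ → ℤ) (c : ℤ → L) (k l : D.Basis) :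
    (∑ i ∈ S, c i • D.E L (f i) i) k l = if l.1 ∈ S ∧ k.1 = f l then c l else 0 := by
  simp only [Matrix.sum_apply, Matrix.smul_apply, E_apply, smul_eq_mul]
  by_cases hl : l.1 ∈ S
  · rw [Finset.sum_eq_single l.1]
    · simp [hl]
    · intro b _ hb
      rw [if_neg (show ¬ (k.1 = f b ∧ l.1 = b) from fun h => hb h.2.symm), mul_zero]
    · exact fun h => absurd hl h
  · rw [Finset.sum_eq_zero, if_neg fun h => hl h.1]
    intro b hb
    rw [if_neg (show ¬ (k.1 = f b ∧ l.1 = b) from fun h => hl (h.2 ▸ hb)), mul_zero]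

/-- The rotation matrices of the generators are invertible. -/
theorem isUnit_rotGenMatrix (v : Lˣ) {g : Rot} (hg : g ∈ D.rotGens) :
    IsUnit (D.rotGenMatrix L v g) := by
  have hphi : D.family = .B ∨ D.family = .D → IsUnit (D.rotGenMatrix L v .phi) := by
    intro hf
    have mem : ∀ a ∈ D.basisSet, -D.n ≤ a ∧ a ≤ D.n ∧ -a ∈ D.basisSet := by
      intro a ha
      rw [mem_basisSet] at ha ⊢
      obtain ⟨fam, n, h⟩ := D
      rcases hf with hf | hf <;> simp only at hf <;> subst hf <;> simp only at ha ⊢ <;> omega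
    have hn : 0 < D.n := by
      obtain ⟨fam, n, h⟩ := D
      rcases hf with hf | hf <;> simp only at hf <;> subst hf <;> simp only at h ⊢ <;> omega
    have e : ∑ i ∈ D.basisSet with |i| < (D.n : ℤ), D.E L i i =
        ∑ i ∈ D.basisSet with |i| < (D.n : ℤ), (1 : L) • D.E L i i := by simp
    refine isUnit_of_monomial L _
      (fun l => if |l.1| < (D.n : ℤ) then l else ⟨-l.1, (mem l.1 l.2).2.2⟩) ?_
      (fun l => if |l.1| < (D.n : ℤ) then 1 else if l.1 = D.n then -v⁻¹ else -v) fun k l => ?_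
    · intro a b hab
      have h1 := congrArg Subtype.val hab
      have h2 := mem a.1 a.2
      have h3 := mem b.1 b.2
      apply Subtype.ext
      simp only [apply_ite Subtype.val, abs_lt] at h1
      split_ifs at h1 <;> omega
    · have hl := mem l.1 l.2
      simp only [rotGenMatrix]
      rw [e, Matrix.sub_apply, Matrix.sub_apply, D.sum_E_apply L _ (fun i => i)]
      simp only [Matrix.smul_apply, E_apply, smul_eq_mul, Finset.mem_filter, l.2, true_and, abs_lt,
        Subtype.ext_iff, mul_ite, mul_one, mul_zero]
      by_cases c1 : -(D.n : ℤ) < l.1 ∧ l.1 < D.n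
      · rw [if_pos c1, if_pos c1]
        rw [if_neg (show ¬ (k.1 = (D.n : ℤ) ∧ l.1 = -D.n) by omega),
          if_neg (show ¬ (k.1 = -(D.n : ℤ) ∧ l.1 = D.n) by omega)]
        simp [c1]
      · rw [if_neg c1, if_neg c1, if_neg (fun h => c1 h.1)]
        by_cases c2 : l.1 = D.n
        · rw [if_pos c2, if_neg (show ¬ (k.1 = (D.n : ℤ) ∧ l.1 = -D.n) by omega)]
          simp [c2]
          split_ifs <;> simp
        · have c3 : l.1 = -D.n := by omega
          rw [if_neg c2, if_neg (show ¬ (k.1 = -(D.n : ℤ) ∧ l.1 = D.n) by omega)]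
          simp [c3]
          split_ifs <;> simp
  have hpi : D.family = .C ∨ D.family = .D → IsUnit (D.rotGenMatrix L v .pi) := by
    intro hf
    have mem : ∀ a ∈ D.basisSet, -D.n ≤ a ∧ a ≤ D.n ∧ a ≠ 0 ∧
        a - a.sign * (D.n + 1) ∈ D.basisSet ∧ (a.sign = 1 ∧ 0 < a ∨ a.sign = -1 ∧ a < 0) := by
      intro a ha
      rw [mem_basisSet] at ha ⊢
      have : a ≠ 0 → (a.sign = 1 ∧ 0 < a ∨ a.sign = -1 ∧ a < 0) := by
        intro h
        rcases lt_or_gt_of_ne h with h | h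
        · exact Or.inr ⟨Int.sign_eq_neg_one_of_neg h, h⟩
        · exact Or.inl ⟨Int.sign_eq_one_of_pos h, h⟩
      obtain ⟨fam, n, h⟩ := D
      rcases hf with hf | hf <;> simp only at hf <;> subst hf <;> simp only at ha ⊢ <;>
        rcases this ha.1 with ⟨h1, h2⟩ | ⟨h1, h2⟩ <;> rw [h1] <;> omega
    obtain ⟨w, hw⟩ : ∃ w : Lˣ, (w : L) = D.signPi L v := by
      obtain ⟨fam, n, h⟩ := D
      rcases hf with hf | hf <;> simp only at hf <;> subst hf
      · exact ⟨v, rfl⟩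
      · exact ⟨-v, rfl⟩
    have e : D.rotGenMatrix L v .pi = ∑ i ∈ D.basisSet,
        (algebraMap Kq L ((-1) ^ (i + 1)) * (if i < 0 then D.signPi L v else 1)) •
          D.E L (i - i.sign * (D.n + 1)) i := by
      simp only [rotGenMatrix]
      refine Finset.sum_congr rfl fun i _ => ?_
      rw [mul_smul, algebraMap_smul]
    refine isUnit_of_monomial L _
      (fun l => ⟨l.1 - l.1.sign * (D.n + 1), (mem l.1 l.2).2.2.2.1⟩) ?_
      (fun l => Units.map (algebraMap Kq L).toMonoidHom ((-1) ^ (l.1 + 1)) *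
        (if l.1 < 0 then w else 1)) fun k l => ?_
    · intro a b hab
      have h1 := congrArg Subtype.val hab
      have h2 := mem a.1 a.2
      have h3 := mem b.1 b.2
      apply Subtype.ext
      simp only at h1
      rcases h2.2.2.2.2 with ⟨h4, h5⟩ | ⟨h4, h5⟩ <;> rcases h3.2.2.2.2 with ⟨h6, h7⟩ | ⟨h6, h7⟩ <;>
        rw [h4, h6] at h1 <;> omega
    · rw [e, D.sum_E_apply L _ (fun i => i - i.sign * (D.n + 1))]
      simp only [l.2, true_and, Subtype.ext_iff]
      congr 1
      have hz : ((Units.map (algebraMap Kq L).toMonoidHom ((-1) ^ (l.1 + 1)) : Lˣ) : L) =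
          algebraMap Kq L ((-1) ^ (l.1 + 1)) := by
        change algebraMap Kq L (((-1 : Kqˣ) ^ (l.1 + 1) : Kqˣ) : Kq) = _
        rw [Units.val_zpow_eq_zpow_val, Units.val_neg, Units.val_one]
      rw [← hw, Units.val_mul, hz]
      split_ifs <;> simp
  obtain ⟨fam, n, h⟩ := D
  cases fam
  · obtain rfl : g = .rho := hg
    have h1 : 1 ≤ n := h
    have mem : ∀ a ∈ (⟨.A, n, h⟩ : Datum).basisSet, 1 ≤ a ∧ a ≤ n + 1 := by
      intro a ha; rwa [mem_basisSet] at ha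
    have mem' : ∀ a ∈ (⟨.A, n, h⟩ : Datum).basisSet,
        (if a = 1 then (n : ℤ) + 1 else a - 1) ∈ (⟨.A, n, h⟩ : Datum).basisSet := by
      intro a ha
      rw [mem_basisSet]
      have := mem a ha
      simp only
      split_ifs <;> omega
    refine isUnit_of_monomial L _ (fun l => ⟨_, mem' l.1 l.2⟩) ?_
      (fun l => if l.1 = 1 then v else 1) fun k l => ?_
    · intro a b hab
      have h1 := congrArg Subtype.val hab
      have h2 := mem a.1 a.2
      have h3 := mem b.1 b.2
      apply Subtype.ext
      simp only at h1
      split_ifs at h1 <;> omega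
    · have hk := mem k.1 k.2
      have hl := mem l.1 l.2
      simp only [rotGenMatrix, Matrix.add_apply, Matrix.sum_apply, Matrix.smul_apply, E_apply,
        smul_eq_mul, Subtype.ext_iff]
      by_cases c : l.1 = 1
      · rw [if_pos c, if_pos c, Finset.sum_eq_zero, zero_add]
        · simp only [c, and_true]; split_ifs <;> simp
        · intro b hb
          rw [Finset.mem_Icc] at hb
          exact if_neg (by omega)
      · rw [if_neg c, if_neg c, if_neg (fun h => c h.2), mul_zero, add_zero]
        by_cases c' : k.1 = l.1 - 1
        · rw [if_pos c', Finset.sum_eq_single k.1]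
          · rw [if_pos ⟨rfl, by omega⟩]; simp
          · intro b _ hb; exact if_neg fun h => hb h.1.symm
          · intro h; rw [Finset.mem_Icc] at h; omega
        · rw [if_neg c', Finset.sum_eq_zero]
          intro b _
          exact if_neg (by omega)
  · obtain rfl : g = .phi := hg
    exact hphi (Or.inl rfl)
  · obtain rfl : g = .pi := hg
    exact hpi (Or.inl rfl)
  · rcases hg with rfl | rfl
    · exact hphi (Or.inr rfl)
    · exact hpi (Or.inr rfl)

theorem rotWord_gens (σ : Equiv.Perm D.I) : ∀ g ∈ D.rotWord σ, g ∈ D.rotGens := by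
  have all : ∀ w ∈ D.rotWords, ∀ g ∈ w, g ∈ D.rotGens := by
    obtain ⟨fam, n, h⟩ := D
    cases fam
    · intro w hw g hg
      simp only [rotWords, List.mem_map] at hw
      obtain ⟨m, -, rfl⟩ := hw
      exact List.eq_of_mem_replicate hg
    all_goals
      intro w hw g hg
      simp only [rotWords, List.mem_cons, List.not_mem_nil, or_false] at hw
      simp only [rotGens, Set.mem_singleton_iff, Set.mem_insert_iff]
    · rcases hw with rfl | rfl <;> simp_all
    · rcases hw with rfl | rfl <;> simp_all
    · cases g with
      | rho => rcases hw with rfl | rfl | rfl | rfl | rfl | rfl | rfl | rfl <;> simp at hg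
      | phi => exact Or.inl rfl
      | pi => exact Or.inr rfl
  rw [rotWord]
  cases h : D.rotWords.find? fun w => D.wordPerm w = σ with
  | none => simp
  | some w => exact all w (List.mem_of_find?_eq_some h)

/-- Rotation matrices are invertible. -/
theorem isUnit_rotationMatrix (σ : Equiv.Perm D.I) (v : Lˣ) :
    IsUnit (D.rotationMatrix L σ v) := by
  rw [rotationMatrix]
  have := D.rotWord_gens σ
  generalize D.rotWord σ = w at this
  induction w with
  | nil => exact isUnit_one
  | cons g w ih =>
    exact (D.isUnit_rotGenMatrix L v (this g (by simp))).mul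
      (ih fun g' hg' => this g' (by simp [hg']))

end RotMatrix

/-! ### The Weyl group and the quantum Weyl group action -/

/-- The generator `k_i` as a unit of `U_q(g)`. -/
def kUnit (i : D.I) : D.Uqˣ where
  val := D.gen (.k i)
  inv := D.gen (.kinv i)
  val_inv := D.gen_relations.k_kinv i
  inv_val := D.gen_relations.kinv_k i

/-- The formulas defining the automorphism `T_i` of `U_q(g)` (`T''_{i,1}` in Lusztig's notation) on
generators; here `k_{r_i(α_j)} = k_j k_i^{-a_{ij}}`. -/
structure IsLusztig (i : D.I) (T : D.Uq →ₐ[Kq] D.Uq) : Prop where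
  x_self : T (D.gen (.x i)) = -(D.gen (.y i) * D.gen (.k i))
  y_self : T (D.gen (.y i)) = -(D.gen (.kinv i) * D.gen (.x i))
  k : ∀ j, T (D.gen (.k j)) = D.gen (.k j) * ((D.kUnit i ^ (-D.cartan i j) : D.Uqˣ) : D.Uq)
  x : ∀ j, j ≠ i → T (D.gen (.x j)) = ∑ r ∈ Finset.range ((-D.cartan i j).toNat + 1),
    (-D.qi i)⁻¹ ^ r • (divPow (D.qi i) (D.gen (.x i)) ((-D.cartan i j).toNat - r) *
      D.gen (.x j) * divPow (D.qi i) (D.gen (.x i)) r)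
  y : ∀ j, j ≠ i → T (D.gen (.y j)) = ∑ r ∈ Finset.range ((-D.cartan i j).toNat + 1),
    (-D.qi i) ^ r • (divPow (D.qi i) (D.gen (.y i)) r * D.gen (.y j) *
      divPow (D.qi i) (D.gen (.y i)) ((-D.cartan i j).toNat - r))

/-- The formulas determine `T_i`. -/
theorem IsLusztig.unique {i : D.I} {T T' : D.Uq →ₐ[Kq] D.Uq} (h : D.IsLusztig i T)
    (h' : D.IsLusztig i T') : T = T' := by
  have hk : ∀ j, T (D.gen (.k j)) = T' (D.gen (.k j)) := fun j => by rw [h.k, h'.k]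
  refine D.hom_ext fun g => ?_
  cases g with
  | x j =>
    by_cases hj : j = i
    · rw [hj, h.x_self, h'.x_self]
    · rw [h.x j hj, h'.x j hj]
  | y j =>
    by_cases hj : j = i
    · rw [hj, h.y_self, h'.y_self]
    · rw [h.y j hj, h'.y j hj]
  | k j => exact hk j
  | kinv j =>
    have e : Units.map (T : D.Uq →* D.Uq) (D.kUnit j) = Units.map (T' : D.Uq →* D.Uq) (D.kUnit j) :=
      Units.ext (hk j)
    exact congrArg (fun u : D.Uqˣ => ((u⁻¹ : D.Uqˣ) : D.Uq)) e

open scoped Classical in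
/-- Lusztig's automorphism `T_i`: the unique algebra endomorphism of `U_q(g)` given on generators by
the formulas `IsLusztig` (that it exists is a classical theorem of Lusztig). -/
def lusztig (i : D.I) : D.Uq →ₐ[Kq] D.Uq :=
  if h : ∃ T, D.IsLusztig i T then h.choose else AlgHom.id Kq D.Uq

/-- The root lattice `Q = ⨁ ℤ α_i`. -/
abbrev RootLattice : Type := D.I → ℤ

/-- The simple root `α_i`. -/
def simpleRoot (i : D.I) : D.RootLattice := Pi.single i 1

/-- The simple reflection `r_i` acting on the root lattice: `r_i(α_j) = α_j - a_{ij} α_i`. -/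
def reflection (i : D.I) (μ : D.RootLattice) : D.RootLattice :=
  μ - (∑ j, D.cartan i j * μ j) • D.simpleRoot i

/-- The Weyl group element `r_{i_1} ⋯ r_{i_l}`, acting on the root lattice. -/
def wordAct : List D.I → D.RootLattice → D.RootLattice
  | [] => id
  | i :: w => D.reflection i ∘ wordAct w

/-- The composition `T_{i_1} ⋯ T_{i_l}`. -/
def wordLusztig : List D.I → (D.Uq →ₐ[Kq] D.Uq)
  | [] => AlgHom.id Kq D.Uq
  | i :: w => (D.lusztig i).comp (wordLusztig w)

/-- Reduced words in the simple reflections (the Weyl group acts faithfully on the root lattice). -/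
def IsReduced (w : List D.I) : Prop :=
  ∀ w' : List D.I, D.wordAct w' = D.wordAct w → w.length ≤ w'.length

/-- `w` is a reduced word representing the longest element of the parabolic subgroup `W_X`. -/
structure IsLongestWord (X : Finset D.I) (w : List D.I) : Prop where
  mem : ∀ i ∈ w, i ∈ X
  reduced : D.IsReduced w
  longest : ∀ w' : List D.I, (∀ i ∈ w', i ∈ X) → D.IsReduced w' → w'.length ≤ w.length

open scoped Classical in
/-- A reduced word for the longest element `w_X` of the (finite) Weyl group `W_X`. -/
def longestWord (X : Finset D.I) : List D.I :=
  if h : ∃ w, D.IsLongestWord X w then h.choose else []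

/-- The action of `w_X` on the root lattice. -/
def longestAct (X : Finset D.I) : D.RootLattice → D.RootLattice := D.wordAct (D.longestWord X)

/-- The involution `θ = -w_X τ` of the root lattice. -/
def theta (X : Finset D.I) (τ : D.Aut) (μ : D.RootLattice) : D.RootLattice :=
  -D.longestAct X (fun i => μ (τ.1.symm i))

/-- The algebra automorphism `θ_q = T_{w_X} τ ω_q`. -/
def thetaq (X : Finset D.I) (τ : D.Aut) : D.Uq →ₐ[Kq] D.Uq :=
  (D.wordLusztig (D.longestWord X)).comp ((D.diagramHom τ).comp D.omegaq)

/-- The bilinear form on the root lattice with `(α_i, α_j) = d_i a_{ij}`. -/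
def form (μ ν : D.RootLattice) : ℚ :=
  ∑ i, ∑ j, (D.twoD i / 2 : ℚ) * D.cartan i j * μ i * ν j

/-! ### Generalized Satake diagrams and quantum pair algebras -/

/-- `A_X` is of finite type: `det(A_Y) ≠ 0` for all `Y ⊆ X`. -/
def IsFiniteType (X : Finset D.I) : Prop :=
  ∀ Y ⊆ X, (Matrix.of fun i j : {i // i ∈ Y} => D.cartan i.1 j.1).det ≠ 0

/-- Generalized Satake diagrams `(X, τ)`. -/
structure IsGSat (X : Finset D.I) (τ : D.Aut) : Prop where
  finite_type : D.IsFiniteType X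
  invol : τ * τ = 1
  longest : ∀ i ∈ X, -D.longestAct X (D.simpleRoot i) = D.simpleRoot (τ.1 i)
  compat : ∀ i ∈ X, ∀ j ∉ X,
    D.theta X τ (D.simpleRoot j) = -(D.simpleRoot i + D.simpleRoot j) → D.cartan j i ≠ -1

/-- `Istar` is a subset of `I \ X` containing precisely one element of every `τ`-orbit. -/
structure IsIstar (X : Finset D.I) (τ : D.Aut) (Istar : Finset D.I) : Prop where
  not_mem : ∀ j ∈ Istar, j ∉ X
  exists_unique : ∀ j ∉ X, ∃! l, l ∈ Istar ∧ (l = j ∨ l = τ.1 j)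

/-- The set `I_diff`. -/
def Idiff (X : Finset D.I) (τ : D.Aut) (Istar : Finset D.I) : Set D.I :=
  {j | j ∈ Istar ∧ j ≠ τ.1 j ∧ D.form (D.simpleRoot j) (D.theta X τ (D.simpleRoot j)) ≠ 0}

/-- The set `I_ns`. -/
def Ins (X : Finset D.I) (τ : D.Aut) (Istar : Finset D.I) : Set D.I :=
  {j | j ∈ Istar ∧ j = τ.1 j ∧ ∀ i ∈ X, D.cartan i j = 0}

/-- The set `I_nsf`. -/
def Insf (X : Finset D.I) (τ : D.Aut) (Istar : Finset D.I) : Set D.I :=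
  {j | j ∈ D.Ins X τ Istar ∧ ∀ i ∈ D.Ins X τ Istar, Even (D.cartan i j)}

/-- The parameter set `𝒞`. Here and below a tuple indexed by `I \ X` is given by a function on `I`,
whose values on `X` are never used. -/
def setC (X : Finset D.I) (τ : D.Aut) (Istar : Finset D.I) : Set (D.I → Kqˣ) :=
  {c | ∀ j ∈ Istar, c j ≠ c (τ.1 j) → j ∈ D.Idiff X τ Istar}

/-- The parameter set `𝒮`. -/
def setS (X : Finset D.I) (τ : D.Aut) (Istar : Finset D.I) : Set (D.I → Kq) :=
  {s | ∀ j ∈ Istar, s j ≠ 0 → j ∈ D.Insf X τ Istar}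

/-- The subalgebra `U_q(h)` generated by all `k_i` and `k_i^{-1}`. -/
def Uqh : Subalgebra Kq D.Uq :=
  Algebra.adjoin Kq (Set.range (fun i => D.gen (.k i)) ∪ Set.range (fun i => D.gen (.kinv i)))

/-- The elements `b_i`. -/
def bGen (X : Finset D.I) (τ : D.Aut) (c : D.I → Kqˣ) (s : D.I → Kq) (i : D.I) : D.Uq :=
  if i ∈ X then D.gen (.y i)
  else D.gen (.y i) +
    (c i : Kq) • (D.thetaq X τ (D.gen (.y i) * D.gen (.k i)) * D.gen (.kinv i)) -
    s i • D.gen (.kinv i)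

/-- The algebra `B_{c,s}(X, τ)` generated by `x_i` with `i ∈ X`, the elements of `U_q(h)` fixed by
`θ_q`, and all `b_i`. -/
def qpAlgebra (X : Finset D.I) (τ : D.Aut) (c : D.I → Kqˣ) (s : D.I → Kq) : Subalgebra Kq D.Uq :=
  Algebra.adjoin Kq ({a | ∃ i ∈ X, a = D.gen (.x i)} ∪
    {a | a ∈ D.Uqh ∧ D.thetaq X τ a = a} ∪ Set.range (D.bGen X τ c s))

/-! ### Boundary intertwining equations -/

/-- The spectral parameter `η u`, a unit of the field of rational functions in `u`. -/
def etaMul (η : Kqˣ) : (RatFunc Kq)ˣ :=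
  Units.map (algebraMap Kq (RatFunc Kq)).toMonoidHom η * Units.mk0 RatFunc.X RatFunc.X_ne_zero

/-- The spectral parameter `η / u`. -/
def etaDiv (η : Kqˣ) : (RatFunc Kq)ˣ :=
  Units.map (algebraMap Kq (RatFunc Kq)).toMonoidHom η / Units.mk0 RatFunc.X RatFunc.X_ne_zero

/-- `(K(u), η)` solves the untwisted boundary intertwining equation for the subalgebra `B`. -/
def Untwisted (B : Subalgebra Kq D.Uq) (K : Matrix D.Basis D.Basis (RatFunc Kq)) (η : Kqˣ) : Prop :=
  ∀ b ∈ B, K * D.vecRep (RatFunc Kq) (etaMul η) b = D.vecRep (RatFunc Kq) (etaDiv η) b * K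

/-- `(K(u), η)` solves the twisted boundary intertwining equation for the subalgebra `B`. -/
def Twisted (B : Subalgebra Kq D.Uq) (K : Matrix D.Basis D.Basis (RatFunc Kq)) (η : Kqˣ) : Prop :=
  ∀ b ∈ B, K * D.vecRep (RatFunc Kq) (etaMul η) b =
    (D.vecRep (RatFunc Kq) (etaDiv η) (D.antipode b)).transpose * K

/-- The diagram automorphism of `U_q(g)` defined by a rotational symmetry. -/
def rotationHom (σ : D.Sigma) : D.Uq →ₐ[Kq] D.Uq := D.diagramHom ⟨σ.1, D.Sigma_le_Aut σ.2⟩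

end Datum

end

end QPair

open QPair

namespace QPair
noncomputable section
namespace Datum

/-! The theorem says that `T_v` and `T_v ∘ σ` are equivalent representations and that `Z^σ(v)` is an
explicit equivalence between them: `T_v(b) Z^σ(v) = Z^σ(v) T_v(σ(b))` for every `b` in `U_q(g)`.
This is `vecRep_mul_rotationMatrix`; what follows from it is short.

Put `M = Z^σ(ηu)` and `N = Z^σ(η/u)`, both invertible. Then `N⁻¹ K M T_{ηu}(σ(b)) = N⁻¹ (K
T_{ηu}(b)) M` and `T_{η/u}(σ(b)) N⁻¹ K M = N⁻¹ (T_{η/u}(b) K) M`, so the untwisted equation for `K`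
at `b` is the same as the one for `N⁻¹ K M` at `σ(b)`. In the twisted case one also needs that `σ`
commutes with the antipode (`antipode_diagramHom`). Transposing the relation for `N` at `S(b)` then
gives `T_{η/u}(S(σ(b)))ᵗ Nᵗ = Nᵗ T_{η/u}(S(b))ᵗ`, which explains why `Nᵗ` takes the place of `N⁻¹`.

For the equivalence itself, invertibility of `Z^σ(v)` turns the relation into an equality of two
algebra homomorphisms, so generators suffice (`intertwine_of_gen`). A product of rotation matrices
is passed through one factor at a time (`vecGen_mul_wordMatrix`), which leaves only `ρ`, `φ₁` and
`π` (`vecGen_mul_rotGenMatrix`).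

Each of these three matrices is monomial, `e_a ↦ c(a) e_{g(a)}`, so multiplying an elementary matrix
by it relabels one index and rescales. For `k_i` the relation says that `g` carries weights to
weights (`kWeight_rho`, `kWeight_phi`, `kWeight_pi`). For `x_i` and `y_i` it is a comparison of
scalars (`rho_vec`, `phi_vec`, `pi_vec`): the powers of `v` in `c` compensate those in `x_0` and
`y_0`, and the signs in `c` compensate the relative sign inside `F_{ab}`. -/

section Intertwining

variable {D : Datum} {L : Type} [CommRing L] [Algebra Kq L]

/-! ### Monomial matrices and their products with elementary and diagonal matrices -/

/-- `Z` maps the basis vector `e_a` to `c(a) e_{g(a)}`. -/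
structure Monomial (Z : Matrix D.Basis D.Basis L) (g : ℤ → ℤ) (c : ℤ → L) : Prop where
  mem : ∀ a ∈ D.basisSet, g a ∈ D.basisSet
  inj : ∀ a ∈ D.basisSet, ∀ b ∈ D.basisSet, g a = g b → a = b
  apply : ∀ k l : D.Basis, Z k l = if k.1 = g l.1 then c l.1 else 0

/-- Column `s` of `Z` has the single entry `c(s)`, in row `g(s)`. The image is a separate variable
`s'` so that applications can name it by a closed formula rather than by the case distinction
defining `g`. -/
theorem Monomial.mul_E {Z : Matrix D.Basis D.Basis L} {g : ℤ → ℤ} {c : ℤ → L}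
    (h : D.Monomial Z g c) {s s' : ℤ} (t : ℤ) (hs : s ∈ D.basisSet) (hg : g s = s') :
    Z * D.E L s t = c s • D.E L s' t := by
  ext k l
  rw [Matrix.mul_apply, Finset.sum_eq_single ⟨s, hs⟩]
  · rw [h.apply, Matrix.smul_apply, E_apply, E_apply, ← hg]
    simp only [true_and, smul_eq_mul]
    by_cases h1 : k.1 = g s <;> by_cases h2 : l.1 = t <;> simp [h1, h2]
  · intro b _ hb
    rw [E_apply, if_neg fun hh => hb (Subtype.ext hh.1), mul_zero]
  · exact fun hh => absurd (Finset.mem_univ _) hh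

/-- Right multiplication pulls the column index back along `g`: row `g(t)` of `Z` has its only entry
in column `t`. The preimage `t` is the datum supplied, since `g` has no named inverse. -/
theorem Monomial.E_mul {Z : Matrix D.Basis D.Basis L} {g : ℤ → ℤ} {c : ℤ → L}
    (h : D.Monomial Z g c) (s : ℤ) {t t' : ℤ} (ht : t ∈ D.basisSet) (hg : g t = t') :
    D.E L s t' * Z = c t • D.E L s t := by
  ext k l
  rw [Matrix.mul_apply, Finset.sum_eq_single ⟨t', hg ▸ h.mem t ht⟩]
  · subst hg
    rw [h.apply, Matrix.smul_apply, E_apply, E_apply]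
    -- Injectivity of `g` on the labels ensures that row `g(t)` has no second nonzero entry.
    have : g t = g l.1 ↔ l.1 = t := ⟨fun e => (h.inj _ ht _ l.2 e).symm, fun e => by rw [e]⟩
    simp only [and_true, this, smul_eq_mul]
    by_cases h1 : k.1 = s <;> by_cases h2 : l.1 = t <;> simp [h1, h2]
  · intro b _ hb
    rw [E_apply, if_neg fun hh => hb (Subtype.ext hh.2), zero_mul]
  · exact fun hh => absurd (Finset.mem_univ _) hh

/-- The entries of `Z` sit at the positions `(g(l), l)`, so moving a diagonal matrix past `Z`
substitutes `g` into its weight function. With `w` the weight of `k_i` and `w'` that of `k_{σ(i)}`,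
this is the intertwining relation on the torus. -/
theorem Monomial.diagonal_mul {Z : Matrix D.Basis D.Basis L} {g : ℤ → ℤ} {c : ℤ → L}
    (h : D.Monomial Z g c) {w w' : ℤ → ℤ} (hw : ∀ a ∈ D.basisSet, w (g a) = w' a) :
    Matrix.diagonal (fun a : D.Basis => algebraMap Kq L (q ^ w a.1)) * Z =
      Z * Matrix.diagonal fun a : D.Basis => algebraMap Kq L (q ^ w' a.1) := by
  ext k l
  rw [Matrix.diagonal_mul, Matrix.mul_diagonal, h.apply]
  split_ifs with hk
  · rw [hk, hw _ l.2, mul_comm]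
  · rw [mul_zero, zero_mul]

/-! ### The matrices of `ρ`, `φ₁` and `π` are monomial -/

/-- Read by columns, the matrix of `ρ` lowers each label by one and wraps `1` around to `N = n + 1`.
The wrap is the only place where the spectral parameter enters. -/
theorem monomial_rho {n : ℕ} (hn) (v : Lˣ) :
    (⟨.A, n, hn⟩ : Datum).Monomial (rotGenMatrix ⟨.A, n, hn⟩ L v .rho)
      (fun a => if a = 1 then n + 1 else a - 1) (fun a => if a = 1 then v else 1) := by
  have h1 : 1 ≤ n := hn
  refine ⟨fun a ha => ?_, fun a ha b hb hab => ?_, fun k l => ?_⟩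
  · rw [mem_basisSet] at ha ⊢
    simp only at ha ⊢
    omega
  · rw [mem_basisSet] at ha hb
    simp only at ha hb hab
    omega
  · have hk := k.2
    have hl := l.2
    rw [mem_basisSet] at hk hl
    simp only at hk hl
    simp only [rotGenMatrix, Matrix.add_apply, Matrix.sum_apply, Matrix.smul_apply, E_apply,
      smul_eq_mul]
    -- Column `1` meets only the corner term `v E_{N1}`; any other column `l` meets only the summand
    -- `i = l - 1`.
    by_cases c : l.1 = 1
    · rw [if_pos c, if_pos c, Finset.sum_eq_zero, zero_add]
      · simp only [c, and_true]; split_ifs <;> simp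
      · intro b hb
        rw [Finset.mem_Icc] at hb
        exact if_neg (by omega)
    · rw [if_neg c, if_neg c, if_neg (fun h => c h.2), mul_zero, add_zero]
      by_cases c' : k.1 = l.1 - 1
      · rw [if_pos c', Finset.sum_eq_single k.1]
        · rw [if_pos ⟨rfl, by omega⟩]
        · intro b _ hb; exact if_neg fun h => hb h.1.symm
        · intro h; rw [Finset.mem_Icc] at h; omega
      · rw [if_neg c', Finset.sum_eq_zero]
        intro b _
        exact if_neg (by omega)

/-- The matrix of `φ₁` exchanges the lines of `e_n` and `e_{-n}` and fixes the other basis vectors: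
`E_{-n,n}` contributes the scalar `-v⁻¹` in column `n`, and `E_{n,-n}` the scalar `-v` in column
`-n`. -/
theorem monomial_phi (hD : D.family = .B ∨ D.family = .D) (v : Lˣ) :
    D.Monomial (D.rotGenMatrix L v .phi) (fun a => if a = D.n then -D.n else if a = -D.n then D.n else a)
      (fun a => if a = D.n then -((v⁻¹ : Lˣ) : L) else if a = -D.n then -(v : L) else 1) := by
  -- The bound `2 ≤ n` is recorded here because it separates the labels `n` and `-n`, so that the
  -- order of the two tests is immaterial.
  have mem : ∀ a, a ∈ D.basisSet → -D.n ≤ a ∧ a ≤ D.n ∧ 2 ≤ D.n ∧ -a ∈ D.basisSet := by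
    intro a ha
    rw [mem_basisSet] at ha ⊢
    obtain ⟨fam, n, h⟩ := D
    rcases hD with hD | hD <;> simp only at hD <;> subst hD <;> simp only at ha h ⊢ <;> omega
  refine ⟨fun a ha => ?_, fun a ha b hb hab => ?_, fun k l => ?_⟩
  · have := (mem a ha).2.2.2
    split_ifs with h1 h2
    · rwa [← h1]
    · rwa [h2, neg_neg] at this
    · exact ha
  · have := mem a ha
    have := mem b hb
    split_ifs at hab <;> omega
  · have hl := mem l.1 l.2
    -- The coefficient `1` is made explicit so that the diagonal part has the shape treated by
    -- `sum_E_apply`.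
    have e : ∑ i ∈ D.basisSet with |i| < (D.n : ℤ), D.E L i i =
        ∑ i ∈ D.basisSet with |i| < (D.n : ℤ), (1 : L) • D.E L i i := by simp
    simp only [rotGenMatrix]
    rw [e, Matrix.sub_apply, Matrix.sub_apply, D.sum_E_apply L _ (fun i => i)]
    simp only [Matrix.smul_apply, E_apply, smul_eq_mul, Finset.mem_filter, l.2, true_and, abs_lt]
    by_cases c1 : l.1 = D.n
    · have c2 : ¬ l.1 = -(D.n : ℤ) := by omega
      rw [if_neg (by omega), if_neg (fun h => c2 h.2)]
      simp [c1]
      split_ifs <;> simp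
    · by_cases c2 : l.1 = -(D.n : ℤ)
      · rw [if_neg (by omega), if_neg (c := _ ∧ l.1 = (D.n : ℤ)) (fun h => c1 h.2)]
        simp only [c2, if_true, and_true, mul_ite, mul_one, mul_zero]
        rw [if_neg (c := -(D.n : ℤ) = D.n) (by omega), if_neg (c := -(D.n : ℤ) = D.n) (by omega)]
        split_ifs <;> simp
      · rw [if_neg (c := _ ∧ l.1 = (D.n : ℤ)) (fun h => c1 h.2),
          if_neg (c := _ ∧ l.1 = -(D.n : ℤ)) (fun h => c2 h.2), if_neg c1, if_neg c2, if_neg c1,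
          if_neg c2]
        simp only [mul_zero, sub_zero]
        congr 1
        -- A label different from `n` and `-n` automatically satisfies `|a| < n`.
        exact propext ⟨fun h => h.2, fun h => ⟨by omega, h⟩⟩

/-- The signs occurring in `Z^π`. -/
def piSign (L : Type) [CommRing L] [Algebra Kq L] (a : ℤ) : L := algebraMap Kq L ((-1) ^ (a + 1))

theorem piSign_one : piSign L 1 = 1 := by
  rw [piSign, show (1 : ℤ) + 1 = ((2 : ℕ) : ℤ) by norm_num, zpow_natCast]; simp

/-- This alternation cancels the minus sign between the two elementary matrices of `F_{ab}` when `π`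
interchanges positive and negative labels. -/
theorem piSign_add_one (a : ℤ) : piSign L (a + 1) = -piSign L a := by
  rw [piSign, piSign, zpow_add_one₀ (by simp)]; simp

theorem piSign_sub_one (a : ℤ) : piSign L (a - 1) = -piSign L a := by
  rw [← neg_eq_iff_eq_neg, ← piSign_add_one, sub_add_cancel]

/-- The sign depends only on the parity of the label, so labels `a` and `-a`, which occur together
in `F_{ab}`, carry the same sign. -/
theorem piSign_neg (a : ℤ) : piSign L (-a) = piSign L a := by
  rw [piSign, piSign, zpow_add_one₀ (by simp), zpow_add_one₀ (by simp), zpow_neg, ← inv_zpow,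
    inv_neg_one]

/-- The shift by `n + 1` sends the negative labels `-n, …, -1` to `1, …, n` in increasing order, and
the positive ones back. Since `0` is not a label in types `C` and `D`, the branch `a ≥ 0` means `a >
0`. -/
theorem monomial_pi (hD : D.family = .C ∨ D.family = .D) (v : Lˣ) :
    D.Monomial (D.rotGenMatrix L v .pi) (fun a => if a < 0 then a + (D.n + 1) else a - (D.n + 1))
      (fun a => piSign L a * if a < 0 then D.signPi L v else 1) := by
  have mem : ∀ a, a ∈ D.basisSet ↔ a ≠ 0 ∧ -D.n ≤ a ∧ a ≤ D.n := by
    intro a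
    rw [mem_basisSet]
    obtain ⟨fam, n, h⟩ := D
    rcases hD with hD | hD <;> simp only at hD <;> subst hD <;> rfl
  refine ⟨fun a ha => ?_, fun a ha b hb hab => ?_, fun k l => ?_⟩
  · rw [mem] at ha ⊢
    split_ifs <;> omega
  · rw [mem] at ha hb
    split_ifs at hab <;> omega
  · have hl := (mem _).1 l.2
    have e : D.rotGenMatrix L v .pi = ∑ i ∈ D.basisSet,
        (piSign L i * (if i < 0 then D.signPi L v else 1)) •
          D.E L (i - i.sign * (D.n + 1)) i := by
      simp only [rotGenMatrix, piSign]
      refine Finset.sum_congr rfl fun i _ => ?_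
      rw [mul_smul, algebraMap_smul]
    rw [e, D.sum_E_apply L _ (fun i => i - i.sign * (D.n + 1))]
    simp only [l.2, true_and]
    -- As `l` is nonzero, its sign is `-1` or `1`, and `i - sgn(i)(n + 1)` becomes one of the two
    -- shifts.
    rcases lt_or_gt_of_ne hl.1 with h | h
    · rw [Int.sign_eq_neg_one_of_neg h, if_pos h, if_pos h,
        show l.1 - -1 * (D.n + 1) = l.1 + (D.n + 1) by ring]
    · rw [Int.sign_eq_one_of_pos h, if_neg h.not_gt, if_neg h.not_gt, one_mul]

/-! ### Moving the matrices of `x_i` and `y_i` past the rotation matrices -/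

/-- Both sides shift one index of an elementary matrix. The nontrivial scalars occur where the label
`1` wraps around, and there they match: for instance `x_0 Z` and `Z x_1` are both `v E_{N2}`, the
factor `v` coming from `x_0` on the left and from `Z` on the right. -/
theorem rho_vec {n : ℕ} (hn) (v : Lˣ) {i j : ℤ} (hi : 0 ≤ i) (hi' : i ≤ n)
    (hj : j = if i = n then 0 else i + 1) :
    vecX ⟨.A, n, hn⟩ L v i * rotGenMatrix ⟨.A, n, hn⟩ L v .rho =
      rotGenMatrix ⟨.A, n, hn⟩ L v .rho * vecX ⟨.A, n, hn⟩ L v j ∧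
    vecY ⟨.A, n, hn⟩ L v i * rotGenMatrix ⟨.A, n, hn⟩ L v .rho =
      rotGenMatrix ⟨.A, n, hn⟩ L v .rho * vecY ⟨.A, n, hn⟩ L v j := by
  have h1 : 1 ≤ n := hn
  have hm := monomial_rho hn v
  have mem : ∀ a : ℤ, 1 ≤ a → a ≤ n + 1 → a ∈ (⟨.A, n, hn⟩ : Datum).basisSet := fun a h h' => by
    rw [mem_basisSet]; exact ⟨h, h'⟩
  -- `r1` and `r2` describe right multiplication by `Z` without and with wrap-around, `l1` and `l2`
  -- left multiplication.
  have r1 : ∀ s t : ℤ, 2 ≤ t → t ≤ n + 1 → E ⟨.A, n, hn⟩ L s (t - 1) *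
      rotGenMatrix ⟨.A, n, hn⟩ L v .rho = E ⟨.A, n, hn⟩ L s t := fun s t h h' => by
    rw [hm.E_mul s (mem t (by omega) h') (if_neg (by omega)), if_neg (by omega), one_smul]
  have r2 : ∀ s : ℤ, E ⟨.A, n, hn⟩ L s (n + 1) *
      rotGenMatrix ⟨.A, n, hn⟩ L v .rho = (v : L) • E ⟨.A, n, hn⟩ L s 1 := fun s => by
    rw [hm.E_mul s (mem 1 (by omega) (by omega)) (if_pos rfl), if_pos rfl]
  have l1 : ∀ s t : ℤ, 2 ≤ s → s ≤ n + 1 → rotGenMatrix ⟨.A, n, hn⟩ L v .rho *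
      E ⟨.A, n, hn⟩ L s t = E ⟨.A, n, hn⟩ L (s - 1) t := fun s t h h' => by
    rw [hm.mul_E t (mem s (by omega) h') (if_neg (by omega)), if_neg (by omega), one_smul]
  have l2 : ∀ t : ℤ, rotGenMatrix ⟨.A, n, hn⟩ L v .rho *
      E ⟨.A, n, hn⟩ L 1 t = (v : L) • E ⟨.A, n, hn⟩ L (n + 1) t := fun t => by
    rw [hm.mul_E t (mem 1 (by omega) (by omega)) (if_pos rfl), if_pos rfl]
  -- The cases `0 ↦ 1` and `n ↦ 0` involve the spectral parameter. They are disjoint because `n ≥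
  -- 1`; for the remaining nodes no scalar appears.
  by_cases c0 : i = 0
  · obtain rfl : j = 1 := by rw [hj, if_neg (by omega)]; omega
    have a := r1 (n + 1) 2 (by omega) (by omega)
    have b := l1 2 1 (by omega) (by omega)
    norm_num at a b
    simp only [vecX, vecY, c0, if_true, one_ne_zero, if_false, smul_mul_assoc, a, l2, r2, b,
      one_add_one_eq_two, smul_smul]
    simp
  by_cases cn : i = n
  · obtain rfl : j = 0 := by rw [hj, if_pos cn]
    have a := r1 (n + 1) (n + 1) (by omega) (by omega)
    have b := l1 (n + 1) (n + 1) (by omega) (by omega)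
    rw [add_sub_cancel_right] at a b
    have b' := l1 (n + 1) 1 (by omega) (by omega)
    have n0 : n ≠ 0 := by omega
    rw [add_sub_cancel_right] at b'
    simp [vecX, vecY, cn, n0, r2, a, b', l2, smul_smul]
  · obtain rfl : j = i + 1 := by rw [hj, if_neg cn]
    have a := r1 i (i + 1 + 1) (by omega) (by omega)
    have b := l1 (i + 1) (i + 1 + 1) (by omega) (by omega)
    have a' := r1 (i + 1) (i + 1) (by omega) (by omega)
    have b' := l1 (i + 1 + 1) (i + 1) (by omega) (by omega)
    rw [add_sub_cancel_right] at a b a' b'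
    have c1 : i + 1 ≠ 0 := by omega
    simp only [vecX, vecY, c0, c1, if_false, a, b, a', b', and_self]

/-- The nodes `0` and `1` are attached to the labels `±n` and `±(n-1)`, and exchanging `e_n` with
`e_{-n}` turns one into the other: `x_0 Z` and `Z x_1` both equal `-E_{n-1,n} - v E_{n,1-n}`. For
every other node the matrices involve only labels with `|a| < n`, which `Z` fixes. -/
theorem phi_vec (hD : D.family = .B ∨ D.family = .D) (v : Lˣ) {i j : ℤ} (hi : 0 ≤ i)
    (hi' : i ≤ D.n) (hj : j = if i = 0 then 1 else if i = 1 then 0 else i) :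
    D.vecX L v i * D.rotGenMatrix L v .phi = D.rotGenMatrix L v .phi * D.vecX L v j ∧
    D.vecY L v i * D.rotGenMatrix L v .phi = D.rotGenMatrix L v .phi * D.vecY L v j := by
  have hm := monomial_phi hD v
  have hn : 2 ≤ D.n := by
    obtain ⟨fam, n, h⟩ := D
    rcases hD with hD | hD <;> simp only at hD <;> subst hD <;> simp only at h ⊢ <;> omega
  have mem : ∀ a : ℤ, -D.n ≤ a → a ≤ D.n → (a = 0 → D.family = .B) → a ∈ D.basisSet := by
    intro a h1 h2 h3
    rw [mem_basisSet]
    obtain ⟨fam, n, h⟩ := D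
    rcases hD with hD | hD <;> simp only at hD <;> subst hD <;> simp only at h1 h2 h3 ⊢
    · exact ⟨h1, h2⟩
    · exact ⟨fun h => by simpa using h3 h, h1, h2⟩
  -- The labels strictly between `-n` and `n` are fixed with scalar `1`. The last condition is there
  -- because `0` is a label in type `B` only.
  have r0 : ∀ s t : ℤ, -D.n < t → t < D.n → (t = 0 → D.family = .B) →
      D.E L s t * D.rotGenMatrix L v .phi = D.E L s t := fun s t h h' h0 => by
    have e1 : t ≠ D.n := by omega
    have e2 : t ≠ -D.n := by omega
    rw [hm.E_mul s (mem t (by omega) (by omega) h0) (by rw [if_neg e1, if_neg e2]), if_neg e1,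
      if_neg e2, one_smul]
  have l0 : ∀ s t : ℤ, -D.n < s → s < D.n → (s = 0 → D.family = .B) →
      D.rotGenMatrix L v .phi * D.E L s t = D.E L s t := fun s t h h' h0 => by
    have e1 : s ≠ D.n := by omega
    have e2 : s ≠ -D.n := by omega
    rw [hm.mul_E t (mem s (by omega) (by omega) h0) (by rw [if_neg e1, if_neg e2]), if_neg e1,
      if_neg e2, one_smul]
  have en : -(D.n : ℤ) ≠ D.n := by omega
  have r1 : ∀ s : ℤ, D.E L s (-D.n) * D.rotGenMatrix L v .phi =
      -(((v⁻¹ : Lˣ) : L) • D.E L s D.n) := fun s => by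
    rw [hm.E_mul s (mem D.n (by omega) (by omega) (by omega)) (if_pos rfl), if_pos rfl, neg_smul]
  have l1 : ∀ t : ℤ, D.rotGenMatrix L v .phi * D.E L D.n t =
      -(((v⁻¹ : Lˣ) : L) • D.E L (-D.n) t) := fun t => by
    rw [hm.mul_E t (mem D.n (by omega) (by omega) (by omega)) (if_pos rfl), if_pos rfl, neg_smul]
  have r2 : ∀ s : ℤ, D.E L s D.n * D.rotGenMatrix L v .phi =
      -((v : L) • D.E L s (-D.n)) := fun s => by
    rw [hm.E_mul s (mem (-D.n) (by omega) (by omega) (by omega)) (by rw [if_neg en, if_pos rfl]),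
      if_neg en, if_pos rfl, neg_smul]
  have l2 : ∀ t : ℤ, D.rotGenMatrix L v .phi * D.E L (-D.n) t =
      -((v : L) • D.E L D.n t) := fun t => by
    rw [hm.mul_E t (mem (-D.n) (by omega) (by omega) (by omega)) (by rw [if_neg en, if_pos rfl]),
      if_neg en, if_pos rfl, neg_smul]
  have hF : ∀ a b, D.F L a b = D.E L a b - D.E L (-b) (-a) :=
    D.F_eq_P L (by rcases hD with h | h <;> simp [h])
  have nn : (D.n : ℤ) ≠ 0 := by omega
  have nn' : (1 : ℤ) ≠ D.n := by omega
  -- The inner labels `±(n-1)` of the nodes `0` and `1` are nonzero and fixed, as `n ≥ 2`.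
  have a1 : ∀ s, D.E L s (D.n - 1) * D.rotGenMatrix L v .phi = D.E L s (D.n - 1) :=
    fun s => r0 s _ (by omega) (by omega) (by omega)
  have a2 : ∀ s, D.E L s (-D.n + 1) * D.rotGenMatrix L v .phi = D.E L s (-D.n + 1) :=
    fun s => r0 s _ (by omega) (by omega) (by omega)
  have b1 : ∀ s, D.rotGenMatrix L v .phi * D.E L (D.n - 1) s = D.E L (D.n - 1) s :=
    fun s => l0 _ s (by omega) (by omega) (by omega)
  have b2 : ∀ s, D.rotGenMatrix L v .phi * D.E L (-D.n + 1) s = D.E L (-D.n + 1) s :=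
    fun s => l0 _ s (by omega) (by omega) (by omega)
  have n1 : -((D.n : ℤ) - 1) = -D.n + 1 := by ring
  have n2 : -(-(D.n : ℤ) + 1) = D.n - 1 := by ring
  have x0 : D.vecX L v 0 = (v : L) • D.F L (D.n - 1) (-D.n) := by
    obtain ⟨fam, n, h⟩ := D
    rcases hD with hD | hD <;> simp only at hD <;> subst hD <;> rfl
  have y0 : D.vecY L v 0 = ((v⁻¹ : Lˣ) : L) • D.F L (-D.n) (D.n - 1) := by
    obtain ⟨fam, n, h⟩ := D
    rcases hD with hD | hD <;> simp only at hD <;> subst hD <;> rfl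
  have xi : ∀ i : ℤ, i ≠ 0 → i ≠ D.n →
      D.vecX L v i = D.F L (-(D.n + 1 - i)) (-(D.n + 1 - i) + 1) := by
    intro i h0 h1
    obtain ⟨fam, n, h⟩ := D
    rcases hD with hD | hD <;> simp only at hD <;> subst hD <;> simp only [vecX] <;>
      rw [if_neg h0, if_neg h1]
  have yi : ∀ i : ℤ, i ≠ 0 → i ≠ D.n →
      D.vecY L v i = D.F L (-(D.n + 1 - i) + 1) (-(D.n + 1 - i)) := by
    intro i h0 h1
    obtain ⟨fam, n, h⟩ := D
    rcases hD with hD | hD <;> simp only at hD <;> subst hD <;> simp only [vecY] <;>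
      rw [if_neg h0, if_neg h1]
  -- For `i = 0` the factor `v^{±1}` of the generator meets the entry of `Z` at the labels `±n`: it
  -- cancels in one of the two terms and survives in the other, where `Z` produces it on the
  -- right-hand side.
  by_cases c0 : i = 0
  · obtain rfl : j = 1 := by rw [hj, if_pos c0]
    rw [c0, x0, y0, xi 1 one_ne_zero nn', yi 1 one_ne_zero nn', add_sub_cancel_right]
    simp only [hF, neg_neg, n1, n2, smul_mul_assoc, sub_mul, mul_sub, r1, r2, l1, l2, a1, a2, b1,
      b2, smul_sub, smul_neg, smul_smul, Units.mul_inv, Units.inv_mul, one_smul]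
    constructor <;> abel
  -- This is the mirror image of the case `i = 0`: now the generator carrying `v^{±1}` stands to the
  -- right of `Z`.
  by_cases c1 : i = 1
  · obtain rfl : j = 0 := by rw [hj, if_neg c0, if_pos c1]
    rw [c1, x0, y0, xi 1 one_ne_zero nn', yi 1 one_ne_zero nn', add_sub_cancel_right]
    simp only [hF, neg_neg, n1, n2, mul_smul_comm, sub_mul, mul_sub, r1, r2, l1, l2, a1, a2, b1,
      b2, smul_sub, smul_neg, smul_smul, Units.mul_inv, Units.inv_mul, one_smul]
    constructor <;> abel
  obtain rfl : j = i := by rw [hj, if_neg c0, if_neg c1]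
  -- From here on the node is fixed by `φ₁`, and it remains to see that its matrices commute with
  -- `Z`.
  by_cases cn : j = D.n
  · subst cn
    obtain ⟨fam, n, h⟩ := D
    rcases hD with hD | hD <;> simp only at hD <;> subst hD <;> simp only at h hn c1 c0
    -- In type `B` the node `n` uses the labels `-1, 0, 1`, which lie inside the fixed range because
    -- `n ≥ 2`.
    · have e : ∀ s t : ℤ, -1 ≤ t → t ≤ 1 → _ :=
        fun s t h1 h2 => r0 s t (by simp only; omega) (by simp only; omega) (fun _ => rfl)
      have f : ∀ s t : ℤ, -1 ≤ s → s ≤ 1 → _ :=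
        fun s t h1 h2 => l0 s t (by simp only; omega) (by simp only; omega) (fun _ => rfl)
      simp only [vecX, vecY, c0, if_false, if_true, smul_mul_assoc, mul_smul_comm, sub_mul, mul_sub]
      rw [e, e, e, e, f, f, f, f] <;> simp
    -- In type `D` the node `n` uses the labels `±1, ±2`, and `n ≥ 3` keeps them away from `±n`.
    · have e : ∀ s t : ℤ, -2 ≤ t → t ≤ 2 → t ≠ 0 → _ :=
        fun s t h1 h2 h3 => r0 s t (by simp only; omega) (by simp only; omega) (fun h => absurd h h3)
      have f : ∀ s t : ℤ, -2 ≤ s → s ≤ 2 → s ≠ 0 → _ :=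
        fun s t h1 h2 h3 => l0 s t (by simp only; omega) (by simp only; omega) (fun h => absurd h h3)
      simp only [vecX, vecY, c0, if_false, if_true, hF, sub_mul, mul_sub]
      rw [e, e, e, e, f, f, f, f] <;> simp
  · rw [xi j c0 cn, yi j c0 cn]
    simp only [hF, sub_mul, mul_sub]
    rw [r0, r0, r0, r0, l0, l0, l0, l0] <;> first | omega | simp

/-- The shift by `n + 1` carries the two terms of `F_{ab}` for node `n - i` to the two terms for
node `i` in reversed order. The resulting discrepancy of sign is absorbed by the alternating signs
in `Z`. The end nodes `0` and `n` determine the scalar `-ϑv` on the negative labels. -/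
theorem pi_vec (hD : D.family = .C ∨ D.family = .D) (v : Lˣ) {i j : ℤ} (hi : 0 ≤ i)
    (hi' : i ≤ D.n) (hj : j = D.n - i) :
    D.vecX L v i * D.rotGenMatrix L v .pi = D.rotGenMatrix L v .pi * D.vecX L v j ∧
    D.vecY L v i * D.rotGenMatrix L v .pi = D.rotGenMatrix L v .pi * D.vecY L v j := by
  have hm := monomial_pi hD v
  have mem : ∀ a : ℤ, a ≠ 0 → -D.n ≤ a → a ≤ D.n → a ∈ D.basisSet := by
    intro a h1 h2 h3
    rw [mem_basisSet]
    obtain ⟨fam, n, h⟩ := D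
    rcases hD with hD | hD <;> simp only at hD <;> subst hD <;> exact ⟨h1, h2, h3⟩
  -- `r1` and `l1` treat a positive label of the source of `Z`, with scalar the bare sign; `r2` and
  -- `l2` treat a negative one, with the additional factor `-ϑv`. The shifted index is a variable so
  -- that it can be given in simplified form.
  have r1 : ∀ s t t' : ℤ, t' = t - (D.n + 1) → 0 < t → t ≤ D.n →
      D.E L s t' * D.rotGenMatrix L v .pi = piSign L t • D.E L s t := fun s t t' e h h' => by
    rw [hm.E_mul s (mem t h.ne' (by omega) h') (by rw [if_neg h.not_gt, e]), if_neg h.not_gt,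
      mul_one]
  have r2 : ∀ s t t' : ℤ, t' = t + (D.n + 1) → t < 0 → -D.n ≤ t →
      D.E L s t' * D.rotGenMatrix L v .pi = (piSign L t * D.signPi L v) • D.E L s t :=
    fun s t t' e h h' => by
      rw [hm.E_mul s (mem t h.ne h' (by omega)) (by rw [if_pos h, e]), if_pos h]
  have l1 : ∀ s t s' : ℤ, s' = s - (D.n + 1) → 0 < s → s ≤ D.n →
      D.rotGenMatrix L v .pi * D.E L s t = piSign L s • D.E L s' t := fun s t s' e h h' => by
    rw [hm.mul_E (s' := s') t (mem s h.ne' (by omega) h') (by rw [if_neg h.not_gt, e]), if_neg h.not_gt,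
      mul_one]
  have l2 : ∀ s t s' : ℤ, s' = s + (D.n + 1) → s < 0 → -D.n ≤ s →
      D.rotGenMatrix L v .pi * D.E L s t = (piSign L s * D.signPi L v) • D.E L s' t :=
    fun s t s' e h h' => by
      rw [hm.mul_E (s' := s') t (mem s h.ne h' (by omega)) (by rw [if_pos h, e]), if_pos h]
  -- In type `C` one has `F_{a,-a} = 2 E_{a,-a}`, which cancels the factor `1/2` in the generators
  -- of the end nodes.
  have half : ∀ (u : L) (M : Matrix D.Basis D.Basis L), (2⁻¹ : Kq) • u • (M + M) = u • M :=
    fun u M => by rw [smul_add, two_half_smul]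
  have s1 : piSign L 1 = 1 := piSign_one
  have s1' : piSign L (-1) = 1 := by rw [piSign_neg, s1]
  have s2 : piSign L 2 = -1 := by
    rw [← one_add_one_eq_two, piSign_add_one, s1]
  have s2' : piSign L (-2) = -1 := by rw [piSign_neg, s2]
  by_cases c0 : i = 0
  · obtain rfl : j = D.n := by omega
    obtain ⟨fam, n, h⟩ := D
    rcases hD with hD | hD <;> simp only at hD <;> subst hD <;> simp only at h
    · have n0 : (n : ℤ) ≠ 0 := by omega
      have e := F_C ⟨.C, n, h⟩ L rfl (a := n) n0
      have e' := F_C ⟨.C, n, h⟩ L rfl (a := -n) (by omega)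
      have f := F_C ⟨.C, n, h⟩ L rfl (a := 1) one_ne_zero
      have f' := F_C ⟨.C, n, h⟩ L rfl (a := -1) (by omega)
      rw [neg_neg] at e' f'
      simp only [vecX, vecY, c0, if_true, n0, if_false, e, e', f, f', half, two_half_smul,
        smul_mul_assoc]
      rw [r1 n 1 (-n) (by simp only; omega) (by omega) (by simp only; omega),
        r2 (-n) (-1) n (by simp only; omega) (by omega) (by simp only; omega),
        l1 1 (-1) (-n) (by simp only; omega) (by omega) (by simp only; omega),
        l2 (-1) 1 n (by simp only; omega) (by omega) (by simp only; omega)]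
      -- In type `C` both sides of the relation for `x_0` are `v E_{n,1}`: on the left `v` comes
      -- from `x_0`, on the right from `-ϑv = v`.
      simp [s1, s1', signPi, smul_smul]
    · have n0 : (n : ℤ) ≠ 0 := by omega
      have hF : ∀ a b, F ⟨.D, n, h⟩ L a b = E ⟨.D, n, h⟩ L a b - E ⟨.D, n, h⟩ L (-b) (-a) :=
        F_eq_P _ L (by simp)
      simp only [vecX, vecY, c0, if_true, n0, if_false, hF, smul_mul_assoc, sub_mul, mul_sub,
        neg_neg]
      rw [r1 _ 1 (-n) (by simp only; omega) (by omega) (by simp only; omega),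
        r1 _ 2 (-((n : ℤ) - 1)) (by simp only; omega) (by omega) (by simp only; omega),
        r2 _ (-1) n (by simp only; omega) (by omega) (by simp only; omega),
        r2 _ (-2) (n - 1) (by simp only; omega) (by omega) (by simp only; omega),
        l1 1 _ (-n) (by simp only; omega) (by omega) (by simp only; omega),
        l1 2 _ (-((n : ℤ) - 1)) (by simp only; omega) (by omega) (by simp only; omega),
        l2 (-1) _ n (by simp only; omega) (by omega) (by simp only; omega),
        l2 (-2) _ (n - 1) (by simp only; omega) (by omega) (by simp only; omega)]
      -- In type `D` both sides for `x_0` are `v (E_{n-1,1} + E_{n,2})`. The labels `1` and `2`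
      -- carry opposite signs, which removes the minus inside `F`; on the right the extra minus is
      -- that of `-ϑv = -v`.
      simp [s1, s1', s2, s2', signPi, smul_smul]
  by_cases cn : i = D.n
  · obtain rfl : j = 0 := by omega
    obtain ⟨fam, n, h⟩ := D
    rcases hD with hD | hD <;> simp only at hD <;> subst hD <;> simp only at h cn
    · have n0 : (n : ℤ) ≠ 0 := by omega
      have e := F_C ⟨.C, n, h⟩ L rfl (a := n) n0
      have e' := F_C ⟨.C, n, h⟩ L rfl (a := -n) (by omega)
      have f := F_C ⟨.C, n, h⟩ L rfl (a := 1) one_ne_zero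
      have f' := F_C ⟨.C, n, h⟩ L rfl (a := -1) (by omega)
      rw [neg_neg] at e' f'
      simp only [vecX, vecY, cn, if_true, n0, if_false, e, e', f, f', half, two_half_smul,
        mul_smul_comm]
      rw [r1 _ n (-1) (by simp only; omega) (by omega) (by simp only; omega),
        r2 _ (-n) 1 (by simp only; omega) (by omega) (by simp only; omega),
        l1 n _ (-1) (by simp only; omega) (by omega) (by simp only; omega),
        l2 (-n) _ 1 (by simp only; omega) (by omega) (by simp only; omega)]
      simp [piSign_neg, signPi, smul_smul, mul_comm, mul_left_comm]
    · have n0 : (n : ℤ) ≠ 0 := by omega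
      have hF : ∀ a b, F ⟨.D, n, h⟩ L a b = E ⟨.D, n, h⟩ L a b - E ⟨.D, n, h⟩ L (-b) (-a) :=
        F_eq_P _ L (by simp)
      simp only [vecX, vecY, cn, if_true, n0, if_false, hF, mul_smul_comm, sub_mul, mul_sub,
        neg_neg]
      rw [r1 _ n (-1) (by simp only; omega) (by omega) (by simp only; omega),
        r1 _ (n - 1) (-2) (by simp only; omega) (by omega) (by simp only; omega),
        r2 _ (-n) 1 (by simp only; omega) (by omega) (by simp only; omega),
        r2 _ (-((n : ℤ) - 1)) 2 (by simp only; omega) (by omega) (by simp only; omega),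
        l1 n _ (-1) (by simp only; omega) (by omega) (by simp only; omega),
        l1 (n - 1) _ (-2) (by simp only; omega) (by omega) (by simp only; omega),
        l2 (-n) _ 1 (by simp only; omega) (by omega) (by simp only; omega),
        l2 (-((n : ℤ) - 1)) _ 2 (by simp only; omega) (by omega) (by simp only; omega)]
      -- All signs are expressed through the one at `n`, which is not evaluated: it occurs as a
      -- common factor on both sides.
      simp only [piSign_neg, piSign_sub_one, signPi, smul_sub, smul_smul, mul_neg, neg_mul, neg_smul,
        neg_neg, smul_neg, mul_left_comm _ (piSign L n), Units.inv_mul,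
        mul_comm (v : L), mul_one, and_self]
  -- For `0 < i < n` both indices of `F_{ab}` are negative, so `ϑ_a ϑ_b = 1` also in the symplectic
  -- case and types `C` and `D` can be treated together.
  · have hF : ∀ a b : ℤ, a < 0 → b < 0 → D.F L a b = D.E L a b - D.E L (-b) (-a) := by
      intro a b ha hb
      rcases hD with h | h
      · exact D.F_eq_P_C L (by
          simp [signZ, h, Int.sign_eq_neg_one_of_neg ha, Int.sign_eq_neg_one_of_neg hb])
      · exact D.F_eq_P L (by simp [h]) a b
    have xi : ∀ i : ℤ, 0 < i → i < D.n → D.vecX L v i =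
        D.E L (i - D.n - 1) (i - D.n) - D.E L (D.n - i) (D.n + 1 - i) := by
      intro i h0 h1
      have := hF (-(D.n + 1 - i)) (-(D.n + 1 - i) + 1) (by omega) (by omega)
      rw [show -((D.n : ℤ) + 1 - i) = i - D.n - 1 by ring, sub_add_cancel,
        show -(i - (D.n : ℤ)) = D.n - i by ring,
        show -(i - (D.n : ℤ) - 1) = D.n + 1 - i by ring] at this
      rw [← this, show i - (D.n : ℤ) - 1 = -(D.n + 1 - i) by ring,
        show i - (D.n : ℤ) = -(D.n + 1 - i) + 1 by ring]
      obtain ⟨fam, n, h⟩ := D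
      rcases hD with hD | hD <;> simp only at hD <;> subst hD <;> simp only [vecX] <;>
        rw [if_neg h0.ne', if_neg h1.ne]
    have yi : ∀ i : ℤ, 0 < i → i < D.n → D.vecY L v i =
        D.E L (i - D.n) (i - D.n - 1) - D.E L (D.n + 1 - i) (D.n - i) := by
      intro i h0 h1
      have := hF (-(D.n + 1 - i) + 1) (-(D.n + 1 - i)) (by omega) (by omega)
      rw [show -((D.n : ℤ) + 1 - i) = i - D.n - 1 by ring, sub_add_cancel,
        show -(i - (D.n : ℤ)) = D.n - i by ring,
        show -(i - (D.n : ℤ) - 1) = D.n + 1 - i by ring] at this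
      rw [← this, show i - (D.n : ℤ) - 1 = -(D.n + 1 - i) by ring,
        show i - (D.n : ℤ) = -(D.n + 1 - i) + 1 by ring]
      obtain ⟨fam, n, h⟩ := D
      rcases hD with hD | hD <;> simp only at hD <;> subst hD <;> simp only [vecY] <;>
        rw [if_neg h0.ne', if_neg h1.ne]
    subst hj
    rw [xi i (by omega) (by omega), yi i (by omega) (by omega), xi (D.n - i) (by omega) (by omega),
      yi (D.n - i) (by omega) (by omega)]
    simp only [sub_mul, mul_sub]
    -- The four indices of the matrices of node `n - i` are `-(i+1)`, `-i`, `i` and `i+1`; these are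
    -- also the labels that the shift carries to the indices of node `i`.
    have t1 : (D.n : ℤ) - i - D.n - 1 = -(i + 1) := by ring
    have t2 : (D.n : ℤ) - i - D.n = -i := by ring
    have t3 : (D.n : ℤ) - (D.n - i) = i := by ring
    have t4 : (D.n : ℤ) + 1 - (D.n - i) = i + 1 := by ring
    rw [t1, t2, t3, t4, r1 _ (i + 1) (i - D.n) (by omega) (by omega) (by omega),
      r1 _ i (i - D.n - 1) (by omega) (by omega) (by omega),
      r2 _ (-i) (D.n + 1 - i) (by omega) (by omega) (by omega),
      r2 _ (-(i + 1)) (D.n - i) (by omega) (by omega) (by omega),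
      l1 (i + 1) _ (i - D.n) (by omega) (by omega) (by omega),
      l1 i _ (i - D.n - 1) (by omega) (by omega) (by omega),
      l2 (-i) _ (D.n + 1 - i) (by omega) (by omega) (by omega),
      l2 (-(i + 1)) _ (D.n - i) (by omega) (by omega) (by omega)]
    -- For `x_i` the left-hand side has coefficients given by the signs at `i+1` and, with a minus,
    -- at `i`; on the right these two signs are exchanged. Since consecutive signs are opposite, the
    -- two agree.
    simp only [piSign_neg, piSign_add_one, neg_smul, neg_mul]
    constructor <;> abel

/-! ### Compatibility of rotations with weights -/

/-- This and the next two lemmas say that `Z e_a` has the weight for `k_i` that `e_a` has for the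
`k`-generator of the image node. The scalars of `Z` play no role, only the permutation of labels. -/
theorem kWeight_rho {n : ℕ} (hn) {i j a : ℤ} (hi : 0 ≤ i) (hi' : i ≤ n)
    (hj : j = if i = n then 0 else i + 1) (ha : a ∈ (⟨.A, n, hn⟩ : Datum).basisSet) :
    (⟨.A, n, hn⟩ : Datum).kWeight i (if a = 1 then n + 1 else a - 1) =
      (⟨.A, n, hn⟩ : Datum).kWeight j a := by
  have h1 : 1 ≤ n := hn
  rw [mem_basisSet] at ha
  simp only [kWeight, eDiag] at ha ⊢
  omega

theorem kWeight_phi (hD : D.family = .B ∨ D.family = .D) {i j a : ℤ} (hi : 0 ≤ i)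
    (hi' : i ≤ D.n) (hj : j = if i = 0 then 1 else if i = 1 then 0 else i)
    (ha : a ∈ D.basisSet) :
    D.kWeight i (if a = D.n then -D.n else if a = -D.n then D.n else a) = D.kWeight j a := by
  rw [mem_basisSet] at ha
  obtain ⟨fam, n, h⟩ := D
  rcases hD with hD | hD <;> simp only at hD <;> subst hD <;> simp only at h ha hi' ⊢ <;>
    simp only [kWeight, fDiag, eDiag] <;> subst hj <;> omega

theorem kWeight_pi (hD : D.family = .C ∨ D.family = .D) {i j a : ℤ} (hi : 0 ≤ i)
    (hi' : i ≤ D.n) (hj : j = D.n - i) (ha : a ∈ D.basisSet) :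
    D.kWeight i (if a < 0 then a + (D.n + 1) else a - (D.n + 1)) = D.kWeight j a := by
  rw [mem_basisSet] at ha
  obtain ⟨fam, n, h⟩ := D
  rcases hD with hD | hD <;> simp only at hD <;> subst hD <;> simp only at h ha hi' ⊢ <;>
    simp only [kWeight, fDiag, eDiag] <;> subst hj <;> by_cases h0 : a < 0 <;>
    simp only [h0, if_true, if_false] <;> omega

/-! ### The intertwining relation for generators, words and the whole algebra -/

/-- This gathers what a single monomial matrix must satisfy, uniformly in the Lie type: the
relations for `x_i` and `y_i` are checked directly, while those for `k_i` and `k_i⁻¹` reduce to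
weights, the latter with opposite sign. -/
theorem vecGen_mul_of {Z : Matrix D.Basis D.Basis L} {f : ℤ → ℤ} {c : ℤ → L}
    (hZ : D.Monomial Z f c) {v : Lˣ} {σ : Equiv.Perm D.I}
    (hxy : ∀ i : D.I, D.vecX L v (i : ℕ) * Z = Z * D.vecX L v (σ i : ℕ) ∧
      D.vecY L v (i : ℕ) * Z = Z * D.vecY L v (σ i : ℕ))
    (hw : ∀ i : D.I, ∀ a ∈ D.basisSet,
      D.kWeight (i : ℕ) (f a) = D.kWeight (σ i : ℕ) a) (a : Gen D.I) :
    D.vecGen L v a * Z = Z * D.vecGen L v (D.permGen σ a) := by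
  cases a with
  | x i => exact (hxy i).1
  | y i => exact (hxy i).2
  | k i => exact hZ.diagonal_mul (w := D.kWeight (i : ℕ)) (w' := D.kWeight (σ i : ℕ)) (hw i)
  | kinv i =>
    exact hZ.diagonal_mul (w := fun a => -D.kWeight (i : ℕ) a)
      (w' := fun a => -D.kWeight (σ i : ℕ) a) fun a ha => congrArg Neg.neg (hw i a ha)

/-- On generators, the rotation matrix `Z^g(v)` conjugates `T_v` to `T_v ∘ g`. -/
theorem vecGen_mul_rotGenMatrix (v : Lˣ) {g : Rot} (hg : g ∈ D.rotGens) (a : Gen D.I) :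
    D.vecGen L v a * D.rotGenMatrix L v g =
      D.rotGenMatrix L v g * D.vecGen L v (D.permGen (D.rotPerm g) a) := by
  have hi : ∀ i : D.I, ((i : ℕ) : ℤ) ≤ D.n := fun i => by have := i.2; omega
  have phi : D.family = .B ∨ D.family = .D → D.vecGen L v a * D.rotGenMatrix L v .phi =
      D.rotGenMatrix L v .phi * D.vecGen L v (D.permGen (D.rotPerm .phi) a) := by
    intro hD
    have hn : 1 ≤ D.n := by
      obtain ⟨fam, n, h⟩ := D
      rcases hD with hD | hD <;> simp only at hD <;> subst hD <;> simp only at h ⊢ <;> omega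
    exact vecGen_mul_of (monomial_phi hD v)
      (fun i => phi_vec hD v (by omega) (hi i) (phi_val hn i))
      (fun i a ha => kWeight_phi hD (by omega) (hi i) (phi_val hn i) ha) a
  have pi : D.family = .C ∨ D.family = .D → D.vecGen L v a * D.rotGenMatrix L v .pi =
      D.rotGenMatrix L v .pi * D.vecGen L v (D.permGen (D.rotPerm .pi) a) := fun hD =>
    vecGen_mul_of (monomial_pi hD v) (fun i => pi_vec hD v (by omega) (hi i) (pi_val i))
      (fun i a ha => kWeight_pi hD (by omega) (hi i) (pi_val i) ha) a
  obtain ⟨fam, n, h⟩ := D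
  cases fam
  · obtain rfl : g = .rho := hg
    exact vecGen_mul_of (monomial_rho h v)
      (fun i => rho_vec h v (by omega) (hi i) (rho_val i))
      (fun i a ha => kWeight_rho h (by omega) (hi i) (rho_val i) ha) a
  · obtain rfl : g = .phi := hg
    exact phi (Or.inl rfl)
  · obtain rfl : g = .pi := hg
    exact pi (Or.inl rfl)
  · rcases hg with rfl | rfl
    · exact phi (Or.inr rfl)
    · exact pi (Or.inr rfl)

/-- The leftmost factor of the matrix product is met first, so its permutation is applied first to
the generator. This is the convention by which words represent permutations, and it is what makes
`σ`, rather than its inverse, appear on the right. -/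
theorem vecGen_mul_wordMatrix (v : Lˣ) : ∀ (w : List Rot), (∀ g ∈ w, g ∈ D.rotGens) →
    ∀ a : Gen D.I, D.vecGen L v a * D.wordMatrix L v w =
      D.wordMatrix L v w * D.vecGen L v (D.permGen (D.wordPerm w) a)
  | [], _, a => by
    rw [wordMatrix, wordPerm, mul_one, one_mul]
    cases a <;> rfl
  | g :: w, hw, a => by
    -- The head `g` of the word acts on the generator before the rest of the word does.
    have e : D.permGen (D.wordPerm (g :: w)) a =
        D.permGen (D.wordPerm w) (D.permGen (D.rotPerm g) a) := by cases a <;> rfl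
    rw [wordMatrix, e, ← mul_assoc, vecGen_mul_rotGenMatrix v (hw g (by simp)), mul_assoc,
      vecGen_mul_wordMatrix v w (fun g' h => hw g' (by simp [h])), mul_assoc]

/-- An intertwining relation for two representations may be checked on generators. -/
theorem intertwine_of_gen {R : Type*} [Ring R] [Algebra Kq R] {φ ψ : D.Uq →ₐ[Kq] R} {Z : R}
    (hZ : IsUnit Z) (h : ∀ g, φ (D.gen g) * Z = Z * ψ (D.gen g)) (b : D.Uq) :
    φ b * Z = Z * ψ b := by
  obtain ⟨U, rfl⟩ := hZ
  -- Conjugation `x ↦ U x U⁻¹` is an algebra endomorphism, so the claim becomes the equality of the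
  -- homomorphisms `φ` and `conj ∘ ψ`, which is decided on generators.
  let conj : R →ₐ[Kq] R := AlgHom.ofLinearMap
    ((LinearMap.mulRight Kq ((U⁻¹ : Rˣ) : R)).comp (LinearMap.mulLeft Kq (U : R)))
    (by simp) (fun x y => by simp [mul_assoc])
  have hc : ∀ x, conj x = U * x * ((U⁻¹ : Rˣ) : R) := fun _ => rfl
  have e : φ = conj.comp ψ := D.hom_ext fun g => by
    rw [AlgHom.comp_apply, hc, ← h, Units.mul_inv_cancel_right]
  rw [e, AlgHom.comp_apply, hc, Units.inv_mul_cancel_right]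

/-- `T_v(b) Z^σ(v) = Z^σ(v) T_v(σ(b))`. -/
theorem vecRep_mul_rotationMatrix (σ : D.Sigma) (v : Lˣ) (b : D.Uq) :
    D.vecRep L v b * D.rotationMatrix L σ.1 v =
      D.rotationMatrix L σ.1 v * D.vecRep L v (D.rotationHom σ b) := by
  refine intertwine_of_gen (ψ := (D.vecRep L v).comp (D.rotationHom σ))
    (D.isUnit_rotationMatrix L σ.1 v) (fun g => ?_) b
  have := vecGen_mul_wordMatrix (L := L) v (D.rotWord σ.1) (D.rotWord_gens σ.1) g
  -- The matrix is defined by a chosen word; that this word represents `σ` is what ties it to the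
  -- action of `σ` on the algebra.
  rw [D.wordPerm_rotWord σ.2] at this
  rw [AlgHom.comp_apply, rotationHom, diagramHom, lift_gen, vecRep, lift_gen, lift_gen]
  exact this

/-- The formulas for `S` on generators use only the node at hand, so relabelling nodes commutes with
them. Viewing `S` as a homomorphism to the opposite algebra makes a check on generators sufficient.
-/
theorem antipode_diagramHom (σ : D.Aut) (b : D.Uq) :
    D.antipode (D.diagramHom σ b) = D.diagramHom σ (D.antipode b) := by
  have e : D.antipodeHom.comp (D.diagramHom σ) =
      (AlgHom.op (D.diagramHom σ)).comp D.antipodeHom := D.hom_ext fun g => by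
    cases g <;>
      simp [diagramHom, antipodeHom, antipodeGen, permGen]
  exact congrArg MulOpposite.unop (DFunLike.congr_fun e b)

end Intertwining

end Datum
end
end QPair

/-! ### Transport of the boundary intertwining equations -/

theorem mainTheorem7 (D : Datum) (σ : D.Sigma) (X : Finset D.I) (τ : D.Aut)
    (hX : D.IsGSat X τ) (Istar : Finset D.I) (hIstar : D.IsIstar X τ Istar)
    (c : D.I → Kqˣ) (hc : c ∈ D.setC X τ Istar) (s : D.I → Kq) (hs : s ∈ D.setS X τ Istar)
    (K : Matrix D.Basis D.Basis (RatFunc Kq)) (η : Kqˣ) :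
    (D.Untwisted (D.qpAlgebra X τ c s) K η ↔
      D.Untwisted ((D.qpAlgebra X τ c s).map (D.rotationHom σ))
        ((D.rotationMatrix (RatFunc Kq) σ.1 (Datum.etaDiv η))⁻¹ * K *
          D.rotationMatrix (RatFunc Kq) σ.1 (Datum.etaMul η)) η) ∧
    (D.Twisted (D.qpAlgebra X τ c s) K η ↔
      D.Twisted ((D.qpAlgebra X τ c s).map (D.rotationHom σ))
        ((D.rotationMatrix (RatFunc Kq) σ.1 (Datum.etaDiv η)).transpose * K *
          D.rotationMatrix (RatFunc Kq) σ.1 (Datum.etaMul η)) η) := by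
  have hM := fun b => Datum.vecRep_mul_rotationMatrix σ (Datum.etaMul η) b
  have hN := fun b => Datum.vecRep_mul_rotationMatrix σ (Datum.etaDiv η) b
  have uM := D.isUnit_rotationMatrix (RatFunc Kq) σ.1 (Datum.etaMul η)
  have uN := D.isUnit_rotationMatrix (RatFunc Kq) σ.1 (Datum.etaDiv η)
  set M := D.rotationMatrix (RatFunc Kq) σ.1 (Datum.etaMul η)
  set N := D.rotationMatrix (RatFunc Kq) σ.1 (Datum.etaDiv η)
  have uN' : IsUnit N.det := (Matrix.isUnit_iff_isUnit_det N).1 uN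
  -- The relation for `N`, rewritten for `N⁻¹`: this is the form in which the left factor of `N⁻¹ K
  -- M` is moved past `T_{η/u}(σ(b))`.
  have hN' : ∀ b, D.vecRep (RatFunc Kq) (Datum.etaDiv η) (D.rotationHom σ b) * N⁻¹ =
      N⁻¹ * D.vecRep (RatFunc Kq) (Datum.etaDiv η) b := fun b => by
    apply uN.mul_left_cancel
    rw [← mul_assoc, ← hN, mul_assoc, Matrix.mul_nonsing_inv _ uN', mul_one, ← mul_assoc,
      Matrix.mul_nonsing_inv _ uN', one_mul]
  constructor
  · simp only [Datum.Untwisted, Subalgebra.mem_map, forall_exists_index, and_imp,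
      forall_apply_eq_imp_iff₂]
    -- The elements of the image algebra are the `σ(b)` with `b` in the original one, so the two
    -- equations are compared for each `b` separately. Both sides of the second become `N⁻¹ (…) M`,
    -- and the outer factors cancel.
    refine forall₂_congr fun b _ => ?_
    rw [mul_assoc, ← hM, ← mul_assoc (D.vecRep _ _ _), ← mul_assoc (D.vecRep _ _ _), hN',
      ← mul_assoc, uM.mul_left_inj, mul_assoc, mul_assoc,
      ((Matrix.isUnit_nonsing_inv_iff).2 uN).mul_right_inj]
  · simp only [Datum.Twisted, Subalgebra.mem_map, forall_exists_index, and_imp,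
      forall_apply_eq_imp_iff₂]
    refine forall₂_congr fun b _ => ?_
    have uT : IsUnit N.transpose := (Matrix.isUnit_transpose N).2 uN
    have e : D.antipode (D.rotationHom σ b) = D.rotationHom σ (D.antipode b) :=
      Datum.antipode_diagramHom _ b
    -- The relation for `N` is used at the element `S(b)` and inside a transpose. Transposition
    -- reverses the product, and both sides take the form `Nᵗ (…) M`.
    rw [e, mul_assoc, ← hM, ← mul_assoc (Matrix.transpose _), ← mul_assoc (Matrix.transpose _),
      ← Matrix.transpose_mul, ← hN, Matrix.transpose_mul, ← mul_assoc, uM.mul_left_inj, mul_assoc,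
      mul_assoc, uT.mul_right_inj]
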